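/- Let $L_{10}$ be the even unimodular hyperbolic lattice of rank $10$ (signature $(1,9)$; unique up to isometry), with a basis $e_1,\dots,e_{10}$ such that $\langle e_i,e_i\rangle=-2$ and, for $i\neq j$, $\langle e_i,e_j\rangle=1$ if $\{i,j\}=\{1,4\}$ or $\{i,j\}=\{k,k+1\}$ with $2\le k\le 9$, and $\langle e_i,e_j\rangle=0$ otherwise; this graph on $\{e_1,\dots,e_{10}\}$ is the Dynkin diagram of $E_{10}$. Let $\mathrm{O}^+(L_{10})$ be the group of isometries of $L_{10}$ preserving a positive cone, i.e. a connected component of $\{x\in L_{10}\otimes\mathbb R : \langle x,x\rangle>0\}$. A root is a vector of square-norm $-2$; a root lattice is a lattice (free $\mathbb Z$-module of finite rank with a non-degenerate symmetric bilinear form) generated by its roots. An ADE-configuration of roots in a lattice is a finite set $\Phi$ (possibly empty) of roots with $\langle x,y\rangle\in\{0,1\}$ for distinct $x,y\in\Phi$, such that every connected component of its Dynkin diagram (join $x,y$ when $\langle x,y\rangle=1$) is of type $A_l$ $(l\ge1)$, $D_m$ $(m\ge4)$ or $E_n$ $(n=6,7,8)$; its ADE-type $\tau(\Phi)$ is the formal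 sum of the types of the components. Every negative-definite root lattice $R$ has a basis that is an ADE-configuration, and $\tau(R)$ denotes the ADE-type of such a basis. For an ADE-type $t$ let $R(t)$ be the negative-definite root lattice of type $t$. For an ADE-configuration $\Phi_f\subset L_{10}$ let $R_f$ be the sublattice generated by $\Phi_f$ and $\overline R_f=(R_f\otimes\mathbb Q)\cap L_{10}$ its primitive closure. An even overlattice of a lattice $R$ is a submodule of the dual lattice $R^\vee\subset R\otimes\mathbb Q$ that contains $R$ and on which the form is integral and even. (1) For every ADE-configuration $\Phi_f$ of roots in $L_{10}$, the lattice $\overline R_f$ is a root lattice. Given two ADE-configurations $\Phi_f,\Phi_{f'}\subset L_{10}$ of roots, there is $g\in \mathrm{O}^+(L_{10})$ with $g(\Phi_f)=\Phi_{f'}$ if and only if $\tau(\Phi_f)=\tau(\Phi_{f'})$ and $\tau(\overline R_f)=\tau(\overline R_{f'})$. (2) Let $(t,\bar t)$ be a pair of ADE-types. There is an ADE-configuration $\Phi_f$ of roots in $L_{10}$ with $(\tau(\Phi_f),\tau(\overline R_f))=(t,\bar t)$ if and only if (i) $R(t)$ has rank $<10$, (ii) $R(\bar t)$ is isometric to an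 even overlattice of $R(t)$, and (iii) the Dynkin diagram of $\bar t$ is isomorphic to a full (induced) subdiagram of the Dynkin diagram of $E_{10}$. (3) There are exactly $184$ equivalence classes, under $\mathrm{O}^+(L_{10})$, of non-empty ADE-configurations of roots in $L_{10}$. -/

import Mathlib

namespace ADELattice

open LinearMap (BilinForm)
open scoped TensorProduct

/-! ### ADE-types and their standard Dynkin diagrams -/

/-- The connected ADE Dynkin types `A_l` (`l ≥ 1`), `D_m` (`m ≥ 4`), `E₆`, `E₇`, `E₈`. -/
inductive Label : Type
  | A (l : ℕ) (hl : 1 ≤ l) : Label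
  | D (m : ℕ) (hm : 4 ≤ m) : Label
  | E6 : Label
  | E7 : Label
  | E8 : Label

/-- The number of vertices of the Dynkin diagram. -/
def Label.rank : Label → ℕ
  | .A l _ => l
  | .D m _ => m
  | .E6 => 6
  | .E7 => 7
  | .E8 => 8

/-- The Cartan matrix of a connected ADE-type. -/
def Label.cartan : (X : Label) → Matrix (Fin X.rank) (Fin X.rank) ℤ
  | .A l _ => CartanMatrix.A l
  | .D m _ => CartanMatrix.D m
  | .E6 => CartanMatrix.E₆
  | .E7 => CartanMatrix.E₇
  | .E8 => CartanMatrix.E₈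

/-- The Dynkin diagram of a table `g` of intersection numbers: distinct vertices `i`, `j` are joined
exactly when their intersection number is `1`. -/
def dynkinDiagram {ι : Type*} (g : ι → ι → ℤ) : SimpleGraph ι :=
  SimpleGraph.fromRel fun i j => g i j = 1

/-- The standard Dynkin diagram of a connected ADE-type; in the negative-definite convention the
intersection matrix is minus the Cartan matrix. -/
def Label.diagram (X : Label) : SimpleGraph (Fin X.rank) :=
  dynkinDiagram (-X.cartan)

/-- An ADE-type: a finite formal sum of connected ADE-types. -/
abbrev ADEType : Type := Multiset Label

/-- The ADE-type of a connected component whose Dynkin diagram is a connected ADE-diagram. -/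
noncomputable def componentType {V : Type*} {G : SimpleGraph V} (c : G.ConnectedComponent) :
    ADEType :=
  open Classical in
  if h : ∃ X : Label, Nonempty (c.toSimpleGraph ≃g X.diagram) then {h.choose} else 0

/-- The ADE-type of a finite graph all of whose connected components are connected ADE-diagrams:
the sum of the types of the connected components. -/
noncomputable def graphType {V : Type*} [Finite V] (G : SimpleGraph V) : ADEType :=
  letI : Fintype G.ConnectedComponent := Fintype.ofFinite _
  ∑ c : G.ConnectedComponent, componentType c

/-! ### Lattices, roots and ADE-configurations -/

section Lattice

variable {M : Type*} [AddCommGroup M] [Module ℤ M]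

/-- `(M, B)` is a lattice: `M` is free of finite rank and `B` is symmetric and non-degenerate. -/
structure IsLattice (B : BilinForm ℤ M) : Prop where
  free : Module.Free ℤ M
  finite : Module.Finite ℤ M
  symm : B.IsSymm
  nondegenerate : B.Nondegenerate

/-- A root is a vector of square-norm `-2`. -/
def IsRoot (B : BilinForm ℤ M) (r : M) : Prop := B r r = -2

/-- A root lattice is a lattice generated by its roots. -/
structure IsRootLattice (B : BilinForm ℤ M) : Prop where
  isLattice : IsLattice B
  span_roots : Submodule.span ℤ {r : M | IsRoot B r} = ⊤

/-- The Dynkin diagram of a finite set of vectors. -/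
def configDiagram (B : BilinForm ℤ M) (Φ : Finset M) : SimpleGraph Φ :=
  dynkinDiagram fun x y : Φ => B x y

/-- An ADE-configuration of roots: a finite set of roots whose pairwise intersection numbers are
`0` or `1`, such that each connected component of its Dynkin diagram is of type `A_l`, `D_m` or
`E_n`. -/
structure IsADEConfiguration (B : BilinForm ℤ M) (Φ : Finset M) : Prop where
  isRoot : ∀ x ∈ Φ, IsRoot B x
  pairing : ∀ x ∈ Φ, ∀ y ∈ Φ, x ≠ y → B x y = 0 ∨ B x y = 1
  components : ∀ c : (configDiagram B Φ).ConnectedComponent,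
    ∃ X : Label, Nonempty (c.toSimpleGraph ≃g X.diagram)

/-- The ADE-type `τ(Φ)` of an ADE-configuration. -/
noncomputable def configType (B : BilinForm ℤ M) (Φ : Finset M) : ADEType :=
  graphType (configDiagram B Φ)

/-- An ADE-basis: an ADE-configuration of roots that is a `ℤ`-basis of the lattice. -/
structure IsADEBasis (B : BilinForm ℤ M) (Φ : Finset M) : Prop where
  isADEConfiguration : IsADEConfiguration B Φ
  linearIndependent : LinearIndependent ℤ (fun x : Φ => (x : M))
  span_eq_top : Submodule.span ℤ (Φ : Set M) = ⊤

/-- The ADE-type `τ(R)` of a negative-definite root lattice: the ADE-type of an ADE-basis. -/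
noncomputable def latticeType (B : BilinForm ℤ M) : ADEType :=
  open Classical in
  if h : ∃ Φ : Finset M, IsADEBasis B Φ then configType B h.choose else 0

/-- The image of `M` in `M ⊗ ℚ`. -/
def rationalImage (M : Type*) [AddCommGroup M] [Module ℤ M] : Submodule ℤ (ℚ ⊗[ℤ] M) :=
  LinearMap.range (TensorProduct.mk ℤ ℚ M 1)

/-- The dual lattice inside `M ⊗ ℚ`: the vectors pairing integrally with all of `M`. -/
noncomputable def dualLattice (B : BilinForm ℤ M) : Submodule ℤ (ℚ ⊗[ℤ] M) :=
  (B.baseChange ℚ).dualSubmodule (rationalImage M)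

/-- An even overlattice of `(M, B)`: a submodule `N` of the dual lattice that contains `M` and on
which the rational form takes integral values, with even square-norms. -/
structure IsEvenOverlattice (B : BilinForm ℤ M) (N : Submodule ℤ (ℚ ⊗[ℤ] M)) : Prop where
  le : rationalImage M ≤ N
  le_dual : N ≤ dualLattice B
  integral : ∀ x ∈ N, ∀ y ∈ N, ∃ k : ℤ, B.baseChange ℚ x y = k
  even : ∀ x ∈ N, ∃ k : ℤ, B.baseChange ℚ x x = 2 * k

/-- `(M', B')` is (isometric to) an even overlattice of `(M, B)`. -/
def HasEvenOverlattice (B : BilinForm ℤ M) {M' : Type*} [AddCommGroup M'] [Module ℤ M']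
    (B' : BilinForm ℤ M') : Prop :=
  ∃ N : Submodule ℤ (ℚ ⊗[ℤ] M), IsEvenOverlattice B N ∧
    ∃ φ : M' ≃ₗ[ℤ] N, ∀ x y : M', B.baseChange ℚ (φ x : ℚ ⊗[ℤ] M) (φ y) = (B' x y : ℚ)

/-- The primitive closure of `R` in `M`: the intersection of `R ⊗ ℚ` and `M` in `M ⊗ ℚ`. -/
def primitiveClosure (R : Submodule ℤ M) : Submodule ℤ M :=
  ((R.baseChange ℚ).restrictScalars ℤ).comap (TensorProduct.mk ℤ ℚ M 1)

end Lattice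

/-! ### The negative-definite root lattice `R(t)` -/

noncomputable instance : DecidableEq Label := Classical.decEq _

/-- The vertices of the Dynkin diagram of the ADE-type `t`: for each summand of `t` (with
multiplicity), the vertices of its diagram. -/
def Vertex (t : ADEType) : Type := (c : t.ToType) × Fin c.1.rank

noncomputable instance (t : ADEType) : DecidableEq t.ToType := Classical.decEq _
noncomputable instance (t : ADEType) : DecidableEq (Vertex t) := Classical.decEq _
noncomputable instance (t : ADEType) : Fintype (Vertex t) :=
  inferInstanceAs (Fintype ((c : t.ToType) × Fin c.1.rank))

/-- The intersection matrix of the ADE-type `t`. -/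
noncomputable def gram (t : ADEType) : Matrix (Vertex t) (Vertex t) ℤ :=
  Matrix.blockDiagonal' fun c : t.ToType => -c.1.cartan

/-- The Dynkin diagram of the ADE-type `t`. -/
noncomputable def typeDiagram (t : ADEType) : SimpleGraph (Vertex t) := dynkinDiagram (gram t)

/-- The free `ℤ`-module underlying `R(t)`. -/
abbrev RootLattice (t : ADEType) : Type := Vertex t → ℤ

/-- The form of the negative-definite root lattice `R(t)`. -/
noncomputable def rootForm (t : ADEType) : BilinForm ℤ (RootLattice t) :=
  Matrix.toBilin' (gram t)

/-! ### The lattice `L₁₀` -/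

/-- The intersection matrix of the roots `e₁, …, e₁₀` (indexed by `0, …, 9`): the Dynkin diagram is
the chain `e₂ - e₃ - ⋯ - e₁₀` together with `e₁` joined to `e₄`. -/
def gramE10 : Matrix (Fin 10) (Fin 10) ℤ :=
  !![-2,  0,  0,  1,  0,  0,  0,  0,  0,  0;
      0, -2,  1,  0,  0,  0,  0,  0,  0,  0;
      0,  1, -2,  1,  0,  0,  0,  0,  0,  0;
      1,  0,  1, -2,  1,  0,  0,  0,  0,  0;
      0,  0,  0,  1, -2,  1,  0,  0,  0,  0;
      0,  0,  0,  0,  1, -2,  1,  0,  0,  0;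
      0,  0,  0,  0,  0,  1, -2,  1,  0,  0;
      0,  0,  0,  0,  0,  0,  1, -2,  1,  0;
      0,  0,  0,  0,  0,  0,  0,  1, -2,  1;
      0,  0,  0,  0,  0,  0,  0,  0,  1, -2]

/-- The Dynkin diagram of `E₁₀`. -/
def diagramE10 : SimpleGraph (Fin 10) := dynkinDiagram gramE10

/-- The free `ℤ`-module of rank `10` underlying `L₁₀`, with standard basis `e₁, …, e₁₀`. -/
abbrev L10 : Type := Fin 10 → ℤ

/-- The form of `L₁₀`. -/
noncomputable def form10 : BilinForm ℤ L10 := Matrix.toBilin' gramE10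

/-- The form on `L₁₀ ⊗ ℝ = ℝ¹⁰`. -/
noncomputable def form10R : BilinForm ℝ (Fin 10 → ℝ) :=
  Matrix.toBilin' (gramE10.map (fun n : ℤ => (n : ℝ)))

/-- The vector `c₀ = e₁^∨ + ⋯ + e₁₀^∨`. -/
def c0 : L10 := ![115, 76, 153, 231, 195, 160, 126, 93, 61, 30]

theorem gramE10_mulVec_c0 : gramE10.mulVec c0 = 1 := by decide

/-- The positive cone of `L₁₀`: the connected component of `{x | ⟨x, x⟩ > 0}` containing `c₀`. -/
def positiveCone : Set (Fin 10 → ℝ) :=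
  connectedComponentIn {x | 0 < form10R x x} (fun i => (c0 i : ℝ))

/-- The `ℝ`-linear extension to `L₁₀ ⊗ ℝ` of an automorphism of the `ℤ`-module `L₁₀`. -/
noncomputable def extend (g : L10 ≃ₗ[ℤ] L10) : (Fin 10 → ℝ) →ₗ[ℝ] (Fin 10 → ℝ) :=
  Matrix.toLin' ((LinearMap.toMatrix' (g : L10 →ₗ[ℤ] L10)).map (Int.castRingHom ℝ))

theorem extend_one : extend 1 = LinearMap.id := by
  have h : ((1 : L10 ≃ₗ[ℤ] L10) : L10 →ₗ[ℤ] L10) = LinearMap.id := rfl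
  rw [extend, h, LinearMap.toMatrix'_id, Matrix.map_one _ (map_zero _) (map_one _),
    Matrix.toLin'_one]

theorem extend_mul (g h : L10 ≃ₗ[ℤ] L10) : extend (g * h) = extend g ∘ₗ extend h := by
  have e : ((g * h : L10 ≃ₗ[ℤ] L10) : L10 →ₗ[ℤ] L10)
      = (g : L10 →ₗ[ℤ] L10) ∘ₗ (h : L10 →ₗ[ℤ] L10) := rfl
  rw [extend, e, LinearMap.toMatrix'_comp, Matrix.map_mul, Matrix.toLin'_mul]
  rfl

theorem extend_intCast (g : L10 ≃ₗ[ℤ] L10) (v : L10) :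
    extend g (fun i => (v i : ℝ)) = fun i => (g v i : ℝ) := by
  have h : g v = (LinearMap.toMatrix' (g : L10 →ₗ[ℤ] L10)).mulVec v := by
    rw [LinearMap.toMatrix'_mulVec]; rfl
  ext i
  rw [extend, Matrix.toLin'_apply, h]
  simp [Matrix.mulVec, dotProduct]

/-- The group `O⁺(L₁₀)` of isometries of `L₁₀` that preserve the positive cone. -/
def OPlus : Subgroup (L10 ≃ₗ[ℤ] L10) where
  carrier := {g | (∀ x y, form10 (g x) (g y) = form10 x y) ∧
    extend g '' positiveCone = positiveCone}
  one_mem' := ⟨fun _ _ => rfl, by rw [extend_one]; simp⟩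
  mul_mem' := by
    rintro g h ⟨hg, hg'⟩ ⟨hh, hh'⟩
    refine ⟨fun x y => ?_, ?_⟩
    · change form10 (g (h x)) (g (h y)) = _
      rw [hg, hh]
    · rw [extend_mul, LinearMap.coe_comp, Set.image_comp, hh', hg']
  inv_mem' := by
    rintro g ⟨hg, hg'⟩
    refine ⟨fun x y => ?_, ?_⟩
    · rw [← hg]
      change form10 (g (g.symm x)) (g (g.symm y)) = _
      simp
    · conv_lhs => rw [← hg']
      rw [← Set.image_comp, ← LinearMap.coe_comp, ← extend_mul, inv_mul_cancel, extend_one]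
      simp

/-- The sublattice of `L₁₀` generated by `Φ`. -/
def generated (Φ : Finset L10) : Submodule ℤ L10 := Submodule.span ℤ (Φ : Set L10)

/-- The lattice obtained from the primitive closure in `L₁₀` of the sublattice generated by `Φ`, by
restricting the form of `L₁₀`. -/
noncomputable def closureForm (Φ : Finset L10) : BilinForm ℤ (primitiveClosure (generated Φ)) :=
  form10.restrict (primitiveClosure (generated Φ))

/-- Two configurations are equivalent if an element of `O⁺(L₁₀)` maps one onto the other. -/
def Equivalent (Φ Φ' : Finset L10) : Prop :=
  ∃ g ∈ OPlus, g '' (Φ : Set L10) = (Φ' : Set L10)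

theorem equivalent_equivalence : Equivalence Equivalent where
  refl Φ := ⟨1, OPlus.one_mem, by simp⟩
  symm := by
    rintro Φ Ψ ⟨g, hg, h⟩
    refine ⟨g⁻¹, OPlus.inv_mem hg, ?_⟩
    rw [← h, ← Set.image_comp]
    change (fun x => g.symm (g x)) '' _ = _
    simp
  trans := by
    rintro Φ Ψ Θ ⟨g, hg, h⟩ ⟨g', hg', h'⟩
    refine ⟨g' * g, OPlus.mul_mem hg' hg, ?_⟩
    rw [← h', ← h, ← Set.image_comp]
    rfl

/-- The non-empty ADE-configurations of roots in `L₁₀`. -/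
def Configuration : Type := {Φ : Finset L10 // IsADEConfiguration form10 Φ ∧ Φ.Nonempty}

/-- Equivalence of non-empty ADE-configurations of roots in `L₁₀`. -/
def configurationSetoid : Setoid Configuration where
  r Φ Ψ := Equivalent Φ.1 Ψ.1
  iseqv := equivalent_equivalence.comap Subtype.val

/-! ### `L₁₀` is even, unimodular and hyperbolic -/

theorem form10_apply (x y : L10) : form10 x y =
    ∑ i, ∑ j, x i * gramE10 i j * y j := by
  simp [form10, Matrix.toBilin'_apply]

theorem even_form10 (x : L10) : Even (form10 x x) := by
  refine ⟨-(x 0 ^ 2 + x 1 ^ 2 + x 2 ^ 2 + x 3 ^ 2 + x 4 ^ 2 + x 5 ^ 2 + x 6 ^ 2 + x 7 ^ 2 +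
    x 8 ^ 2 + x 9 ^ 2) + (x 0 * x 3 + x 1 * x 2 + x 2 * x 3 + x 3 * x 4 + x 4 * x 5 + x 5 * x 6 +
    x 6 * x 7 + x 7 * x 8 + x 8 * x 9), ?_⟩
  rw [form10_apply]
  simp [Fin.sum_univ_succ, gramE10, Fin.succ]
  ring

theorem isUnit_det_gramE10 : IsUnit gramE10.det := by
  let P : Matrix (Fin 10) (Fin 10) ℤ :=
    !![10,  7, 14, 21, 18, 15, 12,  9,  6,  3;
        7,  4,  9, 14, 12, 10,  8,  6,  4,  2;
       14,  9, 18, 28, 24, 20, 16, 12,  8,  4;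
       21, 14, 28, 42, 36, 30, 24, 18, 12,  6;
       18, 12, 24, 36, 30, 25, 20, 15, 10,  5;
       15, 10, 20, 30, 25, 20, 16, 12,  8,  4;
       12,  8, 16, 24, 20, 16, 12,  9,  6,  3;
        9,  6, 12, 18, 15, 12,  9,  6,  4,  2;
        6,  4,  8, 12, 10,  8,  6,  4,  2,  1;
        3,  2,  4,  6,  5,  4,  3,  2,  1,  0]
  have h : gramE10 * P = 1 := by decide
  exact (Matrix.isUnit_iff_isUnit_det _).1 (IsUnit.of_mul_eq_one _ h)

/-- The real form of `L₁₀` diagonalised by completing squares. -/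
theorem form10R_equivalent : QuadraticMap.Equivalent form10R.toQuadraticMap
    (QuadraticMap.weightedSumSquares ℝ
      (![-2, -2, -3/2, 1/42, -7/6, -6/5, -5/4, -4/3, -3/2, -2] : Fin 10 → ℝ)) := by
  refine ⟨⟨{ toFun := fun x => ![x 0 - x 3 / 2, x 1 - x 2 / 2, x 2 - 2 / 3 * x 3, x 3,
              x 4 - 6 / 7 * x 3, x 5 - 5 / 6 * x 4, x 6 - 4 / 5 * x 5, x 7 - 3 / 4 * x 6,
              x 8 - 2 / 3 * x 7, x 9 - x 8 / 2]
             map_add' := ?_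
             map_smul' := ?_
             invFun := fun y =>
              let z4 := y 4 + 6 / 7 * y 3
              let z5 := y 5 + 5 / 6 * z4
              let z6 := y 6 + 4 / 5 * z5
              let z7 := y 7 + 3 / 4 * z6
              let z8 := y 8 + 2 / 3 * z7
              let z2 := y 2 + 2 / 3 * y 3
              ![y 0 + y 3 / 2, y 1 + z2 / 2, z2, y 3, z4, z5, z6, z7, z8, y 9 + z8 / 2]
             left_inv := ?_
             right_inv := ?_ }, ?_⟩⟩
  · intro x y
    ext i
    fin_cases i <;> simp <;> ring
  · intro a x
    ext i
    fin_cases i <;> simp <;> ring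
  · intro x
    ext i
    fin_cases i <;> simp
  · intro y
    ext i
    fin_cases i <;> simp
  · intro x
    simp [QuadraticMap.weightedSumSquares_apply, form10R, Matrix.toBilin'_apply,
      Fin.sum_univ_succ, gramE10, Fin.succ]
    ring

/-- `L₁₀` has signature `(1, 9)`. -/
theorem signature_form10R :
    sigPos form10R.toQuadraticMap = 1 ∧ sigNeg form10R.toQuadraticMap = 9 := by
  constructor
  · rw [QuadraticForm.sigPos_of_equiv_weightedSumSquares form10R_equivalent]
    have h : {i | (0 : ℝ) < (![-2, -2, -3/2, 1/42, -7/6, -6/5, -5/4, -4/3, -3/2, -2] :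
        Fin 10 → ℝ) i} = (({3} : Finset (Fin 10)) : Set (Fin 10)) := by
      ext i
      fin_cases i <;> simp
    rw [h, Set.ncard_coe_finset]
    rfl
  · rw [QuadraticForm.sigNeg_of_equiv_weightedSumSquares form10R_equivalent]
    have h : {i | (![-2, -2, -3/2, 1/42, -7/6, -6/5, -5/4, -4/3, -3/2, -2] :
        Fin 10 → ℝ) i < 0} = (({3}ᶜ : Finset (Fin 10)) : Set (Fin 10)) := by
      ext i
      fin_cases i <;> simp <;> norm_num
    rw [h, Set.ncard_coe_finset]
    rfl

end ADELattice

open ADELattice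

/-!
The isometry group acts on simple systems of roots, that is, on ADE-configurations `Φ`, and the
theorem follows from a list of representatives of its orbits. The reflections in the roots lie in
`O⁺(L₁₀)` and suffice for all the conjugations needed.

*Reduction to parabolic subsystems* (`exists_parabolic`). The lattice of `Φ` is negative definite,
hence orthogonal to vectors `h` of the positive cone. Minimising the pairing of `h` with a vector in
the open fundamental chamber over the orbit makes `h` dominant. Because `E₁₀` is a hyperbolic
diagram, every root has coefficients of one sign in the basis (`root_sign`), so the roots orthogonal
to a dominant `h` are spanned by the basis vectors orthogonal to `h`. Choosing `h` with the fewest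
such basis vectors, `Φ` becomes a simple system of full rank in the lattice of a subset `I` of the
basis. That lattice is primitive, so it is the primitive closure.

*Subsystems of full rank* (`exists_borel_de_siebenthal`). If the lattice of `Φ` is a proper
sublattice of full rank of the lattice of a simple system `J`, some functional is divisible by an
integer `T` on `Φ` but not on `J`. Once it is moved into the fundamental alcove, the only values
divisible by `T` that it takes on positive roots are `0` and `T`, the latter only below a highest
root of value `T`. As `Φ` has full rank, the functional then vanishes on all simple roots of some
block of `J` except one, whose multiplicity in the highest root is at least `2`. Hence `Φ` is
conjugate into the lattice obtained by replacing this simple root by the lowest root. The process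
stops when the two lattices agree, and simple systems of the same lattice are conjugate under its
Weyl group by `exists_weyl_image_eq`, which also shows that the type of a root lattice is well
defined (`latticeType_eq`).

*Finite data.* Explicit words in reflections carry each finite-type subset of the basis to one of a
list of subsets, and explicit words identify the results of the steps above within a list of simple
systems; the kernel verifies both by evaluation (`moves_valid`, `reaches_parabolicMasks`,
`families_isComplete`). This leaves `185` representatives, one of them empty
(`exists_representative`), and they differ in the type of the system or of its primitive closure
(`nodup_code`). Parts (1) and (3) follow.

For part (2), the diagram of the primitive closure of a configuration is that of a subset of the
basis, and the primitive closure is an even overlattice (`conditions_of_configuration`). Conversely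
an embedding of the diagram of `t'` into that of `E₁₀` realises `R(t')` as the lattice of a subset
of the basis, which contains `R(t)` with finite index and is primitive (`exists_configuration`).
-/

namespace ADELattice

open LinearMap (BilinForm)
open scoped TensorProduct

/-! ### Dynkin diagrams and ADE-types of graphs -/

theorem Label.rank_pos (X : Label) : 0 < X.rank := by
  cases X <;> simp only [Label.rank] <;> omega

theorem dynkinDiagram_adj {ι : Type*} (g : ι → ι → ℤ) (i j : ι) :
    (dynkinDiagram g).Adj i j ↔ i ≠ j ∧ (g i j = 1 ∨ g j i = 1) :=
  SimpleGraph.fromRel_adj _ _ _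

/-- The Dynkin diagram of a Cartan matrix. -/
def cartanDiagram {ι : Type*} (M : ι → ι → ℤ) : SimpleGraph ι :=
  dynkinDiagram fun i j => -M i j

/-- The entries of a simply laced Cartan matrix. -/
structure IsSimplyLaced {ι : Type*} (M : ι → ι → ℤ) : Prop where
  diag : ∀ i, M i i = 2
  symm : ∀ i j, M i j = M j i
  off_diag : ∀ i j, i ≠ j → M i j = 0 ∨ M i j = -1

theorem IsSimplyLaced.adj {ι : Type*} {M : ι → ι → ℤ} (h : IsSimplyLaced M) (i j : ι) :
    (cartanDiagram M).Adj i j ↔ M i j = -1 := by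
  refine (dynkinDiagram_adj _ i j).trans ?_
  simp only [h.symm j i, or_self]
  constructor
  · rintro ⟨-, h⟩; omega
  · intro h'
    refine ⟨?_, by omega⟩
    rintro rfl
    rw [h.diag] at h'
    omega

theorem isSimplyLaced_A (l : ℕ) : IsSimplyLaced (CartanMatrix.A l) where
  diag i := by simp [CartanMatrix.A]
  symm i j := (CartanMatrix.A_isSymm l).apply j i
  off_diag i j h := by
    simp only [CartanMatrix.A, Matrix.of_apply]; split_ifs <;> simp_all

theorem isSimplyLaced_D (m : ℕ) : IsSimplyLaced (CartanMatrix.D m) where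
  diag i := by simp
  symm i j := (CartanMatrix.D_isSymm m).apply j i
  off_diag i j h := by
    simp only [CartanMatrix.D, Matrix.of_apply]; split_ifs <;> simp_all

/-- The entries of the Cartan matrix of type `E₆`, as a function. -/
def entryE6 (i j : Fin 6) : ℤ := CartanMatrix.E₆ i j

/-- The entries of the Cartan matrix of type `E₇`, as a function. -/
def entryE7 (i j : Fin 7) : ℤ := CartanMatrix.E₇ i j

/-- The entries of the Cartan matrix of type `E₈`, as a function. -/
def entryE8 (i j : Fin 8) : ℤ := CartanMatrix.E₈ i j

theorem isSimplyLaced_E6 : IsSimplyLaced entryE6 :=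
  ⟨by decide, by decide, by decide⟩

theorem isSimplyLaced_E7 : IsSimplyLaced entryE7 :=
  ⟨by decide, by decide, by decide⟩

theorem isSimplyLaced_E8 : IsSimplyLaced entryE8 :=
  ⟨by decide, by decide, by decide⟩

theorem Label.isSimplyLaced (X : Label) : IsSimplyLaced X.cartan := by
  cases X with
  | A l hl => exact isSimplyLaced_A l
  | D m hm => exact isSimplyLaced_D m
  | E6 => exact isSimplyLaced_E6
  | E7 => exact isSimplyLaced_E7
  | E8 => exact isSimplyLaced_E8

theorem Label.diagram_adj (X : Label) (i j : Fin X.rank) :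
    X.diagram.Adj i j ↔ X.cartan i j = -1 :=
  X.isSimplyLaced.adj i j

/-- A graph is connected as soon as every vertex other than a root has a neighbour that is nearer
to the root, as measured by a natural number. -/
theorem connected_of_descending {V : Type*} (G : SimpleGraph V) (r : V) (f : V → ℕ)
    (h : ∀ v, v ≠ r → ∃ w, f w < f v ∧ G.Adj v w) : G.Connected := by
  rw [SimpleGraph.connected_iff_exists_forall_reachable]
  refine ⟨r, fun w => ?_⟩
  induction hn : f w using Nat.strong_induction_on generalizing w with
  | _ n ih =>
    by_cases hw : w = r
    · rw [hw]
    · obtain ⟨u, hu, hadj⟩ := h w hw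
      exact (ih (f u) (hn ▸ hu) u rfl).trans hadj.symm.reachable

theorem connected_A (l : ℕ) (hl : 1 ≤ l) : (cartanDiagram (CartanMatrix.A l)).Connected := by
  refine connected_of_descending _ ⟨0, by omega⟩ (fun i => i.1) fun i hi => ?_
  have hi0 : i.1 ≠ 0 := fun h => hi (Fin.ext h)
  refine ⟨⟨i.1 - 1, by omega⟩, by simp only; omega, ?_⟩
  rw [(isSimplyLaced_A l).adj]
  simp only [CartanMatrix.A, Matrix.of_apply, Fin.ext_iff]
  split_ifs <;> omega

theorem connected_D (m : ℕ) (hm : 4 ≤ m) : (cartanDiagram (CartanMatrix.D m)).Connected := by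
  refine connected_of_descending _ ⟨0, by omega⟩ (fun i => i.1) fun i hi => ?_
  have hi0 : i.1 ≠ 0 := fun h => hi (Fin.ext h)
  by_cases hl : i.1 + 1 = m
  · refine ⟨⟨i.1 - 2, by omega⟩, by simp only; omega, ?_⟩
    rw [(isSimplyLaced_D m).adj]
    simp only [CartanMatrix.D, Matrix.of_apply, Fin.ext_iff]
    split_ifs <;> omega
  · refine ⟨⟨i.1 - 1, by omega⟩, by simp only; omega, ?_⟩
    rw [(isSimplyLaced_D m).adj]
    simp only [CartanMatrix.D, Matrix.of_apply, Fin.ext_iff]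
    split_ifs <;> omega

theorem Label.diagram_connected (X : Label) : X.diagram.Connected := by
  cases X with
  | A l hl => exact connected_A l hl
  | D m hm => exact connected_D m hm
  | E6 =>
    refine connected_of_descending (cartanDiagram entryE6) 3 ![2, 1, 1, 0, 1, 2] ?_
    simp only [isSimplyLaced_E6.adj]
    decide
  | E7 =>
    refine connected_of_descending (cartanDiagram entryE7) 3 ![2, 1, 1, 0, 1, 2, 3] ?_
    simp only [isSimplyLaced_E7.adj]
    decide
  | E8 =>
    refine connected_of_descending (cartanDiagram entryE8) 3
      ![2, 1, 1, 0, 1, 2, 3, 4] ?_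
    simp only [isSimplyLaced_E8.adj]
    decide

/-- The graph has a vertex with three distinct neighbours. -/
def HasBranch {V : Type*} (G : SimpleGraph V) : Prop :=
  ∃ a b c d, b ≠ c ∧ b ≠ d ∧ c ≠ d ∧ G.Adj a b ∧ G.Adj a c ∧ G.Adj a d

/-- The graph has two distinct leaves with a common neighbour. -/
def HasTwinLeaves {V : Type*} (G : SimpleGraph V) : Prop :=
  ∃ a b c, b ≠ c ∧ G.Adj a b ∧ G.Adj a c ∧ (∀ x, G.Adj b x → x = a) ∧ ∀ x, G.Adj c x → x = a

theorem HasBranch.map_iso {V W : Type*} {G : SimpleGraph V} {H : SimpleGraph W} (e : G ≃g H)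
    (h : HasBranch G) : HasBranch H := by
  obtain ⟨a, b, c, d, h1, h2, h3, h4, h5, h6⟩ := h
  exact ⟨e a, e b, e c, e d, by simpa, by simpa, by simpa, e.map_adj_iff.2 h4,
    e.map_adj_iff.2 h5, e.map_adj_iff.2 h6⟩

theorem HasTwinLeaves.map_iso {V W : Type*} {G : SimpleGraph V} {H : SimpleGraph W} (e : G ≃g H)
    (h : HasTwinLeaves G) : HasTwinLeaves H := by
  obtain ⟨a, b, c, h1, h2, h3, h4, h5⟩ := h
  refine ⟨e a, e b, e c, by simpa, e.map_adj_iff.2 h2, e.map_adj_iff.2 h3, fun x hx => ?_,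
    fun x hx => ?_⟩
  · rw [← h4 (e.symm x) (by rw [← e.map_adj_iff]; simpa using hx), e.apply_symm_apply]
  · rw [← h5 (e.symm x) (by rw [← e.map_adj_iff]; simpa using hx), e.apply_symm_apply]

theorem not_hasBranch_A (l : ℕ) : ¬ HasBranch (cartanDiagram (CartanMatrix.A l)) := by
  rintro ⟨a, b, c, d, h1, h2, h3, h4, h5, h6⟩
  rw [(isSimplyLaced_A l).adj] at h4 h5 h6
  have key : ∀ x : Fin l, CartanMatrix.A l a x = -1 →
      a.val + 1 = x.val ∨ x.val + 1 = a.val := by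
    intro x hx
    simp only [CartanMatrix.A, Matrix.of_apply] at hx
    split_ifs at hx with _ h
    exact h
  have hb := key b h4
  have hc := key c h5
  have hd := key d h6
  rw [ne_eq, Fin.ext_iff] at h1 h2 h3
  omega

theorem hasBranch_D (m : ℕ) (hm : 4 ≤ m) : HasBranch (cartanDiagram (CartanMatrix.D m)) := by
  refine ⟨⟨m - 3, by omega⟩, ⟨m - 4, by omega⟩, ⟨m - 2, by omega⟩,
    ⟨m - 1, by omega⟩, ?_, ?_, ?_, ?_, ?_, ?_⟩
  · rw [ne_eq, Fin.ext_iff]; simp only; omega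
  · rw [ne_eq, Fin.ext_iff]; simp only; omega
  · rw [ne_eq, Fin.ext_iff]; simp only; omega
  all_goals
    rw [(isSimplyLaced_D m).adj]
    simp only [CartanMatrix.D, Matrix.of_apply, Fin.ext_iff]
    split_ifs <;> omega

theorem hasTwinLeaves_D (m : ℕ) (hm : 4 ≤ m) :
    HasTwinLeaves (cartanDiagram (CartanMatrix.D m)) := by
  refine ⟨⟨m - 3, by omega⟩, ⟨m - 2, by omega⟩, ⟨m - 1, by omega⟩, ?_, ?_, ?_, ?_, ?_⟩
  · rw [ne_eq, Fin.ext_iff]; simp only; omega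
  · rw [(isSimplyLaced_D m).adj]
    simp only [CartanMatrix.D, Matrix.of_apply, Fin.ext_iff]
    split_ifs <;> omega
  · rw [(isSimplyLaced_D m).adj]
    simp only [CartanMatrix.D, Matrix.of_apply, Fin.ext_iff]
    split_ifs <;> omega
  all_goals
    intro x hx
    rw [(isSimplyLaced_D m).adj] at hx
    simp only [CartanMatrix.D, Matrix.of_apply, Fin.ext_iff] at hx ⊢
    split_ifs at hx <;> omega

/-- A connected ADE-type is determined by its diagram: `A_l` has no branch vertex, and among the
others only `D_m` has two leaves with a common neighbour. -/
theorem Label.eq_of_diagram_iso {X Y : Label} (e : X.diagram ≃g Y.diagram) : X = Y := by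
  have hr : X.rank = Y.rank := by simpa using e.card_eq
  have hb : HasBranch X.diagram ↔ HasBranch Y.diagram :=
    ⟨fun h => h.map_iso e, fun h => h.map_iso e.symm⟩
  have ht : HasTwinLeaves X.diagram ↔ HasTwinLeaves Y.diagram :=
    ⟨fun h => h.map_iso e, fun h => h.map_iso e.symm⟩
  have a1 : ∀ l hl, ¬ HasBranch (Label.A l hl).diagram := fun l _ => not_hasBranch_A l
  have d1 : ∀ m hm, HasBranch (Label.D m hm).diagram := hasBranch_D
  have d2 : ∀ m hm, HasTwinLeaves (Label.D m hm).diagram := hasTwinLeaves_D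
  have b6 : HasBranch (cartanDiagram entryE6) := by
    refine ⟨3, 1, 2, 4, ?_⟩
    simp only [isSimplyLaced_E6.adj]; decide
  have b7 : HasBranch (cartanDiagram entryE7) := by
    refine ⟨3, 1, 2, 4, ?_⟩
    simp only [isSimplyLaced_E7.adj]; decide
  have b8 : HasBranch (cartanDiagram entryE8) := by
    refine ⟨3, 1, 2, 4, ?_⟩
    simp only [isSimplyLaced_E8.adj]; decide
  have t6 : ¬ HasTwinLeaves (cartanDiagram entryE6) := by
    simp only [HasTwinLeaves, isSimplyLaced_E6.adj]
    decide +kernel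
  have t7 : ¬ HasTwinLeaves (cartanDiagram entryE7) := by
    simp only [HasTwinLeaves, isSimplyLaced_E7.adj]
    decide +kernel
  have t8 : ¬ HasTwinLeaves (cartanDiagram entryE8) := by
    simp only [HasTwinLeaves, isSimplyLaced_E8.adj]
    decide +kernel
  replace b6 : HasBranch Label.E6.diagram := b6
  replace b7 : HasBranch Label.E7.diagram := b7
  replace b8 : HasBranch Label.E8.diagram := b8
  replace t6 : ¬ HasTwinLeaves Label.E6.diagram := t6
  replace t7 : ¬ HasTwinLeaves Label.E7.diagram := t7
  replace t8 : ¬ HasTwinLeaves Label.E8.diagram := t8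
  cases X <;> cases Y <;> simp only [a1, d1, d2, b6, b7, b8,
    t6, t7, t8, iff_self, iff_true, iff_false, not_true_eq_false] at hb ht <;>
    simp only [Label.rank] at hr <;> first | (subst hr; rfl) | rfl | omega

/-! ### Disjoint unions of standard diagrams -/

section Sigma

variable {K : Type*} [DecidableEq K]

/-- The intersection matrix of the disjoint union of the diagrams `X k`. -/
def sigmaGram (X : K → Label) :
    Matrix ((k : K) × Fin (X k).rank) ((k : K) × Fin (X k).rank) ℤ :=
  Matrix.blockDiagonal' fun k => -(X k).cartan

/-- The disjoint union of the diagrams `X k`. -/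
def sigmaDiagram (X : K → Label) : SimpleGraph ((k : K) × Fin (X k).rank) :=
  dynkinDiagram (sigmaGram X)

theorem sigmaGram_same (X : K → Label) (k : K) (i j : Fin (X k).rank) :
    sigmaGram X ⟨k, i⟩ ⟨k, j⟩ = -(X k).cartan i j := by
  rw [sigmaGram, Matrix.blockDiagonal'_apply_eq]; rfl

theorem sigmaGram_ne (X : K → Label) {k l : K} (h : k ≠ l) (i : Fin (X k).rank)
    (j : Fin (X l).rank) : sigmaGram X ⟨k, i⟩ ⟨l, j⟩ = 0 := by
  rw [sigmaGram, Matrix.blockDiagonal'_apply_ne _ _ _ h]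

theorem sigmaGram_symm (X : K → Label) (p q : (k : K) × Fin (X k).rank) :
    sigmaGram X p q = sigmaGram X q p := by
  obtain ⟨k, i⟩ := p
  obtain ⟨l, j⟩ := q
  by_cases h : k = l
  · subst h
    rw [sigmaGram_same, sigmaGram_same, (X k).isSimplyLaced.symm]
  · rw [sigmaGram_ne X h, sigmaGram_ne X (Ne.symm h)]

theorem sigmaGram_diag (X : K → Label) (p : (k : K) × Fin (X k).rank) :
    sigmaGram X p p = -2 := by
  obtain ⟨k, i⟩ := p
  rw [sigmaGram_same, (X k).isSimplyLaced.diag]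

theorem sigmaGram_off_diag (X : K → Label) {p q : (k : K) × Fin (X k).rank} (h : p ≠ q) :
    sigmaGram X p q = 0 ∨ sigmaGram X p q = 1 := by
  obtain ⟨k, i⟩ := p
  obtain ⟨l, j⟩ := q
  by_cases hk : k = l
  · subst hk
    have hij : i ≠ j := by rintro rfl; exact h rfl
    rw [sigmaGram_same]
    rcases (X k).isSimplyLaced.off_diag i j hij with h | h <;> rw [h] <;> simp
  · exact Or.inl (sigmaGram_ne X hk _ _)

theorem sigmaDiagram_adj (X : K → Label) (p q : (k : K) × Fin (X k).rank) :
    (sigmaDiagram X).Adj p q ↔ sigmaGram X p q = 1 := by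
  refine (dynkinDiagram_adj _ p q).trans ?_
  rw [sigmaGram_symm X q p, or_self]
  constructor
  · exact fun h => h.2
  · intro h
    refine ⟨?_, h⟩
    rintro rfl
    rw [sigmaGram_diag] at h
    omega

theorem sigmaDiagram_adj_same (X : K → Label) (k : K) (i j : Fin (X k).rank) :
    (sigmaDiagram X).Adj ⟨k, i⟩ ⟨k, j⟩ ↔ (X k).diagram.Adj i j := by
  rw [sigmaDiagram_adj, sigmaGram_same, Label.diagram_adj]
  omega

theorem fst_eq_of_sigmaDiagram_adj {X : K → Label} {p q : (k : K) × Fin (X k).rank}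
    (h : (sigmaDiagram X).Adj p q) : p.1 = q.1 := by
  by_contra hne
  rw [sigmaDiagram_adj] at h
  obtain ⟨k, i⟩ := p
  obtain ⟨l, j⟩ := q
  rw [sigmaGram_ne X hne] at h
  omega

/-- The union depends only on the family of labels up to reindexing. -/
theorem sigmaDiagram_congr {K' : Type*} [DecidableEq K'] {X : K → Label} {X' : K' → Label}
    (f : K ≃ K') (h : ∀ k, X' (f k) = X k) : Nonempty (sigmaDiagram X ≃g sigmaDiagram X') := by
  obtain rfl : X = fun k => X' (f k) := funext fun k => (h k).symm
  refine ⟨⟨Equiv.sigmaCongrLeft (β := fun k => Fin (X' k).rank) f, ?_⟩⟩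
  rintro ⟨k, i⟩ ⟨l, j⟩
  rw [sigmaDiagram_adj, sigmaDiagram_adj]
  by_cases hk : k = l
  · subst hk
    change sigmaGram X' ⟨f k, i⟩ ⟨f k, j⟩ = 1 ↔ _
    rw [sigmaGram_same, sigmaGram_same (fun k => X' (f k))]
  · change sigmaGram X' ⟨f k, i⟩ ⟨f l, j⟩ = 1 ↔ _
    rw [sigmaGram_ne _ (fun h => hk (f.injective h)), sigmaGram_ne _ hk]

section Components

variable {V : Type*} {G : SimpleGraph V} {X : K → Label} (e : G ≃g sigmaDiagram X)

include e in
theorem reachable_iff_of_iso_sigmaDiagram (v w : V) :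
    G.Reachable v w ↔ (e v).1 = (e w).1 := by
  constructor
  · rintro ⟨p⟩
    induction p with
    | nil => rfl
    | cons h p ih => exact (fst_eq_of_sigmaDiagram_adj (e.map_adj_iff.2 h)).trans ih
  · intro h
    obtain ⟨⟨k, i⟩, rfl⟩ := e.symm.surjective v
    obtain ⟨⟨l, j⟩, rfl⟩ := e.symm.surjective w
    simp only [RelIso.apply_symm_apply] at h
    subst h
    let φ : (X k).diagram →g G :=
      ⟨fun a => e.symm ⟨k, a⟩, fun {a b} hab =>
        e.symm.map_adj_iff.2 ((sigmaDiagram_adj_same X k a b).2 hab)⟩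
    exact ((X k).diagram_connected.preconnected i j).map φ

end Components

end Sigma

section Components

variable {K : Type*} [DecidableEq K] {V : Type*} {G : SimpleGraph V} {X : K → Label}

/-- If `G` is a disjoint union of standard diagrams, its connected components correspond to the
summands. -/
theorem exists_component_equiv (e : G ≃g sigmaDiagram X) :
    ∃ f : G.ConnectedComponent ≃ K,
      ∀ c, Nonempty (c.toSimpleGraph ≃g (X (f c)).diagram) := by
  let κ : G.ConnectedComponent → K := fun c => c.recOn (fun v => (e v).1)
    (fun v w p _ => by simpa using (reachable_iff_of_iso_sigmaDiagram e v w).1 p.reachable)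
  have hκ : ∀ v, κ (G.connectedComponentMk v) = (e v).1 := fun v => rfl
  have hbij : Function.Bijective κ := by
    constructor
    · intro c d
      induction c using SimpleGraph.ConnectedComponent.ind with | _ v
      induction d using SimpleGraph.ConnectedComponent.ind with | _ w
      rw [hκ, hκ]
      exact fun h => SimpleGraph.ConnectedComponent.sound
        ((reachable_iff_of_iso_sigmaDiagram e v w).2 h)
    · intro k
      refine ⟨G.connectedComponentMk (e.symm ⟨k, ⟨0, (X k).rank_pos⟩⟩), ?_⟩
      rw [hκ, e.apply_symm_apply]
  refine ⟨Equiv.ofBijective κ hbij, fun c => ?_⟩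
  change Nonempty (_ ≃g (X (κ c)).diagram)
  have hmem : ∀ v, v ∈ c.supp ↔ (e v).1 = κ c := by
    intro v
    rw [SimpleGraph.ConnectedComponent.mem_supp_iff, ← hκ]
    exact ⟨fun h => by rw [h], fun h => hbij.1 h⟩
  generalize κ c = k at hmem
  let φ : Fin (X k).rank → c.supp := fun i =>
    ⟨e.symm ⟨k, i⟩, by rw [hmem, e.apply_symm_apply]⟩
  have hφ : Function.Bijective φ := by
    constructor
    · intro i j hij
      have h := e.symm.injective (Subtype.ext_iff.1 hij)
      simpa using h
    · rintro ⟨v, hv⟩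
      obtain ⟨⟨l, i⟩, rfl⟩ := e.symm.surjective v
      rw [hmem, e.apply_symm_apply] at hv
      simp only at hv
      subst hv
      exact ⟨i, rfl⟩
  refine ⟨RelIso.symm ⟨Equiv.ofBijective φ hφ, ?_⟩⟩
  intro i j
  change G.Adj (e.symm ⟨k, i⟩) (e.symm ⟨k, j⟩) ↔ _
  rw [e.symm.map_adj_iff, sigmaDiagram_adj_same]

/-- The label of a component is well defined, since labels are determined by their diagrams. -/
theorem componentType_eq {c : G.ConnectedComponent} {Y : Label}
    (h : Nonempty (c.toSimpleGraph ≃g Y.diagram)) : componentType c = {Y} := by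
  have hex : ∃ X : Label, Nonempty (c.toSimpleGraph ≃g X.diagram) := ⟨Y, h⟩
  rw [componentType, dif_pos hex]
  obtain ⟨e⟩ := h
  obtain ⟨e'⟩ := hex.choose_spec
  rw [Label.eq_of_diagram_iso (e'.symm.trans e)]

theorem graphType_of_iso_sigmaDiagram [Finite V] [Fintype K] (e : G ≃g sigmaDiagram X) :
    graphType G = Finset.univ.val.map X := by
  obtain ⟨f, hf⟩ := exists_component_equiv e
  let _ : Fintype G.ConnectedComponent := Fintype.ofFinite _
  have h1 : graphType G = ∑ c : G.ConnectedComponent, {X (f c)} :=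
    Finset.sum_congr rfl fun c _ => componentType_eq (hf c)
  rw [h1, Fintype.sum_equiv f (fun c => ({X (f c)} : ADEType)) (fun k => {X k}) fun _ => rfl]
  change (Finset.univ.val.map fun k => ({X k} : Multiset Label)).sum = _
  have h2 := Multiset.sum_map_singleton (Finset.univ.val.map X)
  rw [Multiset.map_map] at h2
  exact h2

theorem components_of_iso_sigmaDiagram (e : G ≃g sigmaDiagram X) (c : G.ConnectedComponent) :
    ∃ Y : Label, Nonempty (c.toSimpleGraph ≃g Y.diagram) := by
  obtain ⟨f, hf⟩ := exists_component_equiv e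
  exact ⟨_, hf c⟩

end Components

/-- The tagged elements of the multiset of the labels `X k` are the indices `k`. -/
theorem exists_equiv_toType {K : Type*} [Fintype K] (X : K → Label) :
    ∃ f : K ≃ (Finset.univ.val.map X : ADEType).ToType, ∀ k, (f k).1 = X k := by
  classical
  let g : (Finset.univ.val : Multiset K).ToType → K := fun x => x.1
  have hg : Function.Bijective g := by
    constructor
    · rintro ⟨x, i⟩ ⟨y, j⟩ (rfl : x = y)
      have h1 : Multiset.count x (Finset.univ.val : Multiset K) = 1 :=
        Multiset.count_eq_one_of_mem Finset.univ.nodup (Finset.mem_univ x)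
      have : i = j := by
        apply Fin.ext
        have hi := i.2
        have hj := j.2
        omega
      rw [this]
    · intro k
      exact ⟨⟨k, ⟨0, Multiset.count_pos.2 (Finset.mem_univ k)⟩⟩, rfl⟩
  let E := Equiv.ofBijective g hg
  refine ⟨E.symm.trans ((Finset.univ.val : Multiset K).mapEquiv X), fun k => ?_⟩
  have h := Multiset.mapEquiv_apply (Finset.univ.val : Multiset K) X (E.symm k)
  refine h.trans ?_
  congr 1
  exact E.apply_symm_apply k

theorem nonempty_iso_typeDiagram_map {K : Type*} [Fintype K] [DecidableEq K] (X : K → Label) :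
    Nonempty (sigmaDiagram X ≃g typeDiagram (Finset.univ.val.map X)) := by
  obtain ⟨f, hf⟩ := exists_equiv_toType X
  exact sigmaDiagram_congr f hf

/-- A graph all of whose components are standard is a disjoint union of standard diagrams. -/
theorem nonempty_iso_sigmaDiagram {V : Type*} {G : SimpleGraph V}
    [DecidableEq G.ConnectedComponent] {X : G.ConnectedComponent → Label}
    (f : ∀ c, c.toSimpleGraph ≃g (X c).diagram) : Nonempty (sigmaDiagram X ≃g G) := by
  let φ : ((c : G.ConnectedComponent) × Fin (X c).rank) → V := fun p => ((f p.1).symm p.2).1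
  have hφ1 : ∀ p, G.connectedComponentMk (φ p) = p.1 := fun p => ((f p.1).symm p.2).2
  have hφ : Function.Bijective φ := by
    constructor
    · rintro ⟨c, i⟩ ⟨d, j⟩ h
      have hcd : c = d := by
        have h1 := hφ1 ⟨c, i⟩
        rw [h, hφ1 ⟨d, j⟩] at h1
        exact h1.symm
      subst hcd
      have : i = j := (f c).symm.injective (Subtype.ext h)
      rw [this]
    · intro v
      refine ⟨⟨G.connectedComponentMk v, f _ ⟨v, rfl⟩⟩, ?_⟩
      change ((f _).symm (f _ _)).1 = v
      rw [(f _).symm_apply_apply]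
  refine ⟨⟨Equiv.ofBijective φ hφ, ?_⟩⟩
  rintro ⟨c, i⟩ ⟨d, j⟩
  change G.Adj (φ ⟨c, i⟩) (φ ⟨d, j⟩) ↔ _
  by_cases hcd : c = d
  · subst hcd
    rw [sigmaDiagram_adj_same, ← (f c).symm.map_adj_iff]
    rfl
  · constructor
    · intro h
      refine absurd ?_ hcd
      have := SimpleGraph.ConnectedComponent.sound h.reachable
      rwa [hφ1, hφ1] at this
    · intro h
      exact absurd (fst_eq_of_sigmaDiagram_adj h) hcd

/-- A finite graph all of whose components are standard is the diagram of its type. -/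
theorem nonempty_iso_typeDiagram {V : Type*} [Finite V] {G : SimpleGraph V}
    (h : ∀ c : G.ConnectedComponent, ∃ X : Label, Nonempty (c.toSimpleGraph ≃g X.diagram)) :
    Nonempty (G ≃g typeDiagram (graphType G)) := by
  classical
  let _ : Fintype G.ConnectedComponent := Fintype.ofFinite _
  choose X hX using h
  obtain ⟨e⟩ := nonempty_iso_sigmaDiagram fun c => (hX c).some
  obtain ⟨e'⟩ := nonempty_iso_typeDiagram_map X
  rw [graphType_of_iso_sigmaDiagram e.symm]
  exact ⟨e.symm.trans e'⟩

/-! ### Negative definiteness -/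

/-- A square integral matrix of negative-definite type. -/
def NegDef {ι : Type*} [Fintype ι] (M : ι → ι → ℤ) : Prop :=
  ∀ x : ι → ℤ, x ≠ 0 → ∑ i, ∑ j, x i * M i j * x j < 0

/-- A symmetric matrix with non-negative off-diagonal entries is negative definite as soon as it
maps some positive vector `c` to a negative one: with `d = -M c`, the form is
`-∑ dᵢ xᵢ² / cᵢ - ½ ∑ Mᵢⱼ cᵢ cⱼ (xᵢ / cᵢ - xⱼ / cⱼ)²`. -/
theorem negDef_of_pos {ι : Type*} [Fintype ι] {M : ι → ι → ℤ} (hs : ∀ i j, M i j = M j i)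
    (ho : ∀ i j, i ≠ j → 0 ≤ M i j) (c : ι → ℤ) (hc : ∀ i, 0 < c i)
    (hM : ∀ i, ∑ j, M i j * c j < 0) : NegDef M := by
  intro x hx
  have hc' : ∀ i, (0 : ℚ) < c i := fun i => by exact_mod_cast hc i
  let y : ι → ℚ := fun i => x i / c i
  have hxy : ∀ i, (x i : ℚ) = y i * c i := fun i => by
    simp only [y]; rw [div_mul_cancel₀ _ (hc' i).ne']
  have h1 : (2 : ℚ) * ∑ i, ∑ j, (x i : ℚ) * M i j * x j =
      2 * (∑ i, y i ^ 2 * c i * ∑ j, (M i j : ℚ) * c j) -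
        ∑ i, ∑ j, (M i j : ℚ) * c i * c j * (y i - y j) ^ 2 := by
    have h2 : ∑ i, y i ^ 2 * c i * ∑ j, (M i j : ℚ) * c j =
        ∑ i, ∑ j, (M i j : ℚ) * c i * c j * y i ^ 2 :=
      Finset.sum_congr rfl fun i _ => by
        rw [Finset.mul_sum]
        exact Finset.sum_congr rfl fun j _ => by ring
    have h3 : ∑ i, ∑ j, (M i j : ℚ) * c i * c j * y i ^ 2 =
        ∑ i, ∑ j, (M i j : ℚ) * c i * c j * y j ^ 2 := by
      rw [Finset.sum_comm]
      exact Finset.sum_congr rfl fun i _ => Finset.sum_congr rfl fun j _ => by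
        rw [hs]; ring
    rw [two_mul (∑ i, y i ^ 2 * c i * ∑ j, (M i j : ℚ) * c j)]
    nth_rewrite 2 [h2]
    rw [h3, h2, ← Finset.sum_add_distrib, ← Finset.sum_sub_distrib, Finset.mul_sum]
    refine Finset.sum_congr rfl fun i _ => ?_
    rw [← Finset.sum_add_distrib, ← Finset.sum_sub_distrib, Finset.mul_sum]
    refine Finset.sum_congr rfl fun j _ => ?_
    rw [hxy i, hxy j]
    ring
  have h4 : (0 : ℚ) ≤ ∑ i, ∑ j, (M i j : ℚ) * c i * c j * (y i - y j) ^ 2 := by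
    refine Finset.sum_nonneg fun i _ => Finset.sum_nonneg fun j _ => ?_
    by_cases hij : i = j
    · rw [hij]; simp
    · have := ho i j hij
      have h5 : (0 : ℚ) ≤ M i j := by exact_mod_cast this
      have := (hc' i).le
      have := (hc' j).le
      positivity
  have h5 : ∑ i, y i ^ 2 * c i * ∑ j, (M i j : ℚ) * c j < 0 := by
    obtain ⟨i₀, hi₀⟩ : ∃ i, x i ≠ 0 := by
      by_contra h
      push Not at h
      exact hx (funext h)
    have hneg : ∀ i, ∑ j, (M i j : ℚ) * c j < 0 := fun i => by exact_mod_cast hM i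
    refine Finset.sum_neg' (fun i _ => ?_) ⟨i₀, Finset.mem_univ _, ?_⟩
    · exact mul_nonpos_of_nonneg_of_nonpos (mul_nonneg (sq_nonneg _) (hc' i).le) (hneg i).le
    · have hy : y i₀ ≠ 0 := div_ne_zero (by exact_mod_cast hi₀) (hc' i₀).ne'
      exact mul_neg_of_pos_of_neg (mul_pos (by positivity) (hc' i₀)) (hneg i₀)
  have h6 : ∑ i, ∑ j, (x i : ℚ) * M i j * x j < 0 := by linarith
  exact_mod_cast h6

theorem sum_range_single (n a : ℕ) (f : ℕ → ℤ) :
    ∑ j ∈ Finset.range n, (if j = a then f j else 0) = if a < n then f a else 0 := by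
  rw [Finset.sum_ite_eq']
  simp

/-- The multiples `(i + 1) (l - i)` of the coefficients of the half sum of the positive roots serve as
the positive vector. -/
theorem negDef_A (l : ℕ) : NegDef fun i j => -CartanMatrix.A l i j := by
  let c : ℕ → ℤ := fun i => (i + 1) * (l - i)
  refine negDef_of_pos (fun i j => by rw [(isSimplyLaced_A l).symm]) (fun i j h => ?_)
    (fun i => c i) (fun i => ?_) (fun i => ?_)
  · rcases (isSimplyLaced_A l).off_diag i j h with h | h <;> rw [h] <;> norm_num
  · have : (i : ℤ) < l := by exact_mod_cast i.2
    exact mul_pos (by positivity) (by linarith)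
  · have key : ∀ j : Fin l, -CartanMatrix.A l i j * c j =
        (if (j : ℕ) = i then -2 * c j else 0) + (if (j : ℕ) = i + 1 then c j else 0) +
          (if (j : ℕ) = i - 1 then (if (i : ℕ) = 0 then 0 else c j) else 0) := by
      intro j
      simp only [CartanMatrix.A, Matrix.of_apply, Fin.ext_iff]
      generalize c j = z
      split_ifs <;> omega
    rw [Finset.sum_congr rfl fun j _ => key j, Finset.sum_add_distrib, Finset.sum_add_distrib,
      Fin.sum_univ_eq_sum_range (fun j => if j = (i : ℕ) then -2 * c j else 0),
      Fin.sum_univ_eq_sum_range (fun j => if j = (i : ℕ) + 1 then c j else 0),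
      Fin.sum_univ_eq_sum_range
        (fun j => if j = (i : ℕ) - 1 then (if (i : ℕ) = 0 then 0 else c j) else 0),
      sum_range_single, sum_range_single, sum_range_single]
    have hi := i.2
    have e1 : (if (i : ℕ) + 1 < l then c (i + 1) else 0) = (i + 2) * (l - i - 1) := by
      split_ifs with h
      · simp only [c]; push_cast; ring
      · rw [show (l : ℤ) = i + 1 by omega]; ring
    have e2 : (if (i : ℕ) - 1 < l then (if (i : ℕ) = 0 then 0 else c (i - 1)) else 0) =
        i * (l - i + 1) := by
      rw [if_pos (by omega)]
      split_ifs with h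
      · simp [h]
      · simp only [c]; rw [Nat.cast_sub (by omega)]; push_cast; ring
    rw [if_pos hi, e1, e2]
    simp only [c]
    ring_nf
    norm_num

/-- As for `A_l`, the positive vector is a multiple of the half sum of the positive roots. -/
theorem negDef_D (m : ℕ) (hm : 4 ≤ m) : NegDef fun i j => -CartanMatrix.D m i j := by
  let c : ℕ → ℤ := fun i => if i + 2 < m then 2 * (i + 1) * (2 * m - 2 - i) else m * (m - 1)
  have hc1 : ∀ i, i + 2 < m → c i = 2 * (i + 1) * (2 * m - 2 - i) := fun i h => if_pos h
  have hc2 : ∀ i, m ≤ i + 2 → c i = m * (m - 1) := fun i h => if_neg (by omega)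
  refine negDef_of_pos (fun i j => by rw [(isSimplyLaced_D m).symm]) (fun i j h => ?_)
    (fun i => c i) (fun i => ?_) (fun i => ?_)
  · rcases (isSimplyLaced_D m).off_diag i j h with h | h <;> rw [h] <;> norm_num
  · have : (i : ℤ) < m := by exact_mod_cast i.2
    have hm' : (4 : ℤ) ≤ m := by exact_mod_cast hm
    rcases Nat.lt_or_ge ((i : ℕ) + 2) m with h | h
    · rw [hc1 _ h]
      exact mul_pos (by positivity) (by linarith)
    · rw [hc2 _ h]
      exact mul_pos (by linarith) (by linarith)
  · have hi := i.2
    have e0 : ((m - 3 : ℕ) : ℤ) = m - 3 := by omega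
    rcases Nat.lt_or_ge ((i : ℕ) + 3) m with h | h
    · -- a vertex of the chain before the branch vertex
      have key : ∀ j : Fin m, -CartanMatrix.D m i j * c j =
          (if (j : ℕ) = i then -2 * c j else 0) + (if (j : ℕ) = i + 1 then c j else 0) +
            (if (j : ℕ) = i - 1 then (if (i : ℕ) = 0 then 0 else c j) else 0) := by
        intro j
        simp only [CartanMatrix.D, Matrix.of_apply, Fin.ext_iff]
        generalize c j = z
        split_ifs <;> omega
      rw [Finset.sum_congr rfl fun j _ => key j, Finset.sum_add_distrib, Finset.sum_add_distrib,
        Fin.sum_univ_eq_sum_range (fun j => if j = (i : ℕ) then -2 * c j else 0),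
        Fin.sum_univ_eq_sum_range (fun j => if j = (i : ℕ) + 1 then c j else 0),
        Fin.sum_univ_eq_sum_range
          (fun j => if j = (i : ℕ) - 1 then (if (i : ℕ) = 0 then 0 else c j) else 0),
        sum_range_single, sum_range_single, sum_range_single]
      have e2 : (if (i : ℕ) - 1 < m then (if (i : ℕ) = 0 then 0 else c (i - 1)) else 0) =
          2 * i * (2 * m - 1 - i) := by
        rw [if_pos (by omega)]
        split_ifs with h
        · simp [h]
        · rw [hc1 _ (by omega), Nat.cast_sub (by omega)]; push_cast; ring
      rw [if_pos hi, if_pos (by omega), e2, hc1 _ (by omega), hc1 _ (by omega)]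
      push_cast
      ring_nf
      norm_num
    rcases Nat.lt_or_ge ((i : ℕ) + 2) m with h' | h'
    · -- the branch vertex
      have hi3 : (i : ℕ) = m - 3 := by omega
      have key : ∀ j : Fin m, -CartanMatrix.D m i j * c j =
          (if (j : ℕ) = m - 3 then -2 * c j else 0) + (if (j : ℕ) = m - 2 then c j else 0) +
          (if (j : ℕ) = m - 1 then c j else 0) + (if (j : ℕ) = m - 4 then c j else 0) := by
        intro j
        simp only [CartanMatrix.D, Matrix.of_apply, Fin.ext_iff]
        generalize c j = z
        split_ifs <;> omega
      rw [Finset.sum_congr rfl fun j _ => key j, Finset.sum_add_distrib, Finset.sum_add_distrib,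
        Finset.sum_add_distrib,
        Fin.sum_univ_eq_sum_range (fun j => if j = m - 3 then -2 * c j else 0),
        Fin.sum_univ_eq_sum_range (fun j => if j = m - 2 then c j else 0),
        Fin.sum_univ_eq_sum_range (fun j => if j = m - 1 then c j else 0),
        Fin.sum_univ_eq_sum_range (fun j => if j = m - 4 then c j else 0),
        sum_range_single, sum_range_single, sum_range_single, sum_range_single,
        if_pos (by omega), if_pos (by omega), if_pos (by omega), if_pos (by omega),
        hc1 _ (by omega), hc2 _ (by omega), hc2 _ (by omega), hc1 _ (by omega),
        e0, show ((m - 4 : ℕ) : ℤ) = m - 4 by omega]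
      ring_nf
      norm_num
    · -- the two short ends
      have key : ∀ j : Fin m, -CartanMatrix.D m i j * c j =
          (if (j : ℕ) = i then -2 * c j else 0) + (if (j : ℕ) = m - 3 then c j else 0) := by
        intro j
        simp only [CartanMatrix.D, Matrix.of_apply, Fin.ext_iff]
        generalize c j = z
        split_ifs <;> omega
      rw [Finset.sum_congr rfl fun j _ => key j, Finset.sum_add_distrib,
        Fin.sum_univ_eq_sum_range (fun j => if j = (i : ℕ) then -2 * c j else 0),
        Fin.sum_univ_eq_sum_range (fun j => if j = m - 3 then c j else 0),
        sum_range_single, sum_range_single, if_pos hi, if_pos (by omega),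
        hc2 _ (by omega), hc1 _ (by omega), e0]
      ring_nf
      norm_num

theorem Label.negDef (X : Label) : NegDef fun i j => -X.cartan i j := by
  cases X with
  | A l hl => exact negDef_A l
  | D m hm => exact negDef_D m hm
  | E6 =>
    exact negDef_of_pos (M := fun i j => -entryE6 i j) (by decide) (by decide)
      ![16, 22, 30, 42, 30, 16] (by decide) (by decide)
  | E7 =>
    exact negDef_of_pos (M := fun i j => -entryE7 i j) (by decide) (by decide)
      ![34, 49, 66, 96, 75, 52, 27] (by decide) (by decide)
  | E8 =>
    exact negDef_of_pos (M := fun i j => -entryE8 i j) (by decide) (by decide)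
      ![92, 136, 182, 270, 220, 168, 114, 58] (by decide) (by decide)

theorem negDef_sigmaGram {K : Type*} [Fintype K] [DecidableEq K] (X : K → Label) :
    NegDef (sigmaGram X) := by
  intro x hx
  have h1 : ∑ p, ∑ q, x p * sigmaGram X p q * x q =
      ∑ k, ∑ i, ∑ j, x ⟨k, i⟩ * (-(X k).cartan i j) * x ⟨k, j⟩ := by
    rw [Fintype.sum_sigma]
    refine Finset.sum_congr rfl fun k _ => Finset.sum_congr rfl fun i _ => ?_
    rw [Fintype.sum_sigma, Finset.sum_eq_single k]
    · exact Finset.sum_congr rfl fun j _ => by rw [sigmaGram_same]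
    · intro l _ hl
      exact Finset.sum_eq_zero fun j _ => by rw [sigmaGram_ne X hl.symm]; ring
    · intro h
      exact absurd (Finset.mem_univ k) h
  have hle : ∀ k, ∑ i, ∑ j, x ⟨k, i⟩ * (-(X k).cartan i j) * x ⟨k, j⟩ ≤ 0 := by
    intro k
    by_cases h : (fun i => x ⟨k, i⟩) = 0
    · have h0 : ∀ i, x ⟨k, i⟩ = 0 := fun i => congrFun h i
      simp [h0]
    · exact ((X k).negDef _ h).le
  rw [h1]
  obtain ⟨⟨k, i⟩, hki⟩ : ∃ p, x p ≠ 0 := by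
    by_contra h
    push Not at h
    exact hx (funext h)
  exact Finset.sum_neg' (fun k _ => hle k) ⟨k, Finset.mem_univ _,
    (X k).negDef (fun i => x ⟨k, i⟩) fun h => hki (congrFun h i)⟩

/-! ### Hyperbolic geometry of `L₁₀` -/

theorem form10R_expand (x y : Fin 10 → ℝ) : form10R x y =
    -2 * (x 0 * y 0 + x 1 * y 1 + x 2 * y 2 + x 3 * y 3 + x 4 * y 4 + x 5 * y 5 + x 6 * y 6 +
      x 7 * y 7 + x 8 * y 8 + x 9 * y 9) + (x 0 * y 3 + x 3 * y 0) + (x 1 * y 2 + x 2 * y 1) +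
      (x 2 * y 3 + x 3 * y 2) + (x 3 * y 4 + x 4 * y 3) + (x 4 * y 5 + x 5 * y 4) +
      (x 5 * y 6 + x 6 * y 5) + (x 6 * y 7 + x 7 * y 6) + (x 7 * y 8 + x 8 * y 7) +
      (x 8 * y 9 + x 9 * y 8) := by
  simp [form10R, Matrix.toBilin'_apply, Fin.sum_univ_succ, gramE10, Fin.succ]
  ring

theorem form10_expand (x y : L10) : form10 x y =
    -2 * (x 0 * y 0 + x 1 * y 1 + x 2 * y 2 + x 3 * y 3 + x 4 * y 4 + x 5 * y 5 + x 6 * y 6 +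
      x 7 * y 7 + x 8 * y 8 + x 9 * y 9) + (x 0 * y 3 + x 3 * y 0) + (x 1 * y 2 + x 2 * y 1) +
      (x 2 * y 3 + x 3 * y 2) + (x 3 * y 4 + x 4 * y 3) + (x 4 * y 5 + x 5 * y 4) +
      (x 5 * y 6 + x 6 * y 5) + (x 6 * y 7 + x 7 * y 6) + (x 7 * y 8 + x 8 * y 7) +
      (x 8 * y 9 + x 9 * y 8) := by
  simp [form10, Matrix.toBilin'_apply, Fin.sum_univ_succ, gramE10, Fin.succ]
  ring

theorem form10_comm (x y : L10) : form10 x y = form10 y x := by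
  rw [form10_expand, form10_expand]; ring

theorem form10_c0_self : form10 c0 c0 = 1240 := by
  rw [form10_expand]; decide

theorem c0_nine : c0 9 = 30 := rfl

/-- The real vector with the coordinates of an element of `L₁₀`. -/
def toReal (x : L10) : Fin 10 → ℝ := fun i => x i

theorem form10R_toReal (x y : L10) : form10R (toReal x) (toReal y) = form10 x y := by
  rw [form10R_expand, form10_expand]
  simp only [toReal]
  push_cast
  ring

theorem form10R_comm (x y : Fin 10 → ℝ) : form10R x y = form10R y x := by
  rw [form10R_expand, form10R_expand]; ring

/-- The form is minus a sum of eight squares, up to a hyperbolic plane in the last two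
coordinates. -/
theorem form10R_self (x : Fin 10 → ℝ) : form10R x x =
    -(2 * (x 0 - x 3 / 2) ^ 2 + 2 * (x 1 - x 2 / 2) ^ 2 + 3 / 2 * (x 2 - 2 / 3 * x 3) ^ 2 +
      5 / 6 * (x 3 - 6 / 5 * x 4) ^ 2 + 4 / 5 * (x 4 - 5 / 4 * x 5) ^ 2 +
      3 / 4 * (x 5 - 4 / 3 * x 6) ^ 2 + 2 / 3 * (x 6 - 3 / 2 * x 7) ^ 2 +
      1 / 2 * (x 7 - 2 * x 8) ^ 2) + 2 * x 9 * (x 8 - x 9) := by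
  rw [form10R_expand]; ring

theorem form10R_self_nonpos {x : Fin 10 → ℝ} (h : x 9 = 0) : form10R x x ≤ 0 := by
  rw [form10R_self, h]
  have : 0 ≤ 2 * (x 0 - x 3 / 2) ^ 2 + 2 * (x 1 - x 2 / 2) ^ 2 + 3 / 2 * (x 2 - 2 / 3 * x 3) ^ 2 +
      5 / 6 * (x 3 - 6 / 5 * x 4) ^ 2 + 4 / 5 * (x 4 - 5 / 4 * x 5) ^ 2 +
      3 / 4 * (x 5 - 4 / 3 * x 6) ^ 2 + 2 / 3 * (x 6 - 3 / 2 * x 7) ^ 2 +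
      1 / 2 * (x 7 - 2 * x 8) ^ 2 := by positivity
  linarith

/-- On the hyperplane `x 9 = 0` the form is negative semidefinite, with radical spanned by the null
root of the affine diagram `E₉`. -/
theorem eq_of_form10R_self_eq_zero {x : Fin 10 → ℝ} (h : x 9 = 0) (h0 : form10R x x = 0) :
    x = fun i => x 8 * ((![3, 2, 4, 6, 5, 4, 3, 2, 1, 0] : Fin 10 → ℝ) i) := by
  rw [form10R_self, h] at h0
  have p0 := sq_nonneg (x 0 - x 3 / 2)
  have p1 := sq_nonneg (x 1 - x 2 / 2)
  have p2 := sq_nonneg (x 2 - 2 / 3 * x 3)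
  have p3 := sq_nonneg (x 3 - 6 / 5 * x 4)
  have p4 := sq_nonneg (x 4 - 5 / 4 * x 5)
  have p5 := sq_nonneg (x 5 - 4 / 3 * x 6)
  have p6 := sq_nonneg (x 6 - 3 / 2 * x 7)
  have p7 := sq_nonneg (x 7 - 2 * x 8)
  have q0 : x 0 - x 3 / 2 = 0 := pow_eq_zero_iff two_ne_zero |>.1 (by linarith)
  have q1 : x 1 - x 2 / 2 = 0 := pow_eq_zero_iff two_ne_zero |>.1 (by linarith)
  have q2 : x 2 - 2 / 3 * x 3 = 0 := pow_eq_zero_iff two_ne_zero |>.1 (by linarith)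
  have q3 : x 3 - 6 / 5 * x 4 = 0 := pow_eq_zero_iff two_ne_zero |>.1 (by linarith)
  have q4 : x 4 - 5 / 4 * x 5 = 0 := pow_eq_zero_iff two_ne_zero |>.1 (by linarith)
  have q5 : x 5 - 4 / 3 * x 6 = 0 := pow_eq_zero_iff two_ne_zero |>.1 (by linarith)
  have q6 : x 6 - 3 / 2 * x 7 = 0 := pow_eq_zero_iff two_ne_zero |>.1 (by linarith)
  have q7 : x 7 - 2 * x 8 = 0 := pow_eq_zero_iff two_ne_zero |>.1 (by linarith)
  ext i
  fin_cases i <;> simp <;> linarith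

theorem apply_nine_ne_zero {x : Fin 10 → ℝ} (h : 0 < form10R x x) : x 9 ≠ 0 := fun h9 =>
  absurd (form10R_self_nonpos h9) (not_le.2 h)

/-- Two vectors of positive square-norm have a pairing whose sign is that of the product of their
last coordinates. -/
theorem form10R_pos {u v : Fin 10 → ℝ} (hu : 0 < form10R u u) (hv : 0 < form10R v v) :
    0 < u 9 * v 9 * form10R u v := by
  have h := form10R_self_nonpos (x := u 9 • v - v 9 • u) (by simp; ring)
  simp only [map_sub, map_smul, LinearMap.sub_apply, LinearMap.smul_apply, smul_eq_mul,
    form10R_comm v u] at h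
  have h1 : 0 < u 9 ^ 2 * form10R v v := mul_pos (by have := apply_nine_ne_zero hu; positivity) hv
  have h2 : 0 ≤ v 9 ^ 2 * form10R u u := mul_nonneg (sq_nonneg _) hu.le
  nlinarith

/-- The form is negative definite on the orthogonal complement of a vector
of positive square-norm. -/
theorem form10R_orthogonal {h x : Fin 10 → ℝ} (hh : 0 < form10R h h) (hx : form10R h x = 0) :
    form10R x x ≤ 0 ∧ (form10R x x = 0 → x = 0) := by
  have h9 := apply_nine_ne_zero hh
  have h1 := form10R_self_nonpos (x := h 9 • x - x 9 • h) (by simp; ring)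
  simp only [map_sub, map_smul, LinearMap.sub_apply, LinearMap.smul_apply, smul_eq_mul,
    form10R_comm x h, hx] at h1
  have hpos : 0 < h 9 ^ 2 := by positivity
  have h2 : 0 ≤ x 9 ^ 2 * form10R h h := mul_nonneg (sq_nonneg _) hh.le
  have h3 : h 9 ^ 2 * form10R x x ≤ 0 := by linarith
  refine ⟨by nlinarith, fun h0 => ?_⟩
  have hx9 : x 9 = 0 := by
    by_contra hne
    have : 0 < x 9 ^ 2 * form10R h h := mul_pos (by positivity) hh
    rw [h0] at h1
    linarith
  have hx' := eq_of_form10R_self_eq_zero hx9 h0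
  have h4 : form10R h x = x 8 * h 9 := by
    rw [form10R_expand, hx']
    simp
    ring
  rw [hx] at h4
  have h8 : x 8 = 0 := by
    rcases mul_eq_zero.1 h4.symm with h | h
    · exact h
    · exact absurd h h9
  rw [hx', h8]
  ext i
  simp

theorem form10_pos {u v : L10} (hu : 0 < form10 u u) (hv : 0 < form10 v v) :
    0 < u 9 * v 9 * form10 u v := by
  have h := form10R_pos (u := toReal u) (v := toReal v)
    (by rw [form10R_toReal]; exact_mod_cast hu) (by rw [form10R_toReal]; exact_mod_cast hv)
  rw [form10R_toReal] at h
  simp only [toReal] at h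
  exact_mod_cast h

theorem form10_orthogonal {h x : L10} (hh : 0 < form10 h h) (hx : form10 h x = 0) :
    form10 x x ≤ 0 ∧ (form10 x x = 0 → x = 0) := by
  have h1 := form10R_orthogonal (h := toReal h) (x := toReal x)
    (by rw [form10R_toReal]; exact_mod_cast hh) (by rw [form10R_toReal]; exact_mod_cast hx)
  rw [form10R_toReal] at h1
  refine ⟨by exact_mod_cast h1.1, fun h0 => ?_⟩
  have h2 := h1.2 (by exact_mod_cast h0)
  ext i
  have h3 := congrFun h2 i
  simp only [toReal, Pi.zero_apply] at h3 ⊢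
  exact_mod_cast h3

/-- The positive cone is the part of the locus of positive square-norm where the last coordinate is
positive: that part is convex, and the last coordinate vanishes nowhere on the locus. -/
theorem positiveCone_eq : positiveCone = {x | 0 < form10R x x ∧ 0 < x 9} := by
  have hc : (fun i => (c0 i : ℝ)) ∈ {x : Fin 10 → ℝ | 0 < form10R x x ∧ 0 < x 9} := by
    constructor
    · change 0 < form10R (toReal c0) (toReal c0)
      rw [form10R_toReal, form10_c0_self]
      norm_num
    · change (0 : ℝ) < c0 9
      rw [c0_nine]
      norm_num
  apply Set.Subset.antisymm
  · intro x hx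
    have hsub := connectedComponentIn_subset {x | 0 < form10R x x} (fun i => (c0 i : ℝ))
    refine ⟨hsub hx, ?_⟩
    have hpre : IsPreconnected ((fun y : Fin 10 → ℝ => y 9) '' positiveCone) :=
      isPreconnected_connectedComponentIn.image _ (continuous_apply 9).continuousOn
    by_contra hneg
    have h0 : (0 : ℝ) ∈ (fun y : Fin 10 → ℝ => y 9) '' positiveCone :=
      hpre.ordConnected.out ⟨x, hx, rfl⟩
        ⟨_, mem_connectedComponentIn hc.1, rfl⟩ ⟨not_lt.1 hneg, hc.2.le⟩
    obtain ⟨y, hy, hy0⟩ := h0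
    exact apply_nine_ne_zero (hsub hy) hy0
  · refine IsPreconnected.subset_connectedComponentIn (Convex.isPreconnected ?_) hc
      (fun x hx => hx.1)
    intro x hx y hy a b ha hb hab
    have h1 := form10R_pos hx.1 hy.1
    have h2 : 0 < form10R x y := by
      by_contra hn
      have := mul_nonneg_of_nonpos_of_nonpos (not_lt.1 hn) (neg_nonpos.2 (mul_pos hx.2 hy.2).le)
      nlinarith
    have hx1 := hx.1
    have hy1 := hy.1
    have hx2 := hx.2
    have hy2 := hy.2
    have hexp : form10R (a • x + b • y) (a • x + b • y) =
        a ^ 2 * form10R x x + 2 * a * b * form10R x y + b ^ 2 * form10R y y := by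
      simp only [map_add, map_smul, LinearMap.add_apply, LinearMap.smul_apply, smul_eq_mul,
        form10R_comm y x]
      ring
    rcases ha.eq_or_lt with rfl | ha'
    · have hb1 : b = 1 := by linarith
      subst hb1
      simpa using hy
    · constructor
      · change 0 < form10R (a • x + b • y) (a • x + b • y)
        rw [hexp]
        positivity
      · change 0 < a * x 9 + b * y 9
        positivity

theorem form10R_extend {g : L10 ≃ₗ[ℤ] L10} (hg : ∀ x y, form10 (g x) (g y) = form10 x y)
    (x y : Fin 10 → ℝ) : form10R (extend g x) (extend g y) = form10R x y := by
  have h : form10R.compl₁₂ (extend g) (extend g) = form10R := by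
    refine LinearMap.ext_basis (Pi.basisFun ℝ (Fin 10)) (Pi.basisFun ℝ (Fin 10)) fun i j => ?_
    have hs : ∀ i, Pi.basisFun ℝ (Fin 10) i = toReal (Pi.single i 1) := by
      intro i
      ext k
      simp only [Pi.basisFun_apply, toReal, Pi.single_apply]
      split_ifs <;> simp
    have he : ∀ x : L10, extend g (toReal x) = toReal (g x) := fun x => extend_intCast g x
    rw [LinearMap.compl₁₂_apply, hs, hs, he, he, form10R_toReal, form10R_toReal, hg]
  exact LinearMap.congr_fun₂ h x y

/-- An isometry preserves the positive cone if it keeps `c₀` in it. -/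
theorem mem_OPlus {g : L10 ≃ₗ[ℤ] L10} (hg : ∀ x y, form10 (g x) (g y) = form10 x y)
    (hc : 0 < form10 (g c0) c0) : g ∈ OPlus := by
  -- the image of the cone under any such isometry is contained in the cone
  have key : ∀ f : L10 ≃ₗ[ℤ] L10, (∀ x y, form10 (f x) (f y) = form10 x y) →
      0 < form10 (f c0) c0 → ∀ x ∈ positiveCone, extend f x ∈ positiveCone := by
    intro f hf hfc x hx
    rw [positiveCone_eq] at hx ⊢
    have hc0 : 0 < form10R (toReal c0) (toReal c0) := by
      rw [form10R_toReal, form10_c0_self]; norm_num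
    have hc9 : toReal c0 9 = 30 := by rw [toReal, c0_nine]; norm_num
    have hfc0 : 0 < form10R (toReal (f c0)) (toReal (f c0)) := by
      rw [form10R_toReal, hf, form10_c0_self]; norm_num
    have hx1 : 0 < form10R (extend f x) (extend f x) := by
      rw [form10R_extend hf]; exact hx.1
    have h1 := form10R_pos hfc0 hc0
    have h2 := form10R_pos hc0 hx.1
    have h3 := form10R_pos hfc0 hx1
    have he : toReal (f c0) = extend f (toReal c0) := (extend_intCast f c0).symm
    rw [he, form10R_extend hf, ← he] at h3
    rw [form10R_toReal] at h1
    have hfc' : (0 : ℝ) < form10 (f c0) c0 := by exact_mod_cast hfc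
    have hx9 : 0 < x 9 := hx.2
    rw [hc9] at h1 h2
    have h4 : 0 < toReal (f c0) 9 := by
      by_contra hn
      nlinarith [mul_nonneg_of_nonpos_of_nonpos (not_lt.1 hn) (neg_nonpos.2 hfc'.le)]
    have h5 : 0 < form10R (toReal c0) x := by
      by_contra hn
      nlinarith [mul_nonneg_of_nonpos_of_nonpos (not_lt.1 hn) (neg_nonpos.2 hx9.le)]
    refine ⟨hx1, ?_⟩
    by_contra hn
    have h6 := mul_nonneg h4.le h5.le
    nlinarith [mul_nonneg_of_nonpos_of_nonpos (not_lt.1 hn) (neg_nonpos.2 h6)]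
  have hg' : ∀ x y, form10 (g⁻¹ x) (g⁻¹ y) = form10 x y := by
    intro x y
    rw [← hg]
    change form10 (g (g.symm x)) (g (g.symm y)) = _
    simp
  have hc' : 0 < form10 (g⁻¹ c0) c0 := by
    rw [← hg]
    change 0 < form10 (g (g.symm c0)) (g c0)
    rw [g.apply_symm_apply, form10_comm]
    exact hc
  refine ⟨hg, Set.Subset.antisymm ?_ ?_⟩
  · rintro _ ⟨x, hx, rfl⟩
    exact key g hg hc x hx
  · intro x hx
    refine ⟨extend g⁻¹ x, key _ hg' hc' x hx, ?_⟩
    rw [← LinearMap.comp_apply, ← extend_mul, mul_inv_cancel, extend_one, LinearMap.id_apply]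

/-! ### Reflections and the groups they generate -/

/-- The reflection in a root `r`. -/
noncomputable def refl (r : L10) (hr : form10 r r = -2) : L10 ≃ₗ[ℤ] L10 :=
  LinearEquiv.ofInvolutive (LinearMap.id + (form10 r).smulRight r) fun x => by
    change x + form10 r x • r + form10 r (x + form10 r x • r) • r = x
    rw [map_add, map_smul, hr, smul_eq_mul]
    module

theorem refl_apply (r : L10) (hr : form10 r r = -2) (x : L10) :
    refl r hr x = x + form10 r x • r := rfl

theorem form10_refl (r : L10) (hr : form10 r r = -2) (x y : L10) :
    form10 (refl r hr x) (refl r hr y) = form10 x y := by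
  simp only [refl_apply, map_add, map_smul, LinearMap.add_apply, LinearMap.smul_apply, smul_eq_mul,
    hr, form10_comm x r]
  ring

theorem refl_mem_OPlus (r : L10) (hr : form10 r r = -2) : refl r hr ∈ OPlus := by
  refine mem_OPlus (form10_refl r hr) ?_
  rw [refl_apply, map_add, map_smul, LinearMap.add_apply, LinearMap.smul_apply, form10_c0_self,
    smul_eq_mul]
  nlinarith [sq_nonneg (form10 r c0)]

/-- The group generated by the reflections in the roots of a sublattice `S`. -/
def weyl (S : Submodule ℤ L10) : Subgroup (L10 ≃ₗ[ℤ] L10) :=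
  Subgroup.closure {g | ∃ r, ∃ hr : form10 r r = -2, r ∈ S ∧ g = refl r hr}

theorem refl_mem_weyl {S : Submodule ℤ L10} {r : L10} (hr : form10 r r = -2) (h : r ∈ S) :
    refl r hr ∈ weyl S :=
  Subgroup.subset_closure ⟨r, hr, h, rfl⟩

theorem weyl_le_OPlus (S : Submodule ℤ L10) : weyl S ≤ OPlus := by
  rw [weyl, Subgroup.closure_le]
  rintro _ ⟨r, hr, -, rfl⟩
  exact refl_mem_OPlus r hr

theorem OPlus_form {g : L10 ≃ₗ[ℤ] L10} (hg : g ∈ OPlus) (x y : L10) :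
    form10 (g x) (g y) = form10 x y := hg.1 x y

theorem weyl_form {S : Submodule ℤ L10} {g : L10 ≃ₗ[ℤ] L10} (hg : g ∈ weyl S) (x y : L10) :
    form10 (g x) (g y) = form10 x y := OPlus_form (weyl_le_OPlus S hg) x y

theorem weyl_sub_mem {S : Submodule ℤ L10} {g : L10 ≃ₗ[ℤ] L10} (hg : g ∈ weyl S) (x : L10) :
    g x - x ∈ S := by
  induction hg using Subgroup.closure_induction generalizing x with
  | mem g h =>
    obtain ⟨r, hr, hS, rfl⟩ := h
    rw [refl_apply, add_sub_cancel_left]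
    exact S.smul_mem _ hS
  | one => simp
  | mul g h _ _ ihg ihh =>
    have := S.add_mem (ihg (h x)) (ihh x)
    rwa [sub_add_sub_cancel] at this
  | inv g _ ih =>
    have := S.neg_mem (ih (g⁻¹ x))
    rw [neg_sub] at this
    change g⁻¹ x - g (g.symm x) ∈ S at this
    rwa [g.apply_symm_apply] at this

theorem weyl_map_mem {S : Submodule ℤ L10} {g : L10 ≃ₗ[ℤ] L10} (hg : g ∈ weyl S) {x : L10}
    (hx : x ∈ S) : g x ∈ S := by
  have := S.add_mem (weyl_sub_mem hg x) hx
  rwa [sub_add_cancel] at this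

theorem weyl_apply_of_orthogonal {S : Submodule ℤ L10} {g : L10 ≃ₗ[ℤ] L10} (hg : g ∈ weyl S)
    {x : L10} (hx : ∀ s ∈ S, form10 s x = 0) : g x = x := by
  induction hg using Subgroup.closure_induction with
  | mem g h =>
    obtain ⟨r, hr, hS, rfl⟩ := h
    rw [refl_apply, hx r hS, zero_smul, add_zero]
  | one => rfl
  | mul g h _ _ ihg ihh =>
    change g (h x) = x
    rw [ihh, ihg]
  | inv g _ ih =>
    change g.symm x = x
    rw [LinearEquiv.symm_apply_eq, ih]

/-! ### Simple systems of roots in `L₁₀` -/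

/-- The linear combination of the elements of `J` with coefficients `a`. -/
def comb (J : Finset L10) (a : L10 → ℤ) : L10 := ∑ j ∈ J, a j • j

/-- A simple system: roots with non-negative pairings (with the sign convention of negative-definite
root lattices) that are linearly independent and span a negative-definite lattice. -/
structure IsSimple (J : Finset L10) : Prop where
  root : ∀ j ∈ J, form10 j j = -2
  pairing : ∀ i ∈ J, ∀ j ∈ J, i ≠ j → 0 ≤ form10 i j
  negDef : ∀ a : L10 → ℤ, (∃ j ∈ J, a j ≠ 0) → form10 (comb J a) (comb J a) < 0

/-- The sublattice spanned by `J`. -/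
abbrev lat (J : Finset L10) : Submodule ℤ L10 := Submodule.span ℤ (J : Set L10)

theorem mem_lat {J : Finset L10} {j : L10} (h : j ∈ J) : j ∈ lat J := Submodule.subset_span h

theorem comb_mem (J : Finset L10) (a : L10 → ℤ) : comb J a ∈ lat J :=
  Submodule.sum_mem _ fun _ hj => Submodule.smul_mem _ _ (mem_lat hj)

theorem exists_comb {J : Finset L10} {x : L10} (h : x ∈ lat J) : ∃ a, comb J a = x := by
  obtain ⟨a, -, ha⟩ := Submodule.mem_span_finset.1 h
  exact ⟨a, ha⟩

theorem form10_comb_left (J : Finset L10) (a : L10 → ℤ) (y : L10) :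
    form10 (comb J a) y = ∑ j ∈ J, a j * form10 j y := by
  simp only [comb, map_sum, LinearMap.sum_apply, map_smul, LinearMap.smul_apply, smul_eq_mul]

theorem form10_comb_right (J : Finset L10) (a : L10 → ℤ) (y : L10) :
    form10 y (comb J a) = ∑ j ∈ J, a j * form10 y j := by
  simp only [comb, map_sum, map_smul, smul_eq_mul]

theorem comb_sub (J : Finset L10) (a b : L10 → ℤ) : comb J (a - b) = comb J a - comb J b := by
  simp [comb, sub_smul, Finset.sum_sub_distrib]

theorem comb_add (J : Finset L10) (a b : L10 → ℤ) : comb J (a + b) = comb J a + comb J b := by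
  simp [comb, add_smul, Finset.sum_add_distrib]

theorem comb_smul (J : Finset L10) (c : ℤ) (a : L10 → ℤ) :
    comb J (fun j => c * a j) = c • comb J a := by
  simp only [comb, mul_smul, Finset.smul_sum]

theorem comb_neg (J : Finset L10) (a : L10 → ℤ) : comb J (fun j => -a j) = -comb J a := by
  simp [comb]

theorem comb_eq_zero {J : Finset L10} {a : L10 → ℤ} (h : ∀ j ∈ J, a j = 0) : comb J a = 0 :=
  Finset.sum_eq_zero fun j hj => by rw [h j hj, zero_smul]

theorem comb_congr {J : Finset L10} {a b : L10 → ℤ} (h : ∀ j ∈ J, a j = b j) :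
    comb J a = comb J b :=
  Finset.sum_congr rfl fun j hj => by rw [h j hj]

theorem orthogonal_lat {J : Finset L10} {y : L10} (h : ∀ j ∈ J, form10 j y = 0) {x : L10}
    (hx : x ∈ lat J) : form10 x y = 0 := by
  obtain ⟨a, rfl⟩ := exists_comb hx
  rw [form10_comb_left]
  exact Finset.sum_eq_zero fun j hj => by rw [h j hj, mul_zero]

namespace IsSimple

variable {J : Finset L10} (hJ : IsSimple J)

include hJ

theorem neg_of_mem {x : L10} (hx : x ∈ lat J) (h0 : x ≠ 0) : form10 x x < 0 := by
  obtain ⟨a, rfl⟩ := exists_comb hx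
  refine hJ.negDef a ?_
  by_contra h
  push Not at h
  exact h0 (comb_eq_zero h)

theorem le_of_mem {x : L10} (hx : x ∈ lat J) (h0 : x ≠ 0) : form10 x x ≤ -2 := by
  have h1 := hJ.neg_of_mem hx h0
  obtain ⟨k, hk⟩ := even_form10 x
  omega

theorem nonpos_of_mem {x : L10} (hx : x ∈ lat J) : form10 x x ≤ 0 := by
  by_cases h : x = 0
  · simp [h]
  · exact (hJ.neg_of_mem hx h).le

theorem coeff_eq_zero {a : L10 → ℤ} (h : comb J a = 0) : ∀ j ∈ J, a j = 0 := by
  by_contra hn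
  push Not at hn
  have := hJ.negDef a hn
  rw [h] at this
  simp at this

theorem coeff_unique {a b : L10 → ℤ} (h : comb J a = comb J b) : ∀ j ∈ J, a j = b j := by
  intro j hj
  have := hJ.coeff_eq_zero (a := a - b) (by rw [comb_sub, h, sub_self]) j hj
  simpa [sub_eq_zero] using this

/-- Every root in the span of a simple system is a combination with coefficients of one sign: the
positive and negative parts pair non-negatively, and two non-zero parts would give square-norm at
most `-4`. -/
theorem sign {r : L10} (hr : form10 r r = -2) (hmem : r ∈ lat J) :
    ∃ a : L10 → ℤ, ((∀ j ∈ J, 0 ≤ a j) ∨ (∀ j ∈ J, a j ≤ 0)) ∧ comb J a = r := by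
  obtain ⟨a, ha⟩ := exists_comb hmem
  refine ⟨a, ?_, ha⟩
  let p : L10 → ℤ := fun j => max (a j) 0
  let n : L10 → ℤ := fun j => max (-a j) 0
  have hpn : r = comb J p - comb J n := by
    rw [← comb_sub, ← ha]
    refine comb_congr fun j _ => ?_
    simp only [Pi.sub_apply, p, n]
    omega
  have h1 : 0 ≤ form10 (comb J p) (comb J n) := by
    rw [form10_comb_left]
    refine Finset.sum_nonneg fun i hi => ?_
    rw [form10_comb_right, Finset.mul_sum]
    refine Finset.sum_nonneg fun j hj => ?_
    by_cases hij : i = j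
    · subst hij
      have : p i * n i = 0 := by
        simp only [p, n]
        rcases le_total (a i) 0 with h | h
        · rw [max_eq_right h, zero_mul]
        · rw [max_eq_right (by omega : -a i ≤ 0), mul_zero]
      rw [← mul_assoc, this, zero_mul]
    · exact mul_nonneg (le_max_right _ _) (mul_nonneg (le_max_right _ _) (hJ.pairing i hi j hj hij))
  have h2 : form10 r r = form10 (comb J p) (comb J p) + form10 (comb J n) (comb J n) -
      2 * form10 (comb J p) (comb J n) := by
    rw [hpn]
    simp only [map_sub, LinearMap.sub_apply, form10_comm (comb J n) (comb J p)]
    ring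
  by_cases hp : comb J p = 0
  · right
    intro j hj
    have := hJ.coeff_eq_zero hp j hj
    simp only [p] at this
    omega
  · left
    have hn : comb J n = 0 := by
      by_contra hn
      have h3 := hJ.le_of_mem (comb_mem J p) hp
      have h4 := hJ.le_of_mem (comb_mem J n) hn
      omega
    intro j hj
    have := hJ.coeff_eq_zero hn j hj
    simp only [n] at this
    omega

/-- Multiples of the dual basis lie in the lattice: they are the rows of the adjugate of the Gram
matrix. -/
theorem exists_dual : ∃ d : ℤ, 0 < d ∧ ∃ v : L10 → L10, ∀ j ∈ J, v j ∈ lat J ∧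
    ∀ i ∈ J, form10 (v j) i = if i = j then d else 0 := by
  classical
  let G : Matrix J J ℤ := Matrix.of fun i j => form10 i j
  have hdet : G.det ≠ 0 := by
    intro h0
    obtain ⟨x, hx0, hx⟩ := Matrix.exists_mulVec_eq_zero_iff.2 h0
    let a : L10 → ℤ := fun l => if h : l ∈ J then x ⟨l, h⟩ else 0
    have ha : ∀ i : J, a i = x i := fun i => by simp [a]
    have hneg := hJ.negDef a (by
      by_contra hn
      push Not at hn
      refine hx0 (funext fun i => ?_)
      rw [← ha, hn i i.2]; rfl)
    rw [form10_comb_left, ← Finset.sum_coe_sort] at hneg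
    have : ∑ i : J, a i * form10 i (comb J a) = 0 := by
      refine Finset.sum_eq_zero fun i _ => ?_
      rw [form10_comb_right, ← Finset.sum_coe_sort]
      have h1 := congrFun hx i
      rw [Matrix.mulVec, dotProduct] at h1
      rw [show ∑ j : J, a j * form10 i j = 0 by
        refine Eq.trans ?_ h1
        exact Finset.sum_congr rfl fun j _ => by rw [ha, mul_comm]; rfl, mul_zero]
    omega
  let v : L10 → L10 := fun l => if h : l ∈ J then ∑ i : J, (G.det * G.adjugate ⟨l, h⟩ i) • (i : L10)
    else 0
  refine ⟨G.det * G.det, mul_self_pos.2 hdet, v, fun j hj => ⟨?_, fun i hi => ?_⟩⟩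
  · simp only [v, dif_pos hj]
    exact Submodule.sum_mem _ fun i _ => Submodule.smul_mem _ _ (mem_lat i.2)
  · simp only [v, dif_pos hj]
    have h1 := congrFun (congrFun (Matrix.adjugate_mul G) ⟨j, hj⟩) ⟨i, hi⟩
    rw [Matrix.mul_apply] at h1
    simp only [map_sum, map_smul, LinearMap.sum_apply, LinearMap.smul_apply, smul_eq_mul]
    rw [show ∑ x : J, G.det * G.adjugate ⟨j, hj⟩ x * form10 x i =
      G.det * ∑ x : J, G.adjugate ⟨j, hj⟩ x * G x ⟨i, hi⟩ by
        rw [Finset.mul_sum]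
        exact Finset.sum_congr rfl fun x _ => by rw [mul_assoc]; rfl, h1]
    simp only [Matrix.smul_apply, Matrix.one_apply, Subtype.mk.injEq, smul_eq_mul, eq_comm (a := j)]
    split_ifs <;> simp

/-- A vector pairing with each simple root to the same positive number. -/
theorem exists_weylVector : ∃ d : ℤ, 0 < d ∧ ∃ c ∈ lat J, ∀ j ∈ J, form10 c j = d := by
  obtain ⟨d, hd, v, hv⟩ := hJ.exists_dual
  refine ⟨d, hd, ∑ j ∈ J, v j, Submodule.sum_mem _ fun j hj => (hv j hj).1, fun i hi => ?_⟩
  rw [map_sum, LinearMap.sum_apply, Finset.sum_congr rfl fun j hj => (hv j hj).2 i hi]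
  simp [hi]

/-- A positive multiple of any vector is the sum of an element of the lattice and a vector
orthogonal to it. -/
theorem exists_projection (x : L10) : ∃ d : ℤ, 0 < d ∧ ∃ p ∈ lat J,
    ∀ j ∈ J, form10 (d • x - p) j = 0 := by
  obtain ⟨d, hd, v, hv⟩ := hJ.exists_dual
  refine ⟨d, hd, ∑ j ∈ J, form10 x j • v j,
    Submodule.sum_mem _ fun j hj => Submodule.smul_mem _ _ (hv j hj).1, fun i hi => ?_⟩
  have : form10 (∑ j ∈ J, form10 x j • v j) i = form10 x i * d := by
    rw [map_sum, LinearMap.sum_apply]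
    simp only [map_smul, LinearMap.smul_apply, smul_eq_mul]
    rw [Finset.sum_congr rfl fun j hj => by rw [(hv j hj).2 i hi]]
    simp [hi]
  rw [map_sub, LinearMap.sub_apply, this, map_smul, LinearMap.smul_apply, smul_eq_mul]
  ring

/-- A simple system is orthogonal to a vector of the positive cone, namely to the projection
of `c₀`. -/
theorem exists_positive : ∃ h : L10, 0 < form10 h h ∧ 0 < h 9 ∧ ∀ j ∈ J, form10 h j = 0 := by
  obtain ⟨d, hd, p, hp, hort⟩ := hJ.exists_projection c0
  set h := d • c0 - p with hh
  have hhp : form10 h p = 0 := by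
    rw [form10_comm]
    exact orthogonal_lat (fun j hj => by rw [form10_comm]; exact hort j hj) hp
  have e : h + p = d • c0 := by rw [hh]; abel
  have h1 : form10 (h + p) (h + p) = d * d * 1240 := by
    rw [e]
    simp only [map_smul, LinearMap.smul_apply, smul_eq_mul, form10_c0_self]
    ring
  simp only [map_add, LinearMap.add_apply, form10_comm p h, hhp] at h1
  have h2 := hJ.nonpos_of_mem hp
  have hpos : 0 < form10 h h := by nlinarith
  refine ⟨h, hpos, ?_, hort⟩
  have h3 : form10 h (h + p) = form10 h h := by rw [map_add, hhp, add_zero]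
  rw [e, map_smul, smul_eq_mul] at h3
  have h4 : 0 < form10 h c0 := by
    by_contra hn
    nlinarith
  have h5 := form10_pos hpos (v := c0) (by rw [form10_c0_self]; norm_num)
  rw [c0_nine] at h5
  by_contra hn
  nlinarith [mul_nonneg_of_nonpos_of_nonpos (not_lt.1 hn) (neg_nonpos.2 h4.le)]

theorem image {g : L10 ≃ₗ[ℤ] L10} (hg : ∀ x y, form10 (g x) (g y) = form10 x y) :
    IsSimple (J.image g) where
  root := by
    intro j hj
    obtain ⟨i, hi, rfl⟩ := Finset.mem_image.1 hj
    rw [hg, hJ.root i hi]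
  pairing := by
    intro k hk l hl hij
    obtain ⟨i, hi, rfl⟩ := Finset.mem_image.1 hk
    obtain ⟨j, hj, rfl⟩ := Finset.mem_image.1 hl
    rw [hg]
    exact hJ.pairing i hi j hj fun h => hij (by rw [h])
  negDef := by
    intro a ⟨j, hj, h0⟩
    obtain ⟨i, hi, rfl⟩ := Finset.mem_image.1 hj
    have h : comb (J.image g) a = g (comb J fun j => a (g j)) := by
      rw [comb, Finset.sum_image fun x _ y _ h => g.injective h, comb, map_sum]
      exact Finset.sum_congr rfl fun j _ => (map_smul g _ _).symm
    rw [h, hg]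
    exact hJ.negDef _ ⟨i, hi, h0⟩

end IsSimple

/-! ### Dominance -/

theorem exists_min_of_nonneg {α : Type*} (p : α → Prop) (f : α → ℤ) (h : ∃ a, p a)
    (h0 : ∀ a, p a → 0 ≤ f a) : ∃ a, p a ∧ ∀ b, p b → f a ≤ f b := by
  obtain ⟨a, ha, hmin⟩ := WellFounded.has_min (measure fun a => (f a).toNat).wf {a | p a} h
  refine ⟨a, ha, fun b hb => ?_⟩
  have h1 : ¬ (f b).toNat < (f a).toNat := hmin b hb
  have h2 := h0 a ha
  have h3 := h0 b hb
  omega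

theorem exists_positive_add {h : L10} (hh : 0 < form10 h h) (h9 : 0 < h 9) (y : L10) :
    ∃ N₀ : ℤ, 0 < N₀ ∧ ∀ N, N₀ ≤ N →
      0 < form10 (N • h + y) (N • h + y) ∧ 0 < (N • h + y) 9 := by
  refine ⟨2 * |form10 h y| + |form10 y y| + |y 9| + 1, by positivity, fun N hN => ⟨?_, ?_⟩⟩
  · simp only [map_add, map_smul, LinearMap.add_apply, LinearMap.smul_apply, smul_eq_mul,
      form10_comm y h]
    have h1 := neg_abs_le (form10 h y)
    have h2 := neg_abs_le (form10 y y)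
    have h3 := abs_nonneg (y 9)
    have h4 := abs_nonneg (form10 h y)
    have h5 := abs_nonneg (form10 y y)
    have hN1 : 1 ≤ N := by linarith
    have h6 : N * N ≤ N * (N * form10 h h) := by
      have : N * N * 1 ≤ N * N * form10 h h := mul_le_mul_of_nonneg_left hh (by positivity)
      linarith
    have h7 : N * (2 * |form10 h y| + |form10 y y| + 1) ≤ N * N :=
      mul_le_mul_of_nonneg_left (by linarith) (by linarith)
    have h8 : N * (-|form10 h y|) ≤ N * form10 h y := mul_le_mul_of_nonneg_left h1 (by linarith)
    have h10 : |form10 y y| ≤ N * |form10 y y| := le_mul_of_one_le_left h5 hN1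
    linarith
  · change 0 < N * h 9 + y 9
    have h1 := neg_abs_le (y 9)
    have h4 := abs_nonneg (form10 h y)
    have h5 := abs_nonneg (form10 y y)
    have h3 := abs_nonneg (y 9)
    have : N * 1 ≤ N * h 9 := mul_le_mul_of_nonneg_left h9 (by linarith)
    linarith

theorem OPlus_nine {g : L10 ≃ₗ[ℤ] L10} (hg : g ∈ OPlus) {x : L10} (hx : 0 < form10 x x)
    (h9 : 0 < x 9) : 0 < g x 9 := by
  have h1 : toReal x ∈ positiveCone := by
    rw [positiveCone_eq]
    refine ⟨?_, ?_⟩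
    · rw [form10R_toReal]; exact_mod_cast hx
    · change (0 : ℝ) < x 9
      exact_mod_cast h9
  have h2 : extend g (toReal x) ∈ positiveCone := hg.2 ▸ Set.mem_image_of_mem _ h1
  rw [show extend g (toReal x) = toReal (g x) from extend_intCast g x, positiveCone_eq] at h2
  have h3 : (0 : ℝ) < g x 9 := h2.2
  exact_mod_cast h3

/-- If some `c` in the positive cone lies in the open chamber of `J`, every `u` in the positive cone
can be moved into the closed chamber: the pairings of `c` with the orbit of `u` are positive, and a
member of the orbit where the pairing is minimal is dominant. -/
theorem exists_dominant_of_positive {J : Finset L10} (hroot : ∀ j ∈ J, form10 j j = -2) {c u : L10}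
    (hc : 0 < form10 c c) (hc9 : 0 < c 9) (hcJ : ∀ j ∈ J, 0 < form10 c j)
    (hu : 0 < form10 u u) (hu9 : 0 < u 9) :
    ∃ w ∈ weyl (lat J), ∀ j ∈ J, 0 ≤ form10 (w u) j := by
  obtain ⟨w, hw, hmin⟩ := exists_min_of_nonneg (fun w => w ∈ weyl (lat J))
    (fun w => form10 (w u) c) ⟨1, one_mem _⟩ (fun w hw => by
      have h1 : 0 < form10 (w u) (w u) := by rw [weyl_form hw]; exact hu
      have h2 := form10_pos h1 hc
      have h3 := OPlus_nine (weyl_le_OPlus _ hw) hu hu9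
      by_contra hn
      nlinarith [mul_pos h3 hc9])
  refine ⟨w, hw, fun j hj => ?_⟩
  by_contra hneg
  push Not at hneg
  have hr := hroot j hj
  have h1 := hmin (refl j hr * w) (mul_mem (refl_mem_weyl hr (mem_lat hj)) hw)
  have h2 : (refl j hr * w) u = w u + form10 j (w u) • j := rfl
  simp only [h2, map_add, map_smul, LinearMap.add_apply, LinearMap.smul_apply, smul_eq_mul,
    form10_comm j] at h1
  nlinarith [hcJ j hj]

/-- Every vector can be moved to the chamber of a simple system: adding a multiple of a positive
vector orthogonal to the system brings it into the positive cone. -/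
theorem IsSimple.exists_dominant {J : Finset L10} (hJ : IsSimple J) (x : L10) :
    ∃ w ∈ weyl (lat J), ∀ j ∈ J, 0 ≤ form10 (w x) j := by
  obtain ⟨h, hh, h9, hort⟩ := hJ.exists_positive
  obtain ⟨d, hd, c, -, hc⟩ := hJ.exists_weylVector
  obtain ⟨N, -, hN⟩ := exists_positive_add hh h9 x
  obtain ⟨M, -, hM⟩ := exists_positive_add hh h9 c
  obtain ⟨w, hw, hdom⟩ := exists_dominant_of_positive hJ.root (hM M le_rfl).1 (hM M le_rfl).2
    (fun j hj => by
      rw [map_add, map_smul, LinearMap.add_apply, LinearMap.smul_apply, hort j hj, hc j hj]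
      simpa using hd) (hN N le_rfl).1 (hN N le_rfl).2
  refine ⟨w, hw, fun j hj => ?_⟩
  have h1 := hdom j hj
  have h2 : w h = h := weyl_apply_of_orthogonal hw fun s hs =>
    orthogonal_lat (fun j hj => by rw [form10_comm]; exact hort j hj) hs
  rw [map_add, map_smul, h2, map_add, map_smul, LinearMap.add_apply, LinearMap.smul_apply,
    hort j hj] at h1
  simpa using h1

/-! ### Conjugacy of simple systems -/

/-- The monoid generated by `J`. -/
def InCone (J : Finset L10) (x : L10) : Prop := ∃ a : L10 → ℤ, (∀ j ∈ J, 0 ≤ a j) ∧ comb J a = x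

/-- Two simple systems that generate the same monoid are equal, as they consist of its
indecomposable elements. -/
theorem subset_of_inCone {J K : Finset L10} (hJ : IsSimple J) (hK : IsSimple K)
    (hKJ : ∀ k ∈ K, InCone J k) (hJK : ∀ j ∈ J, InCone K j) : J ⊆ K := by
  intro j hj
  obtain ⟨b, hb, hbj⟩ := hJK j hj
  choose! a ha hak using hKJ
  -- the coefficient matrices are non-negative and inverse to each other
  have h1 : comb J (fun i => ∑ k ∈ K, b k * a k i) = comb J (fun i => if i = j then 1 else 0) := by
    have e1 : comb J (fun i => ∑ k ∈ K, b k * a k i) = j := by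
      conv_rhs => rw [← hbj]
      rw [comb, comb]
      simp only [Finset.sum_smul]
      rw [Finset.sum_comm]
      refine Finset.sum_congr rfl fun k hk => ?_
      have e2 : b k • k = b k • comb J (a k) := by rw [hak k hk]
      rw [e2, comb, Finset.smul_sum]
      exact Finset.sum_congr rfl fun i _ => by rw [mul_smul]
    rw [e1, comb]
    simp [hj]
  have h2 := hJ.coeff_unique h1
  obtain ⟨k, hk, hbk⟩ : ∃ k ∈ K, b k ≠ 0 := by
    by_contra hn
    push Not at hn
    have : j = 0 := by rw [← hbj]; exact comb_eq_zero hn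
    have h3 := hJ.root j hj
    rw [this] at h3
    simp at h3
  have hbk' : 0 < b k := lt_of_le_of_ne (hb k hk) (Ne.symm hbk)
  have h3 : ∀ i ∈ J, i ≠ j → a k i = 0 := by
    intro i hi hij
    have h4 := h2 i hi
    rw [if_neg hij] at h4
    have h5 := (Finset.sum_eq_zero_iff_of_nonneg fun k hk =>
      mul_nonneg (hb k hk) (ha k hk i hi)).1 h4 k hk
    rcases mul_eq_zero.1 h5 with h | h
    · exact absurd h hbk
    · exact h
  have h4 : k = a k j • j := by
    conv_lhs => rw [← hak k hk]
    rw [comb, Finset.sum_eq_single j]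
    · intro i hi hij
      rw [h3 i hi hij, zero_smul]
    · exact fun h => absurd hj h
  have h5 := hK.root k hk
  rw [h4, map_smul, map_smul, LinearMap.smul_apply, smul_eq_mul, smul_eq_mul, hJ.root j hj] at h5
  have h6 := ha k hk j hj
  have h7 : a k j = 1 := by nlinarith
  rw [h7, one_smul] at h4
  rwa [← h4]

/-- Two simple systems of the same lattice are conjugate under its Weyl group: after moving the Weyl
vector of one into the chamber of the other, both generate the same monoid. -/
theorem exists_weyl_image_eq {J K : Finset L10} (hJ : IsSimple J) (hK : IsSimple K)
    (h : lat K = lat J) : ∃ w ∈ weyl (lat J), K.image w = J := by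
  obtain ⟨d, hd, ρ, hρ, hρK⟩ := hK.exists_weylVector
  obtain ⟨w, hw, hdom⟩ := hJ.exists_dominant ρ
  refine ⟨w, hw, ?_⟩
  have hL : IsSimple (K.image w) := hK.image (weyl_form hw)
  have hρL : ∀ k ∈ K.image w, form10 (w ρ) k = d := by
    intro k hk
    obtain ⟨i, hi, rfl⟩ := Finset.mem_image.1 hk
    rw [weyl_form hw, hρK i hi]
  have hLJ : lat (K.image w) = lat J := by
    apply le_antisymm
    · rw [Submodule.span_le]
      intro k hk
      obtain ⟨i, hi, rfl⟩ := Finset.mem_image.1 hk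
      exact weyl_map_mem hw (h ▸ mem_lat hi)
    · intro x hx
      have h1 : w⁻¹ x ∈ lat K := h ▸ weyl_map_mem (inv_mem hw) hx
      have h2 : x = w (w⁻¹ x) := (w.apply_symm_apply x).symm
      rw [h2, lat, Finset.coe_image]
      change w (w⁻¹ x) ∈ Submodule.span ℤ ((w : L10 →ₗ[ℤ] L10) '' (K : Set L10))
      rw [Submodule.span_image]
      exact ⟨_, h1, rfl⟩
  have h1 : ∀ k ∈ K.image w, InCone J k := by
    intro k hk
    obtain ⟨a, ha | ha, hak⟩ := hJ.sign (hL.root k hk) (hLJ ▸ mem_lat hk)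
    · exact ⟨a, ha, hak⟩
    · have h2 := hρL k hk
      rw [← hak, form10_comb_right] at h2
      have h3 := Finset.sum_nonpos fun j hj =>
        mul_nonpos_of_nonpos_of_nonneg (ha j hj) (hdom j hj)
      omega
  have h2 : ∀ j ∈ J, InCone (K.image w) j := by
    intro j hj
    obtain ⟨a, ha | ha, hak⟩ := hL.sign (hJ.root j hj) (hLJ ▸ mem_lat hj)
    · exact ⟨a, ha, hak⟩
    · have h3 := hdom j hj
      rw [← hak, form10_comb_right] at h3
      have h4 : ∀ k ∈ K.image w, a k * form10 (w ρ) k ≤ 0 := fun k hk => by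
        rw [hρL k hk]; exact mul_nonpos_of_nonpos_of_nonneg (ha k hk) hd.le
      have h5 := (Finset.sum_eq_zero_iff_of_nonpos h4).1 (le_antisymm (Finset.sum_nonpos h4) h3)
      refine ⟨a, fun k hk => ?_, hak⟩
      have h6 := h5 k hk
      rw [hρL k hk] at h6
      rcases mul_eq_zero.1 h6 with h | h <;> omega
  exact (subset_of_inCone hL hJ h2 h1).antisymm (subset_of_inCone hJ hL h1 h2)

/-! ### The fundamental chamber of `L₁₀` -/

/-- The standard basis `e₁, …, e₁₀`. -/
def basisVec (i : Fin 10) : L10 := Pi.single i 1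

theorem basisVec_injective : Function.Injective basisVec := fun i j h => by
  by_contra hij
  have := congrFun h i
  simp [basisVec, hij] at this

theorem form10_basisVec_right (x : L10) (i : Fin 10) :
    form10 x (basisVec i) = ∑ j, x j * gramE10 j i := by
  rw [form10_apply]
  simp [basisVec, Pi.single_apply]

theorem form10_basisVec (i j : Fin 10) : form10 (basisVec i) (basisVec j) = gramE10 i j := by
  rw [form10_basisVec_right]
  simp [basisVec, Pi.single_apply]

theorem sum_basisVec (x : L10) : ∑ i, x i • basisVec i = x := by
  ext j
  simp [basisVec, Finset.sum_apply, Pi.single_apply]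

theorem form10_eq_sum (h x : L10) : form10 h x = ∑ i, x i * form10 h (basisVec i) := by
  conv_lhs => rw [← sum_basisVec x]
  simp only [map_sum, map_smul, smul_eq_mul]

/-- The entries of `gramE10`, as a function. -/
def entryE10 (i j : Fin 10) : ℤ := gramE10 i j

theorem gramE10_diag : ∀ i, gramE10 i i = -2 :=
  (by decide : ∀ i, entryE10 i i = -2)

theorem gramE10_off_diag : ∀ i j, i ≠ j → gramE10 i j = 0 ∨ gramE10 i j = 1 :=
  (by decide : ∀ i j, i ≠ j → entryE10 i j = 0 ∨ entryE10 i j = 1)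

theorem form10_c0 (i : Fin 10) : form10 c0 (basisVec i) = 1 := by
  rw [form10_comm, form10_expand]
  revert i
  decide

/-- The fundamental weights other than the last one, which is isotropic. -/
def weight (i : Fin 10) : L10 :=
  (![![10, 7, 14, 21, 18, 15, 12, 9, 6, 3], ![7, 4, 9, 14, 12, 10, 8, 6, 4, 2],
    ![14, 9, 18, 28, 24, 20, 16, 12, 8, 4], ![21, 14, 28, 42, 36, 30, 24, 18, 12, 6],
    ![18, 12, 24, 36, 30, 25, 20, 15, 10, 5], ![15, 10, 20, 30, 25, 20, 16, 12, 8, 4],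
    ![12, 8, 16, 24, 20, 16, 12, 9, 6, 3], ![9, 6, 12, 18, 15, 12, 9, 6, 4, 2],
    ![6, 4, 8, 12, 10, 8, 6, 4, 2, 1], ![3, 2, 4, 6, 5, 4, 3, 2, 1, 0]] : Fin 10 → L10) i

theorem form10_weight (i : Fin 10) (x : L10) : form10 (weight i) x = x i := by
  have h : ∀ i j, form10 (weight i) (basisVec j) = if i = j then 1 else 0 := by
    intro i j
    rw [form10_expand]
    revert i j
    decide +kernel
  rw [form10_eq_sum]
  simp [h]

theorem weight_self_pos : ∀ i : Fin 10, i ≠ 9 → 0 < weight i i := by decide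

/-- A vector with a vanishing coordinate has non-positive square-norm. -/
theorem self_nonpos_of_coord {x : L10} {i : Fin 10} (h : x i = 0) :
    form10 x x ≤ 0 ∧ (form10 x x = 0 → x = 0 ∨ i = 9 ∧ x = x 8 • weight 9) := by
  by_cases hi : i = 9
  · subst hi
    have h1 : toReal x 9 = 0 := by simp [toReal, h]
    refine ⟨?_, fun h0 => Or.inr ⟨rfl, ?_⟩⟩
    · have := form10R_self_nonpos h1
      rw [form10R_toReal] at this
      exact_mod_cast this
    · have h2 := eq_of_form10R_self_eq_zero h1 (by rw [form10R_toReal, h0]; simp)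
      have h3 : ∀ k, (weight 9 k : ℝ) = (![3, 2, 4, 6, 5, 4, 3, 2, 1, 0] : Fin 10 → ℝ) k := by
        intro k
        fin_cases k <;> simp [weight]
      ext k
      have h4 := congrFun h2 k
      simp only [toReal, ← h3] at h4
      exact_mod_cast h4
  · have hpos : 0 < form10 (weight i) (weight i) := by
      rw [form10_weight]; exact weight_self_pos i hi
    have := form10_orthogonal hpos (x := x) (by rw [form10_weight, h])
    exact ⟨this.1, fun h0 => Or.inl (this.2 h0)⟩

/-- A root is not the difference of an isotropic and a non-zero vector, both with non-negative
coefficients and of disjoint supports. -/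
theorem not_root_of_isotropic {p n : L10} (hp : ∀ i, 0 ≤ p i) (hn : ∀ i, 0 ≤ n i)
    (hd : ∀ i, p i = 0 ∨ n i = 0) (hp0 : p ≠ 0) (hn0 : n ≠ 0) (h0 : form10 p p = 0) :
    form10 (p - n) (p - n) ≠ -2 := by
  -- the support of `n` must be the last node, so that `p` is a multiple of the null root
  have h1 : ∀ i, n i ≠ 0 → i = 9 ∧ p = p 8 • weight 9 := fun i hi =>
    ((self_nonpos_of_coord ((hd i).resolve_right hi)).2 h0).resolve_left hp0
  obtain ⟨i, hi⟩ : ∃ i, n i ≠ 0 := by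
    by_contra h
    push Not at h
    exact hn0 (funext h)
  obtain ⟨rfl, hp8⟩ := h1 i hi
  have hn9 : n = n 9 • basisVec 9 := by
    ext k
    by_cases hk : k = 9
    · subst hk; simp [basisVec]
    · have : n k = 0 := by
        by_contra h
        exact hk (h1 k h).1
      simp [basisVec, hk, this]
  have h2 : form10 p n = p 8 * n 9 := by
    conv_lhs => rw [hp8]
    rw [map_smul, LinearMap.smul_apply, form10_weight, smul_eq_mul]
  have h3 : form10 n n = -2 * (n 9 * n 9) := by
    rw [hn9]
    simp only [map_smul, LinearMap.smul_apply, smul_eq_mul, form10_basisVec, gramE10_diag]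
    simp [basisVec]
    ring
  have h4 : 0 < n 9 := lt_of_le_of_ne (hn 9) (Ne.symm hi)
  have h5 : 0 < p 8 := by
    refine lt_of_le_of_ne (hp 8) fun h => hp0 ?_
    rw [hp8, ← h, zero_smul]
  simp only [map_sub, LinearMap.sub_apply, form10_comm n p, h0, h2, h3]
  nlinarith

theorem form10_nonneg_of_disjoint {p n : L10} (hp : ∀ i, 0 ≤ p i) (hn : ∀ i, 0 ≤ n i)
    (hd : ∀ i, p i = 0 ∨ n i = 0) : 0 ≤ form10 p n := by
  rw [form10_apply]
  refine Finset.sum_nonneg fun i _ => Finset.sum_nonneg fun j _ => ?_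
  by_cases hij : i = j
  · subst hij
    rcases hd i with h | h <;> simp [h]
  · have : 0 ≤ gramE10 i j := by rcases gramE10_off_diag i j hij with h | h <;> rw [h]; norm_num
    exact mul_nonneg (mul_nonneg (hp i) this) (hn j)

/-- Every root of `L₁₀` has coefficients of one sign in the basis `e₁, …, e₁₀`: since `E₁₀` is a
hyperbolic diagram, vectors supported on proper subsets have non-positive square-norm. -/
theorem root_sign {r : L10} (hr : form10 r r = -2) : (∀ i, 0 ≤ r i) ∨ (∀ i, r i ≤ 0) := by
  let p : L10 := fun i => max (r i) 0
  let n : L10 := fun i => max (-r i) 0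
  have hp : ∀ i, 0 ≤ p i := fun i => le_max_right _ _
  have hn : ∀ i, 0 ≤ n i := fun i => le_max_right _ _
  have hd : ∀ i, p i = 0 ∨ n i = 0 := fun i => by simp only [p, n]; omega
  have hpn : r = p - n := by ext i; simp only [Pi.sub_apply, p, n]; omega
  by_cases hp0 : p = 0
  · right
    intro i
    have := congrFun hp0 i
    simp only [p, Pi.zero_apply] at this
    omega
  by_cases hn0 : n = 0
  · left
    intro i
    have := congrFun hn0 i
    simp only [n, Pi.zero_apply] at this
    omega
  exfalso
  obtain ⟨i, hi⟩ : ∃ i, n i ≠ 0 := by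
    by_contra h
    push Not at h
    exact hn0 (funext h)
  obtain ⟨j, hj⟩ : ∃ j, p j ≠ 0 := by
    by_contra h
    push Not at h
    exact hp0 (funext h)
  have h1 := (self_nonpos_of_coord ((hd i).resolve_right hi)).1
  have h2 := (self_nonpos_of_coord ((hd j).resolve_left hj)).1
  have h3 := form10_nonneg_of_disjoint hp hn hd
  have h4 : form10 r r = form10 p p + form10 n n - 2 * form10 p n := by
    rw [hpn]
    simp only [map_sub, LinearMap.sub_apply, form10_comm n p]
    ring
  obtain ⟨k, hk⟩ := even_form10 p
  obtain ⟨l, hl⟩ := even_form10 n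
  rcases (by omega : form10 p p = 0 ∨ form10 n n = 0) with h0 | h0
  · exact not_root_of_isotropic hp hn hd hp0 hn0 h0 (hpn ▸ hr)
  · refine not_root_of_isotropic hn hp (fun i => (hd i).symm) hn0 hp0 h0 ?_
    rw [← neg_sub p n, ← hpn]
    simpa using hr

/-- The set of basis vectors indexed by `I`. -/
def basisSet (I : Finset (Fin 10)) : Finset L10 := I.image basisVec

theorem basisVec_mem_basisSet {I : Finset (Fin 10)} {i : Fin 10} (h : i ∈ I) :
    basisVec i ∈ basisSet I := Finset.mem_image_of_mem _ h

theorem comb_basisSet (I : Finset (Fin 10)) (a : L10 → ℤ) :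
    comb (basisSet I) a = fun i => if i ∈ I then a (basisVec i) else 0 := by
  rw [comb, basisSet, Finset.sum_image fun i _ j _ h => basisVec_injective h]
  ext i
  simp [basisVec, Finset.sum_apply, Pi.single_apply]

theorem mem_lat_basisSet {I : Finset (Fin 10)} {x : L10} :
    x ∈ lat (basisSet I) ↔ ∀ i, x i ≠ 0 → i ∈ I := by
  constructor
  · intro h i hi
    obtain ⟨a, rfl⟩ := exists_comb h
    rw [comb_basisSet] at hi
    by_contra hn
    simp [hn] at hi
  · intro h
    rw [← sum_basisVec x]
    refine Submodule.sum_mem _ fun i _ => ?_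
    by_cases hi : x i = 0
    · rw [hi, zero_smul]; exact zero_mem _
    · exact Submodule.smul_mem _ _ (mem_lat (basisVec_mem_basisSet (h i hi)))

/-- A root orthogonal to a dominant vector `h` of the positive cone is a combination of the basis
vectors orthogonal to `h`. -/
theorem root_mem_of_orthogonal {h r : L10} (hdom : ∀ i, 0 ≤ form10 h (basisVec i))
    (hr : form10 r r = -2) (hhr : form10 h r = 0) :
    r ∈ lat (basisSet (Finset.univ.filter fun i => form10 h (basisVec i) = 0)) := by
  have key : ∀ s : L10, (∀ i, 0 ≤ s i) → form10 h s = 0 →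
      ∀ i, s i ≠ 0 → form10 h (basisVec i) = 0 := by
    intro s hs h0 i hi
    rw [form10_eq_sum] at h0
    have := (Finset.sum_eq_zero_iff_of_nonneg fun i _ => mul_nonneg (hs i) (hdom i)).1 h0 i
      (Finset.mem_univ i)
    exact (mul_eq_zero.1 this).resolve_left hi
  rw [mem_lat_basisSet]
  intro i hi
  rw [Finset.mem_filter]
  refine ⟨Finset.mem_univ i, ?_⟩
  rcases root_sign hr with hs | hs
  · exact key r hs hhr i hi
  · exact key (-r) (fun i => by simpa using hs i) (by simpa using hhr) i (by simpa using hi)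

/-- Basis vectors orthogonal to a vector of positive square-norm form a simple system. -/
theorem isSimple_basisSet {h : L10} (hh : 0 < form10 h h) {I : Finset (Fin 10)}
    (hI : ∀ i ∈ I, form10 h (basisVec i) = 0) : IsSimple (basisSet I) where
  root := by
    intro j hj
    obtain ⟨i, -, rfl⟩ := Finset.mem_image.1 hj
    rw [form10_basisVec, gramE10_diag]
  pairing := by
    intro x hx y hy hxy
    obtain ⟨i, -, rfl⟩ := Finset.mem_image.1 hx
    obtain ⟨j, -, rfl⟩ := Finset.mem_image.1 hy
    rw [form10_basisVec]
    rcases gramE10_off_diag i j (fun h => hxy (by rw [h])) with h | h <;> rw [h]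
    norm_num
  negDef := by
    intro a ⟨x, hx, hax⟩
    obtain ⟨i, hi, rfl⟩ := Finset.mem_image.1 hx
    have h1 : form10 h (comb (basisSet I) a) = 0 := by
      rw [form10_comb_right]
      refine Finset.sum_eq_zero fun y hy => ?_
      obtain ⟨j, hj, rfl⟩ := Finset.mem_image.1 hy
      rw [hI j hj, mul_zero]
    have h2 := form10_orthogonal hh h1
    refine lt_of_le_of_ne h2.1 fun h0 => hax ?_
    have h3 := congrFun (h2.2 h0) i
    rw [comb_basisSet] at h3
    simpa [hi] using h3

/-- Every simple system can be moved into the lattice of a subset of the basis of the same rank.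
Among the chamber vectors orthogonal to a translate of `Φ`, one with the fewest orthogonal basis
vectors is used: if the rank of those exceeded the rank of `Φ`, perturbing it would reduce their
number. -/
theorem exists_parabolic {Φ : Finset L10} (hΦ : IsSimple Φ) :
    ∃ g ∈ OPlus, ∃ I : Finset (Fin 10), IsSimple (basisSet I) ∧
      (∀ x ∈ Φ, g x ∈ lat (basisSet I)) ∧
      ∀ i ∈ I, ∃ k : ℤ, k ≠ 0 ∧ k • basisVec i ∈ lat (Φ.image g) := by
  let Z : L10 → Finset (Fin 10) := fun h => Finset.univ.filter fun i => form10 h (basisVec i) = 0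
  have hZ : ∀ h i, i ∈ Z h ↔ form10 h (basisVec i) = 0 := fun h i => by simp [Z]
  obtain ⟨⟨g, h⟩, ⟨hg, hh, h9, hdom, hort⟩, hmin⟩ := exists_min_of_nonneg
    (fun p : (L10 ≃ₗ[ℤ] L10) × L10 => p.1 ∈ OPlus ∧ 0 < form10 p.2 p.2 ∧ 0 < p.2 9 ∧
      (∀ i, 0 ≤ form10 p.2 (basisVec i)) ∧ ∀ x ∈ Φ, form10 p.2 (p.1 x) = 0)
    (fun p => (Z p.2).card) (by
      obtain ⟨h, hh, h9, hort⟩ := hΦ.exists_positive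
      obtain ⟨w, hw, hdom⟩ := exists_dominant_of_positive (J := basisSet Finset.univ) (c := c0)
        (u := h) (fun j hj => by
          obtain ⟨i, -, rfl⟩ := Finset.mem_image.1 hj
          rw [form10_basisVec, gramE10_diag]) (by rw [form10_c0_self]; norm_num)
        (by rw [c0_nine]; norm_num) (fun j hj => by
          obtain ⟨i, -, rfl⟩ := Finset.mem_image.1 hj
          rw [form10_c0]; norm_num) hh h9
      have hw' := weyl_le_OPlus _ hw
      refine ⟨(w, w h), hw', by rw [OPlus_form hw']; exact hh, OPlus_nine hw' hh h9,
        fun i => hdom _ (basisVec_mem_basisSet (Finset.mem_univ i)), fun x hx => ?_⟩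
      rw [OPlus_form hw']
      exact hort x hx) (fun _ _ => by positivity)
  simp only at hg hh h9 hdom hort hmin
  have hI : IsSimple (basisSet (Z h)) := isSimple_basisSet hh fun i hi => (hZ h i).1 hi
  have hsub : ∀ x ∈ Φ, g x ∈ lat (basisSet (Z h)) := fun x hx =>
    root_mem_of_orthogonal hdom (by rw [OPlus_form hg]; exact hΦ.root x hx) (hort x hx)
  refine ⟨g, hg, Z h, hI, hsub, fun i hi => ?_⟩
  have hΨ : IsSimple (Φ.image g) := hΦ.image (OPlus_form hg)
  obtain ⟨d, hd, p, hp, hpo⟩ := hΨ.exists_projection (basisVec i)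
  refine ⟨d, hd.ne', ?_⟩
  by_contra hnot
  set v := d • basisVec i - p with hv
  have hv0 : v ≠ 0 := fun h0 => hnot (by rw [sub_eq_zero.1 (hv.symm.trans h0)]; exact hp)
  have hpI : p ∈ lat (basisSet (Z h)) := by
    refine (Submodule.span_le.2 ?_ : lat (Φ.image g) ≤ _) hp
    intro y hy
    obtain ⟨x, hx, rfl⟩ := Finset.mem_image.1 hy
    exact hsub x hx
  have hvI : v ∈ lat (basisSet (Z h)) := sub_mem
    (Submodule.smul_mem _ _ (mem_lat (basisVec_mem_basisSet hi))) hpI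
  obtain ⟨w, hw, hwdom⟩ := hI.exists_dominant v
  have hwO := weyl_le_OPlus _ hw
  have hwh : w h = h := weyl_apply_of_orthogonal hw fun s hs => orthogonal_lat (fun j hj => by
    obtain ⟨k, hk, rfl⟩ := Finset.mem_image.1 hj
    rw [form10_comm, (hZ h k).1 hk]) hs
  obtain ⟨N₀, hN₀, hN⟩ := exists_positive_add hh h9 (w v)
  let N := N₀ + ∑ k, |form10 (w v) (basisVec k)|
  have hNk : ∀ k, |form10 (w v) (basisVec k)| < N := fun k => by
    have := Finset.single_le_sum (f := fun k => |form10 (w v) (basisVec k)|)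
      (fun k _ => abs_nonneg _) (Finset.mem_univ k)
    simp only [N]
    omega
  have hN1 := hN N (by
    have : 0 ≤ ∑ k, |form10 (w v) (basisVec k)| := Finset.sum_nonneg fun k _ => abs_nonneg _
    simp only [N]; omega)
  have hform : ∀ y, form10 (N • h + w v) y = N * form10 h y + form10 (w v) y := fun y => by
    simp only [map_add, map_smul, LinearMap.add_apply, LinearMap.smul_apply, smul_eq_mul]
  -- off the zero set of `h`, the perturbed vector stays strictly dominant
  have hoff : ∀ k, k ∉ Z h → 0 < form10 (N • h + w v) (basisVec k) := by
    intro k hk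
    rw [hform]
    have h1 : form10 h (basisVec k) ≠ 0 := fun h0 => hk ((hZ h k).2 h0)
    have h2 : 1 ≤ form10 h (basisVec k) := by
      have := hdom k
      omega
    have h3 := hNk k
    have h4 := neg_abs_le (form10 (w v) (basisVec k))
    have h5 := abs_nonneg (form10 (w v) (basisVec k))
    nlinarith
  have hon : ∀ k, k ∈ Z h → form10 (N • h + w v) (basisVec k) = form10 (w v) (basisVec k) := by
    intro k hk
    rw [hform, (hZ h k).1 hk, mul_zero, zero_add]
  have hle := hmin (w * g, N • h + w v) ⟨mul_mem hwO hg, hN1.1, hN1.2, fun k => by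
      by_cases hk : k ∈ Z h
      · simp only
        rw [hon k hk]
        exact hwdom _ (basisVec_mem_basisSet hk)
      · exact (hoff k hk).le, fun x hx => by
      change form10 (N • h + w v) (w (g x)) = 0
      rw [← hwh, ← map_smul, ← map_add, OPlus_form hwO]
      simp only [map_add, map_smul, LinearMap.add_apply, LinearMap.smul_apply, smul_eq_mul,
        hort x hx]
      rw [hv, hpo _ (Finset.mem_image_of_mem _ hx)]
      ring⟩
  have hsubset : Z (N • h + w v) ⊆ Z h := by
    intro k hk
    by_contra hn
    exact absurd ((hZ _ k).1 hk) (hoff k hn).ne'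
  have heq : Z (N • h + w v) = Z h :=
    Finset.eq_of_subset_of_card_le hsubset (by exact_mod_cast hle)
  have hwv : w v = 0 := by
    have hmem : w v ∈ lat (basisSet (Z h)) := weyl_map_mem hw hvI
    by_contra h0
    have h1 := hI.neg_of_mem hmem h0
    have h2 : form10 (w v) (w v) = 0 := orthogonal_lat (fun j hj => by
      obtain ⟨k, hk, rfl⟩ := Finset.mem_image.1 hj
      rw [form10_comm, ← hon k hk]
      exact (hZ _ k).1 (heq ▸ hk)) hmem
    omega
  exact hv0 ((map_eq_zero_iff w w.injective).1 hwv)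

/-! ### Sublattices of full rank -/

/-- The decomposition of a simple system into blocks, each with a root `θ i = ∑ m i j • j` that
pairs non-positively with the simple roots: the highest root of the block. The block `i` consists of
the `j` with `m i j ≠ 0`. -/
structure HighestRoots (J : Finset L10) {ι : Type*} (θ : ι → L10) (m : ι → L10 → ℤ) : Prop where
  root : ∀ i, form10 (θ i) (θ i) = -2
  comb_eq : ∀ i, comb J (m i) = θ i
  nonneg : ∀ i, ∀ j ∈ J, 0 ≤ m i j
  nonpos : ∀ i, ∀ j ∈ J, form10 (θ i) j ≤ 0
  cover : ∀ j ∈ J, ∃ i, 0 < m i j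
  disjoint : ∀ i i', ∀ j ∈ J, 0 < m i j → 0 < m i' j → i = i'

theorem comb_single {J : Finset L10} {j : L10} (hj : j ∈ J) :
    comb J (fun i => if i = j then 1 else 0) = j := by
  rw [comb]
  simp [hj]

/-- Roots of a negative-definite lattice have pairing at least `-2`, with equality only for equal
roots. -/
theorem IsSimple.eq_of_form10_le {J : Finset L10} (hJ : IsSimple J) {r s : L10} (hr : r ∈ lat J)
    (hs : s ∈ lat J) (hr2 : form10 r r = -2) (hs2 : form10 s s = -2) (h : form10 r s ≤ -2) :
    r = s := by
  by_contra hne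
  have h1 := hJ.neg_of_mem (sub_mem hr hs) (sub_ne_zero.2 hne)
  simp only [map_sub, LinearMap.sub_apply, form10_comm s r, hr2, hs2] at h1
  omega

/-- A positive root lies below the highest root of some block. -/
theorem HighestRoots.exists_le {J : Finset L10} (hJ : IsSimple J) {ι : Type*} {θ : ι → L10}
    {m : ι → L10 → ℤ} (hθ : HighestRoots J θ m) {r : L10} (hr : form10 r r = -2)
    (hpos : InCone J r) : ∃ i, ∃ n : L10 → ℤ, (∀ j ∈ J, 0 ≤ n j) ∧ θ i = r + comb J n := by
  obtain ⟨a, ha, har⟩ := hpos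
  obtain ⟨d, hd, c, hc, hcJ⟩ := hJ.exists_weylVector
  have hrmem : r ∈ lat J := har ▸ comb_mem J a
  -- a root of maximal height among those above `r`
  obtain ⟨n, ⟨hn, hroot⟩, hmin⟩ := exists_min_of_nonneg
    (fun n : L10 → ℤ => (∀ j ∈ J, 0 ≤ n j) ∧
      form10 (r + comb J n) (r + comb J n) = -2)
    (fun n => 2 - form10 c c - 2 * form10 c (r + comb J n))
    ⟨0, fun j _ => le_rfl, by
      rw [show comb J 0 = 0 from comb_eq_zero fun j _ => rfl, add_zero, hr]⟩
    (fun n ⟨_, hn⟩ => by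
      have h1 := hJ.nonpos_of_mem (add_mem (add_mem hrmem (comb_mem J n)) hc)
      generalize r + comb J n = s at hn h1 ⊢
      simp only [map_add, LinearMap.add_apply, form10_comm s c, hn] at h1
      omega)
  set s := r + comb J n with hs
  have hsmem : s ∈ lat J := add_mem hrmem (comb_mem J n)
  have hsa : s = comb J (a + n) := by rw [comb_add, har]
  clear_value s
  have hdom : ∀ j ∈ J, form10 s j ≤ 0 := by
    intro j hj
    by_contra hgt
    push Not at hgt
    have h2 : form10 s j < 2 := by
      by_contra h2
      -- otherwise `s` would be the opposite of a simple root
      have h3 := hJ.eq_of_form10_le hsmem (neg_mem (mem_lat hj)) hroot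
        (by simpa using hJ.root j hj) (by rw [map_neg]; omega)
      have h4 : comb J (a + n) = comb J (fun i => -(if i = j then 1 else 0)) := by
        rw [← hsa, h3, comb_neg, comb_single hj]
      have h5 := hJ.coeff_unique h4 j hj
      simp only [Pi.add_apply, if_true] at h5
      have := ha j hj
      have := hn j hj
      omega
    have h6 : r + comb J (n + fun i => if i = j then 1 else 0) = s + j := by
      rw [comb_add, comb_single hj, hs, add_assoc]
    have h7 := hmin (n + fun i => if i = j then 1 else 0) ⟨fun i hi => by
        have := hn i hi
        simp only [Pi.add_apply]
        split_ifs <;> omega, by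
        rw [h6]
        simp only [map_add, LinearMap.add_apply, form10_comm j s, hroot, hJ.root j hj]
        omega⟩
    have h8 : form10 c (s + j) = form10 c s + d := by rw [map_add, hcJ j hj]
    rw [h6, h8] at h7
    omega
  obtain ⟨j, hj, hneg⟩ : ∃ j ∈ J, form10 s j < 0 := by
    by_contra hn'
    push Not at hn'
    have : form10 (comb J (a + n)) s = 0 := by
      rw [form10_comb_left]
      refine Finset.sum_eq_zero fun j hj => ?_
      rw [form10_comm, le_antisymm (hdom j hj) (hn' j hj), mul_zero]
    rw [← hsa] at this
    omega
  obtain ⟨i, hi⟩ := hθ.cover j hj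
  refine ⟨i, n, hn, ?_⟩
  have hθmem : θ i ∈ lat J := hθ.comb_eq i ▸ comb_mem J _
  have hlt : form10 s (θ i) < 0 := by
    rw [← hθ.comb_eq, form10_comb_right]
    exact Finset.sum_neg' (fun k hk => mul_nonpos_of_nonneg_of_nonpos (hθ.nonneg i k hk)
      (hdom k hk)) ⟨j, hj, mul_neg_of_pos_of_neg hi hneg⟩
  by_contra hne
  have h1 : form10 s (θ i) = -1 := by
    by_contra h1
    exact hne ((hJ.eq_of_form10_le hsmem hθmem hroot (hθ.root i) (by omega)).symm.trans hs)
  -- the difference of the two roots is a root, of one sign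
  obtain ⟨b, hb, hbs⟩ := hJ.sign (r := s - θ i) (by
    simp only [map_sub, LinearMap.sub_apply, form10_comm (θ i) s, hroot, hθ.root i, h1]
    norm_num) (sub_mem hsmem hθmem)
  rcases hb with hb | hb
  · have h2 : form10 (θ i) (s - θ i) = 1 := by
      rw [map_sub, form10_comm, h1, hθ.root]; norm_num
    rw [← hbs, form10_comb_right] at h2
    have := Finset.sum_nonpos fun k hk =>
      mul_nonpos_of_nonneg_of_nonpos (hb k hk) (hθ.nonpos i k hk)
    omega
  · have h2 : form10 s (s - θ i) = -1 := by
      rw [map_sub, h1, hroot]; norm_num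
    rw [← hbs, form10_comb_right] at h2
    have := Finset.sum_nonneg fun k hk => mul_nonneg_of_nonpos_of_nonpos (hb k hk) (hdom k hk)
    omega

theorem exists_smul_mem_of_full {J Φ : Finset L10}
    (hfull : ∀ j ∈ J, ∃ k : ℤ, k ≠ 0 ∧ k • j ∈ lat Φ) {x : L10} (hx : x ∈ lat J) :
    ∃ k : ℤ, k ≠ 0 ∧ k • x ∈ lat Φ := by
  induction hx using Submodule.span_induction with
  | mem x h => exact hfull x h
  | zero => exact ⟨1, one_ne_zero, by simp⟩
  | add x y _ _ ihx ihy =>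
    obtain ⟨k, hk, hkx⟩ := ihx
    obtain ⟨l, hl, hly⟩ := ihy
    refine ⟨k * l, mul_ne_zero hk hl, ?_⟩
    rw [smul_add]
    refine add_mem ?_ ?_
    · rw [mul_comm, mul_smul]; exact Submodule.smul_mem _ _ hkx
    · rw [mul_smul]; exact Submodule.smul_mem _ _ hly
  | smul c x _ ih =>
    obtain ⟨k, hk, hkx⟩ := ih
    exact ⟨k, hk, by rw [smul_comm]; exact Submodule.smul_mem _ _ hkx⟩

/-- A proper sublattice of finite index is contained in the kernel of a functional modulo some
integer. -/
theorem exists_functional {J Φ : Finset L10} (hΦ : IsSimple Φ)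
    (hfull : ∀ j ∈ J, ∃ k : ℤ, k ≠ 0 ∧ k • j ∈ lat Φ) (hne : ¬ lat J ≤ lat Φ) :
    ∃ T : ℤ, 0 < T ∧ ∃ v ∈ lat Φ, (∀ x ∈ Φ, T ∣ form10 v x) ∧ ∃ j ∈ J, ¬ T ∣ form10 v j := by
  obtain ⟨d, hd, v, hv⟩ := hΦ.exists_dual
  by_contra hn
  push Not at hn
  have h1 : ∀ x ∈ Φ, ∀ j ∈ J, d ∣ form10 (v x) j := fun x hx =>
    hn d hd (v x) (hv x hx).1 fun y hy => by
      rw [(hv x hx).2 y hy]; split_ifs <;> simp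
  refine hne (Submodule.span_le.2 fun j hj => ?_)
  obtain ⟨k, hk, hkj⟩ := hfull j hj
  obtain ⟨b, hb⟩ := exists_comb hkj
  choose! c hc using fun x hx => h1 x hx j hj
  have h2 : ∀ x ∈ Φ, b x = k * c x := by
    intro x hx
    have h3 : form10 (v x) (k • j) = d * b x := by
      rw [← hb, form10_comb_right, Finset.sum_congr rfl fun y hy => by rw [(hv x hx).2 y hy]]
      simp [hx, mul_comm]
    rw [map_smul, hc x hx, smul_eq_mul] at h3
    have : d * (b x - k * c x) = 0 := by linarith
    rcases mul_eq_zero.1 this with h | h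
    · omega
    · omega
  have h4 : k • (j - comb Φ c) = 0 := by
    rw [smul_sub, ← comb_smul, ← hb, comb_congr h2, sub_self]
  have h5 := (smul_eq_zero.1 h4).resolve_left hk
  rw [sub_eq_zero.1 h5]
  exact comb_mem Φ c

/-- Up to the Weyl group and translations by `T` times coroots, the functional takes values in the
fundamental alcove: a representative nearest to an interior point of the alcove is chosen. -/
theorem exists_alcove {J Φ : Finset L10} (hJ : IsSimple J) {ι : Type*}
    [Fintype ι] {θ : ι → L10} {m : ι → L10 → ℤ} (hθ : HighestRoots J θ m) {T : ℤ} (hT : 0 < T)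
    {v₀ : L10} (hv₀ : v₀ ∈ lat J) (hdiv : ∀ x ∈ Φ, T ∣ form10 v₀ x)
    (hndiv : ∃ j ∈ J, ¬ T ∣ form10 v₀ j) :
    ∃ w ∈ weyl (lat J), ∃ v ∈ lat J, (∀ x ∈ Φ, T ∣ form10 v (w x)) ∧
      (∃ j ∈ J, ¬ T ∣ form10 v j) ∧ (∀ j ∈ J, 0 ≤ form10 v j) ∧ ∀ i, form10 v (θ i) ≤ T := by
  obtain ⟨d, hd, q, hq, hqJ⟩ := hJ.exists_weylVector
  let K : ℤ := 1 + ∑ i, |form10 q (θ i)|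
  have hK : ∀ i, form10 q (θ i) < K := fun i => by
    have h1 := Finset.single_le_sum (f := fun i => |form10 q (θ i)|)
      (fun i _ => abs_nonneg _) (Finset.mem_univ i)
    have h2 := le_abs_self (form10 q (θ i))
    simp only [K]
    omega
  have hK0 : 0 < K := by
    have : 0 ≤ ∑ i, |form10 q (θ i)| := Finset.sum_nonneg fun i _ => abs_nonneg _
    simp only [K]
    omega
  obtain ⟨⟨w, v⟩, ⟨hw, hv, hvΦ, hvJ⟩, hmin⟩ := exists_min_of_nonneg
    (fun p : (L10 ≃ₗ[ℤ] L10) × L10 => p.1 ∈ weyl (lat J) ∧ p.2 ∈ lat J ∧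
      (∀ x ∈ Φ, T ∣ form10 p.2 (p.1 x)) ∧ ∃ j ∈ J, ¬ T ∣ form10 p.2 j)
    (fun p => -form10 (K • p.2 - q) (K • p.2 - q)) ⟨(1, v₀), one_mem _, hv₀, hdiv, hndiv⟩
    (fun p hp => by
      have := hJ.nonpos_of_mem (sub_mem (Submodule.smul_mem _ K hp.2.1) hq)
      omega)
  simp only at hw hv hvΦ hvJ
  -- reflections in the walls of the alcove preserve the conditions on the pair
  have step : ∀ r, ∀ hr : form10 r r = -2, r ∈ lat J → ∀ k : ℤ,
      -form10 (K • v - q) (K • v - q) ≤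
        -form10 (K • (refl r hr v - (T * k) • r) - q) (K • (refl r hr v - (T * k) • r) - q) := by
    intro r hr hrJ k
    refine hmin (refl r hr * w, refl r hr v - (T * k) • r) ⟨mul_mem (refl_mem_weyl hr hrJ) hw,
      sub_mem (weyl_map_mem (refl_mem_weyl hr hrJ) hv) (Submodule.smul_mem _ _ hrJ),
      fun x hx => ?_, ?_⟩
    · change T ∣ form10 (refl r hr v - (T * k) • r) (refl r hr (w x))
      rw [map_sub, LinearMap.sub_apply, form10_refl, map_smul, LinearMap.smul_apply, smul_eq_mul,
        mul_assoc]
      exact dvd_sub (hvΦ x hx) (dvd_mul_right _ _)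
    · by_contra hn
      push Not at hn
      obtain ⟨j, hj, hjT⟩ := hvJ
      have h1 : ∀ y ∈ lat J, T ∣ form10 (refl r hr v) y := by
        intro y hy
        obtain ⟨a, rfl⟩ := exists_comb hy
        rw [form10_comb_right]
        refine Finset.dvd_sum fun i hi => Dvd.dvd.mul_left ?_ _
        have h2 := hn i hi
        simp only [map_sub, LinearMap.sub_apply, map_smul, LinearMap.smul_apply, smul_eq_mul,
          mul_assoc] at h2
        exact (dvd_sub_left (dvd_mul_right T _)).1 h2
      refine hjT ?_
      rw [← form10_refl r hr]
      exact h1 _ (weyl_map_mem (refl_mem_weyl hr hrJ) (mem_lat hj))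
  refine ⟨w, hw, v, hv, hvΦ, hvJ, fun j hj => ?_, fun i => ?_⟩
  · by_contra hneg
    push Not at hneg
    have h1 := step j (hJ.root j hj) (mem_lat hj) 0
    simp only [refl_apply, mul_zero, zero_smul, sub_zero, map_sub, map_add, map_smul,
      LinearMap.sub_apply, LinearMap.add_apply, LinearMap.smul_apply, smul_eq_mul, hJ.root j hj,
      form10_comm j, form10_comm v q, hqJ j hj] at h1
    have h2 : 0 < K * d := mul_pos hK0 hd
    nlinarith
  · by_contra hgt
    push Not at hgt
    have h1 := step (θ i) (hθ.root i) (hθ.comb_eq i ▸ comb_mem J _) 1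
    simp only [refl_apply, mul_one, map_sub, map_add, map_smul,
      LinearMap.sub_apply, LinearMap.add_apply, LinearMap.smul_apply, smul_eq_mul, hθ.root i,
      form10_comm (θ i), form10_comm v q] at h1
    have h2 := hK i
    have h3 : 0 < K * (form10 v (θ i) - T) := mul_pos hK0 (by omega)
    have h4 : form10 q (θ i) < K * T := by nlinarith
    nlinarith [mul_pos h3 (sub_pos.2 h4)]

/-- The step of Borel and de Siebenthal: a proper sublattice of full rank spanned by roots is
conjugate into the lattice obtained by replacing a simple root `j` of multiplicity at least `2` in a
highest root `θ i` by `-θ i`. -/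
theorem exists_borel_de_siebenthal {J Φ : Finset L10} (hJ : IsSimple J) (hΦ : IsSimple Φ)
    (hsub : ∀ x ∈ Φ, x ∈ lat J) (hfull : ∀ j ∈ J, ∃ k : ℤ, k ≠ 0 ∧ k • j ∈ lat Φ)
    (hne : ¬ lat J ≤ lat Φ) {ι : Type*} [Fintype ι] {θ : ι → L10} {m : ι → L10 → ℤ}
    (hθ : HighestRoots J θ m) :
    ∃ w ∈ weyl (lat J), ∃ i, ∃ j ∈ J, 2 ≤ m i j ∧
      ∀ x ∈ Φ, w x ∈ lat (insert (-θ i) (J.erase j)) := by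
  obtain ⟨T, hT, v₀, hv₀, hdiv, hndiv⟩ := exists_functional hΦ hfull hne
  have hΦJ : lat Φ ≤ lat J := Submodule.span_le.2 hsub
  obtain ⟨w, hw, v, hv, hvΦ, ⟨j₀, hj₀, hj₀T⟩, hv0, hvθ⟩ :=
    exists_alcove hJ hθ hT (hΦJ hv₀) hdiv hndiv
  let M : Submodule ℤ L10 := Submodule.span ℤ
    ({j | j ∈ J ∧ form10 v j = 0} ∪ {x | ∃ i, x = θ i ∧ form10 v (θ i) = T})
  have hMZ : ∀ j ∈ J, form10 v j = 0 → j ∈ M := fun j hj h0 =>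
    Submodule.subset_span (Or.inl ⟨hj, h0⟩)
  have hMθ : ∀ i, form10 v (θ i) = T → θ i ∈ M := fun i h =>
    Submodule.subset_span (Or.inr ⟨i, rfl, h⟩)
  -- a positive root on which `v` is divisible by `T` takes one of the extreme values `0`, `T`
  have hposM : ∀ r, form10 r r = -2 → InCone J r → T ∣ form10 v r → r ∈ M := by
    intro r hr hpos hTr
    obtain ⟨i, n, hn, hθr⟩ := hθ.exists_le hJ hr hpos
    obtain ⟨a, ha, rfl⟩ := hpos
    have h1 : 0 ≤ form10 v (comb J a) := by
      rw [form10_comb_right]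
      exact Finset.sum_nonneg fun j hj => mul_nonneg (ha j hj) (hv0 j hj)
    have h2 : 0 ≤ form10 v (comb J n) := by
      rw [form10_comb_right]
      exact Finset.sum_nonneg fun j hj => mul_nonneg (hn j hj) (hv0 j hj)
    have h3 : form10 v (θ i) = form10 v (comb J a) + form10 v (comb J n) := by rw [hθr, map_add]
    have h4 := hvθ i
    have hcombM : ∀ b : L10 → ℤ, (∀ j ∈ J, 0 ≤ b j) → form10 v (comb J b) = 0 →
        comb J b ∈ M := by
      intro b hb h0
      rw [form10_comb_right] at h0
      have h5 := (Finset.sum_eq_zero_iff_of_nonneg fun j hj => mul_nonneg (hb j hj) (hv0 j hj)).1 h0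
      refine Submodule.sum_mem _ fun j hj => ?_
      rcases mul_eq_zero.1 (h5 j hj) with h | h
      · rw [h, zero_smul]; exact zero_mem _
      · exact Submodule.smul_mem _ _ (hMZ j hj h)
    obtain ⟨c, hc⟩ := hTr
    rcases (by
      have : c = 0 ∨ c = 1 := by
        have h6 : 0 ≤ c := by by_contra hc'; nlinarith
        have h7 : c ≤ 1 := by by_contra hc'; nlinarith
        omega
      rcases this with rfl | rfl
      · left; omega
      · right; omega : form10 v (comb J a) = 0 ∨ form10 v (comb J a) = T) with h | h
    · exact hcombM a ha h
    · have h5 : comb J n ∈ M := hcombM n hn (by omega)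
      have h6 := sub_mem (hMθ i (by omega)) h5
      rwa [hθr, add_sub_cancel_right] at h6
  have hM : ∀ x ∈ Φ, w x ∈ M := by
    intro x hx
    have hr : form10 (w x) (w x) = -2 := by rw [weyl_form hw, hΦ.root x hx]
    obtain ⟨a, ha | ha, hax⟩ := hJ.sign hr (weyl_map_mem hw (hsub x hx))
    · exact hposM _ hr ⟨a, ha, hax⟩ (hvΦ x hx)
    · have := hposM (-w x) (by simpa using hr)
        ⟨fun j => -a j, fun j hj => neg_nonneg.2 (ha j hj), by rw [comb_neg, hax]⟩
        (by rw [map_neg]; exact (dvd_neg).2 (hvΦ x hx))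
      simpa using neg_mem this
  -- `M` has full rank, so that only zero kills it
  have hkill : ∀ u, (∀ j ∈ J, form10 v j = 0 → form10 u j = 0) →
      (∀ i, form10 v (θ i) = T → form10 u (θ i) = 0) → ∀ j ∈ J, form10 u j = 0 := by
    intro u h1 h2 j hj
    have h3 : ∀ x ∈ M, form10 u x = 0 := by
      intro x hx
      induction hx using Submodule.span_induction with
      | mem x h =>
        rcases h with ⟨hj, h⟩ | ⟨i, rfl, h⟩
        · exact h1 x hj h
        · exact h2 i h
      | zero => exact map_zero _
      | add x y _ _ ihx ihy => rw [map_add, ihx, ihy, add_zero]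
      | smul c x _ ih => rw [map_smul, ih, smul_zero]
    obtain ⟨k, hk, hkj⟩ := exists_smul_mem_of_full hfull
      (weyl_map_mem (inv_mem hw) (mem_lat hj))
    obtain ⟨b, hb⟩ := exists_comb hkj
    have h4 : k • j = ∑ x ∈ Φ, b x • w x := by
      have h5 : w (k • w⁻¹ j) = k • j := by
        rw [map_smul]; exact congrArg _ (w.apply_symm_apply j)
      rw [← h5, ← hb, comb, map_sum]
      exact Finset.sum_congr rfl fun x _ => map_smul w _ _
    have h6 : form10 u (k • j) = 0 := by
      rw [h4]
      exact h3 _ (Submodule.sum_mem _ fun x hx => Submodule.smul_mem _ _ (hM x hx))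
    rw [map_smul, smul_eq_mul] at h6
    exact (mul_eq_zero.1 h6).resolve_left hk
  obtain ⟨i, hi⟩ := hθ.cover j₀ hj₀
  obtain ⟨d, hd, vd, hvd⟩ := hJ.exists_dual
  have hother : ∀ k, k ≠ i → ∀ j ∈ J, 0 < m i j → m k j = 0 := by
    intro k hki j hj hij
    by_contra h0
    exact hki (hθ.disjoint k i j hj (lt_of_le_of_ne (hθ.nonneg k j hj) (Ne.symm h0)) hij)
  have hvj₀ : form10 v j₀ ≠ 0 := fun h0 => hj₀T (by rw [h0]; exact dvd_zero T)
  have hθT : form10 v (θ i) = T := by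
    by_contra hne'
    let u : L10 := ∑ j ∈ J, (if 0 < m i j then form10 v j else 0) • vd j
    have hu : ∀ j ∈ J, form10 u j = (if 0 < m i j then form10 v j else 0) * d := by
      intro j hj
      simp only [u, map_sum, LinearMap.sum_apply, map_smul, LinearMap.smul_apply, smul_eq_mul]
      rw [Finset.sum_congr rfl fun k hk => by rw [(hvd k hk).2 j hj]]
      simp [hj]
    have h1 := hkill u (fun j hj h0 => by rw [hu j hj, h0]; simp) (fun k hk => by
      have hki : k ≠ i := by rintro rfl; exact hne' hk
      rw [← hθ.comb_eq, form10_comb_right]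
      refine Finset.sum_eq_zero fun j hj => ?_
      by_cases hij : 0 < m i j
      · rw [hother k hki j hj hij, zero_mul]
      · rw [hu j hj, if_neg hij, zero_mul, mul_zero]) j₀ hj₀
    rw [hu j₀ hj₀, if_pos hi] at h1
    rcases mul_eq_zero.1 h1 with h | h
    · exact hvj₀ h
    · omega
  have honly : ∀ j ∈ J, 0 < m i j → j ≠ j₀ → form10 v j = 0 := by
    intro j₁ hj₁ hij₁ hne₁
    by_contra hv1
    let u : L10 := m i j₁ • vd j₀ - m i j₀ • vd j₁
    have hu : ∀ j ∈ J, form10 u j =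
        m i j₁ * (if j = j₀ then d else 0) - m i j₀ * (if j = j₁ then d else 0) := by
      intro j hj
      simp only [u, map_sub, LinearMap.sub_apply, map_smul, LinearMap.smul_apply, smul_eq_mul]
      rw [(hvd j₀ hj₀).2 j hj, (hvd j₁ hj₁).2 j hj]
    have hsum : ∀ k, form10 u (θ k) = m i j₁ * (m k j₀ * d) - m i j₀ * (m k j₁ * d) := by
      intro k
      rw [← hθ.comb_eq, form10_comb_right, Finset.sum_congr rfl fun j hj => by rw [hu j hj]]
      simp only [mul_sub, Finset.sum_sub_distrib, mul_ite, mul_zero, Finset.sum_ite_eq', hj₀, hj₁,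
        if_true]
      ring
    have h1 := hkill u (fun j hj h0 => by
        rw [hu j hj, if_neg, if_neg, mul_zero, mul_zero, sub_zero]
        · rintro rfl; exact hv1 h0
        · rintro rfl; exact hvj₀ h0) (fun k hk => by
      rw [hsum]
      by_cases hki : k = i
      · subst hki; ring
      · rw [hother k hki j₀ hj₀ hi, hother k hki j₁ hj₁ hij₁]; ring) j₀ hj₀
    rw [hu j₀ hj₀, if_pos rfl, if_neg (Ne.symm hne₁), mul_zero, sub_zero] at h1
    rcases mul_eq_zero.1 h1 with h | h <;> omega
  refine ⟨w, hw, i, j₀, hj₀, ?_, fun x hx => ?_⟩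
  · by_contra hlt
    have h1 : m i j₀ = 1 := by omega
    rw [← hθ.comb_eq, form10_comb_right, Finset.sum_eq_single j₀, h1, one_mul] at hθT
    · exact hj₀T (by rw [hθT])
    · intro j hj hne₁
      by_cases hij : 0 < m i j
      · rw [honly j hj hij hne₁, mul_zero]
      · rw [le_antisymm (not_lt.1 hij) (hθ.nonneg i j hj), zero_mul]
    · exact fun h => absurd hj₀ h
  · refine (Submodule.span_le.2 ?_ : M ≤ _) (hM x hx)
    rintro y (⟨hy, h0⟩ | ⟨k, rfl, -⟩)
    · exact mem_lat (Finset.mem_insert_of_mem (Finset.mem_erase.2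
        ⟨by rintro rfl; exact hvj₀ h0, hy⟩))
    · by_cases hki : k = i
      · subst hki
        have := neg_mem (mem_lat (Finset.mem_insert_self (-θ k) (J.erase j₀)))
        simpa using this
      · suffices h : comb J (m k) ∈ lat (insert (-θ i) (J.erase j₀)) from hθ.comb_eq k ▸ h
        rw [comb]
        refine Submodule.sum_mem _ fun j hj => ?_
        by_cases hjj : j = j₀
        · subst hjj
          rw [hother k hki j hj hi, zero_smul]
          exact zero_mem _
        · exact Submodule.smul_mem _ _
            (mem_lat (Finset.mem_insert_of_mem (Finset.mem_erase.2 ⟨hjj, hj⟩)))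

/-! ### Configurations with a standard Gram matrix -/

section Gram

variable {M : Type*} [AddCommGroup M] [Module ℤ M] {B : BilinForm ℤ M}
  {K : Type*} [DecidableEq K] {X : K → Label} {v : (k : K) × Fin (X k).rank → M}

theorem injective_of_gram (hv : ∀ p q, B (v p) (v q) = sigmaGram X p q) :
    Function.Injective v := by
  intro p q h
  by_contra hne
  have h1 := hv p q
  rw [← h, hv, sigmaGram_diag] at h1
  rcases sigmaGram_off_diag X hne with h2 | h2 <;> omega

theorem nonempty_iso_of_gram [Fintype K] [DecidableEq M]
    (hv : ∀ p q, B (v p) (v q) = sigmaGram X p q) :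
    Nonempty (configDiagram B (Finset.univ.image v) ≃g sigmaDiagram X) := by
  let f : (k : K) × Fin (X k).rank → (Finset.univ.image v : Finset M) := fun p =>
    ⟨v p, Finset.mem_image_of_mem v (Finset.mem_univ p)⟩
  have hf : Function.Bijective f := by
    constructor
    · intro p q h
      exact injective_of_gram hv (Subtype.ext_iff.1 h)
    · rintro ⟨x, hx⟩
      obtain ⟨p, -, rfl⟩ := Finset.mem_image.1 hx
      exact ⟨p, rfl⟩
  refine ⟨(⟨Equiv.ofBijective f hf, ?_⟩ : sigmaDiagram X ≃g _).symm⟩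
  intro p q
  refine (dynkinDiagram_adj _ (f p) (f q)).trans (Iff.trans ?_ (sigmaDiagram_adj X p q).symm)
  change f p ≠ f q ∧ (B (v p) (v q) = 1 ∨ B (v q) (v p) = 1) ↔ _
  rw [hv, hv, sigmaGram_symm X q p, or_self]
  refine ⟨fun h => h.2, fun h => ⟨?_, h⟩⟩
  intro hpq
  rw [hf.1 hpq, sigmaGram_diag] at h
  omega

theorem isADEConfiguration_of_gram [Fintype K] [DecidableEq M]
    (hv : ∀ p q, B (v p) (v q) = sigmaGram X p q) :
    IsADEConfiguration B (Finset.univ.image v) where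
  isRoot := by
    intro x hx
    obtain ⟨p, -, rfl⟩ := Finset.mem_image.1 hx
    rw [IsRoot, hv, sigmaGram_diag]
  pairing := by
    intro x hx y hy hxy
    obtain ⟨p, -, rfl⟩ := Finset.mem_image.1 hx
    obtain ⟨q, -, rfl⟩ := Finset.mem_image.1 hy
    rw [hv]
    exact sigmaGram_off_diag X fun h => hxy (by rw [h])
  components := components_of_iso_sigmaDiagram (nonempty_iso_of_gram hv).some

theorem configType_of_gram [Fintype K] [DecidableEq M]
    (hv : ∀ p q, B (v p) (v q) = sigmaGram X p q) :
    configType B (Finset.univ.image v) = Finset.univ.val.map X :=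
  graphType_of_iso_sigmaDiagram (nonempty_iso_of_gram hv).some

end Gram

/-- The Gram matrix of an ADE-configuration is the standard one of its type. -/
theorem IsADEConfiguration.exists_gram {M : Type*} [AddCommGroup M] [Module ℤ M]
    [DecidableEq M] {B : BilinForm ℤ M} (hs : ∀ x y, B x y = B y x) {Φ : Finset M}
    (hΦ : IsADEConfiguration B Φ) :
    ∃ v : (c : (configType B Φ).ToType) × Fin c.1.rank → M, Finset.univ.image v = Φ ∧
      ∀ p q, B (v p) (v q) = sigmaGram (fun c : (configType B Φ).ToType => c.1) p q := by
  let X : (configType B Φ).ToType → Label := fun c => c.1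
  obtain ⟨e⟩ : Nonempty (configDiagram B Φ ≃g sigmaDiagram X) :=
    nonempty_iso_typeDiagram hΦ.components
  refine ⟨fun p => (e.symm p).1, ?_, fun p q => ?_⟩
  · ext x
    simp only [Finset.mem_image, Finset.mem_univ, true_and]
    constructor
    · rintro ⟨p, rfl⟩
      exact (e.symm p).2
    · intro hx
      exact ⟨e ⟨x, hx⟩, by rw [e.symm_apply_apply]⟩
  · change B (e.symm p).1 (e.symm q).1 = sigmaGram X p q
    by_cases hpq : p = q
    · subst hpq
      rw [hΦ.isRoot _ (e.symm p).2, sigmaGram_diag]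
    · have hne : (e.symm p).1 ≠ (e.symm q).1 := fun h => hpq (e.symm.injective (Subtype.ext h))
      have h1 : B (e.symm p).1 (e.symm q).1 = 1 ↔ sigmaGram X p q = 1 := by
        rw [← sigmaDiagram_adj, ← e.symm.map_adj_iff]
        refine Iff.trans ?_ (dynkinDiagram_adj _ _ _).symm
        rw [hs (e.symm q).1, or_self]
        exact ⟨fun h => ⟨fun h' => hne (congrArg _ h'), h⟩, fun h => h.2⟩
      rcases hΦ.pairing _ (e.symm p).2 _ (e.symm q).2 hne with h | h <;>
        rcases sigmaGram_off_diag X hpq with h' | h' <;> omega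

section Simple

variable {K : Type*} [DecidableEq K] [Fintype K] {X : K → Label}
  {v : (k : K) × Fin (X k).rank → L10}

theorem comb_image {ι : Type*} [Fintype ι] {v : ι → L10} (hv : Function.Injective v)
    (a : L10 → ℤ) : comb (Finset.univ.image v) a = ∑ p, a (v p) • v p := by
  rw [comb, Finset.sum_image fun p _ q _ h => hv h]

theorem isSimple_of_gram (hv : ∀ p q, form10 (v p) (v q) = sigmaGram X p q) :
    IsSimple (Finset.univ.image v) where
  root := (isADEConfiguration_of_gram hv).isRoot
  pairing := by
    intro x hx y hy hxy
    rcases (isADEConfiguration_of_gram hv).pairing x hx y hy hxy with h | h <;> omega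
  negDef := by
    intro a ⟨x, hx, hax⟩
    obtain ⟨p, -, rfl⟩ := Finset.mem_image.1 hx
    have h1 := negDef_sigmaGram X (fun p => a (v p)) fun h => hax (congrFun h p)
    rw [comb_image (injective_of_gram hv)]
    simp only [map_sum, LinearMap.sum_apply, map_smul, LinearMap.smul_apply, smul_eq_mul, hv]
    convert h1 using 1
    rw [Finset.sum_comm]
    exact Finset.sum_congr rfl fun p _ => by
      rw [Finset.mul_sum]
      exact Finset.sum_congr rfl fun q _ => by rw [sigmaGram_symm X q p]; ring

theorem IsADEConfiguration.isSimple {Φ : Finset L10} (hΦ : IsADEConfiguration form10 Φ) :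
    IsSimple Φ := by
  obtain ⟨v, hvΦ, hv⟩ := hΦ.exists_gram form10_comm
  have h := isSimple_of_gram (X := fun c : (configType form10 Φ).ToType => c.1) (v := v) hv
  rwa [← hvΦ]

end Simple

/-! ### Highest roots -/

/-- The coefficients of the highest root in the simple roots. -/
def Label.mark : (X : Label) → Fin X.rank → ℤ
  | .A _ _ => fun _ => 1
  | .D m _ => fun p => if p.val = 0 ∨ m ≤ p.val + 2 then 1 else 2
  | .E6 => ![1, 2, 2, 3, 2, 1]
  | .E7 => ![2, 2, 3, 4, 3, 2, 1]
  | .E8 => ![2, 3, 4, 6, 5, 4, 3, 2]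

/-- The combination of the simple roots with the coefficients `Label.mark` is a dominant root. -/
structure Label.MarkDominant (X : Label) : Prop where
  pos : ∀ p, 0 < X.mark p
  nonneg : ∀ q, 0 ≤ ∑ p, X.mark p * X.cartan p q
  norm : ∑ q, X.mark q * ∑ p, X.mark p * X.cartan p q = 2

section Highest

variable {K : Type*} {X : K → Label} {v : (k : K) × Fin (X k).rank → L10}

/-- The highest root of the block `k` of a configuration. -/
def highestRoot (v : (k : K) × Fin (X k).rank → L10) (k : K) : L10 :=
  ∑ p, (X k).mark p • v ⟨k, p⟩

/-- The coefficients of the highest root of the block `k`, as a function on the configuration. -/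
def highestCoeff (v : (k : K) × Fin (X k).rank → L10) (k : K) (x : L10) : ℤ :=
  ∑ p, if v ⟨k, p⟩ = x then (X k).mark p else 0

theorem highestCoeff_same (hv : Function.Injective v) (k : K) (p : Fin (X k).rank) :
    highestCoeff v k (v ⟨k, p⟩) = (X k).mark p := by
  rw [highestCoeff, Finset.sum_eq_single p]
  · simp
  · intro q _ hq
    rw [if_neg]
    intro h
    exact hq (eq_of_heq (Sigma.mk.inj (hv h)).2)
  · exact fun h => absurd (Finset.mem_univ p) h

theorem highestCoeff_ne (hv : Function.Injective v) {k l : K} (hkl : k ≠ l)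
    (p : Fin (X l).rank) : highestCoeff v k (v ⟨l, p⟩) = 0 := by
  refine Finset.sum_eq_zero fun q _ => if_neg fun h => hkl ?_
  exact congrArg Sigma.fst (hv h)

variable [DecidableEq K]

theorem form10_highestRoot (hv : ∀ p q, form10 (v p) (v q) = sigmaGram X p q) (k : K)
    (q : Fin (X k).rank) :
    form10 (highestRoot v k) (v ⟨k, q⟩) = -∑ p, (X k).mark p * (X k).cartan p q := by
  simp only [highestRoot, map_sum, LinearMap.sum_apply, map_smul, LinearMap.smul_apply,
    smul_eq_mul, hv, sigmaGram_same, mul_neg, Finset.sum_neg_distrib]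

theorem highestRoots_of_gram [Fintype K] (hv : ∀ p q, form10 (v p) (v q) = sigmaGram X p q)
    (hX : ∀ k, (X k).MarkDominant) :
    HighestRoots (Finset.univ.image v) (highestRoot v) (highestCoeff v) where
  root := by
    intro k
    have h : form10 (highestRoot v k) (highestRoot v k) =
        ∑ q, (X k).mark q * form10 (highestRoot v k) (v ⟨k, q⟩) := by
      generalize form10 (highestRoot v k) = f
      rw [highestRoot, map_sum]
      exact Finset.sum_congr rfl fun q _ => by rw [map_smul, smul_eq_mul]
    rw [h, Finset.sum_congr rfl fun q _ => by rw [form10_highestRoot hv, mul_neg],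
      Finset.sum_neg_distrib, (hX k).norm]
  comb_eq := by
    intro k
    rw [comb_image (injective_of_gram hv), Fintype.sum_sigma, Finset.sum_eq_single k]
    · exact Finset.sum_congr rfl fun p _ => by rw [highestCoeff_same (injective_of_gram hv)]
    · intro l _ hl
      exact Finset.sum_eq_zero fun p _ => by
        rw [highestCoeff_ne (injective_of_gram hv) hl.symm, zero_smul]
    · exact fun h => absurd (Finset.mem_univ k) h
  nonneg := by
    intro k x _
    refine Finset.sum_nonneg fun p _ => ?_
    split_ifs
    · exact ((hX k).pos p).le
    · exact le_rfl
  nonpos := by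
    intro k x hx
    obtain ⟨⟨l, q⟩, -, rfl⟩ := Finset.mem_image.1 hx
    by_cases hkl : k = l
    · subst hkl
      rw [form10_highestRoot hv]
      have := (hX k).nonneg q
      omega
    · refine le_of_eq ?_
      simp only [highestRoot, map_sum, LinearMap.sum_apply, map_smul, LinearMap.smul_apply,
        smul_eq_mul, hv, sigmaGram_ne X hkl, mul_zero, Finset.sum_const_zero]
  cover := by
    intro x hx
    obtain ⟨⟨k, p⟩, -, rfl⟩ := Finset.mem_image.1 hx
    exact ⟨k, by rw [highestCoeff_same (injective_of_gram hv)]; exact (hX k).pos p⟩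
  disjoint := by
    intro k l x hx hk hl
    obtain ⟨⟨i, p⟩, -, rfl⟩ := Finset.mem_image.1 hx
    have h : ∀ j, 0 < highestCoeff v j (v ⟨i, p⟩) → j = i := by
      intro j hj
      by_contra hne
      rw [highestCoeff_ne (injective_of_gram hv) hne] at hj
      exact lt_irrefl _ hj
    rw [h k hk, h l hl]

end Highest

/-! ### Computing with coordinate vectors -/

/-- A vector of `L₁₀` stored as a tuple of coordinates, a form in which the kernel evaluates the
bilinear form and products of reflections. -/
structure Coord where
  (a0 a1 a2 a3 a4 a5 a6 a7 a8 a9 : ℤ)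
  deriving DecidableEq

namespace Coord

/-- The vector with the given coordinates. -/
def toVec (v : Coord) : L10 := ![v.a0, v.a1, v.a2, v.a3, v.a4, v.a5, v.a6, v.a7, v.a8, v.a9]

/-- The pairing of two vectors in terms of coordinates. -/
def dot (v w : Coord) : ℤ :=
  -2 * (v.a0 * w.a0 + v.a1 * w.a1 + v.a2 * w.a2 + v.a3 * w.a3 + v.a4 * w.a4 + v.a5 * w.a5 +
    v.a6 * w.a6 + v.a7 * w.a7 + v.a8 * w.a8 + v.a9 * w.a9) + (v.a0 * w.a3 + v.a3 * w.a0) +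
    (v.a1 * w.a2 + v.a2 * w.a1) + (v.a2 * w.a3 + v.a3 * w.a2) + (v.a3 * w.a4 + v.a4 * w.a3) +
    (v.a4 * w.a5 + v.a5 * w.a4) + (v.a5 * w.a6 + v.a6 * w.a5) + (v.a6 * w.a7 + v.a7 * w.a6) +
    (v.a7 * w.a8 + v.a8 * w.a7) + (v.a8 * w.a9 + v.a9 * w.a8)

/-- The vector `v + c • r`. -/
def addMul (c : ℤ) (r v : Coord) : Coord :=
  ⟨v.a0 + c * r.a0, v.a1 + c * r.a1, v.a2 + c * r.a2, v.a3 + c * r.a3, v.a4 + c * r.a4,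
    v.a5 + c * r.a5, v.a6 + c * r.a6, v.a7 + c * r.a7, v.a8 + c * r.a8, v.a9 + c * r.a9⟩

/-- The image of `v` under the successive reflections in the roots of `w`. -/
def reflect (w : List Coord) (v : Coord) : Coord :=
  w.foldl (fun v r => addMul (dot r v) r v) v

/-- The vector whose coordinates are, up to a common sign, the decimal digits of `n`, the last digit
being the coordinate at the first basis vector. -/
def ofDigits (n : ℤ) : Coord :=
  let d (i : ℕ) : ℤ := n.sign * ((n.natAbs / 10 ^ i % 10 : ℕ) : ℤ)
  ⟨d 0, d 1, d 2, d 3, d 4, d 5, d 6, d 7, d 8, d 9⟩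

/-- The basis vector of index `i`. -/
def unit (i : ℕ) : Coord := ofDigits (10 ^ i : ℕ)

theorem form10_toVec (v w : Coord) : form10 v.toVec w.toVec = dot v w := form10_expand _ _

theorem toVec_addMul (c : ℤ) (r v : Coord) : (addMul c r v).toVec = v.toVec + c • r.toVec := by
  ext i
  rw [Pi.add_apply, Pi.smul_apply, smul_eq_mul]
  fin_cases i <;> rfl

theorem toVec_unit (i : Fin 10) : (unit i).toVec = basisVec i := by
  revert i
  decide +kernel

theorem toVec_ofDigits_zero : (ofDigits 0).toVec = 0 := by
  decide +kernel

/-- A word in roots of a submodule acts as an element of its Weyl group. -/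
theorem exists_weyl_reflect {S : Submodule ℤ L10} {w : List Coord}
    (h : ∀ r ∈ w, dot r r = -2 ∧ r.toVec ∈ S) :
    ∃ g ∈ weyl S, ∀ v, g v.toVec = (reflect w v).toVec := by
  induction w with
  | nil => exact ⟨1, one_mem _, fun v => rfl⟩
  | cons r w ih =>
    obtain ⟨g, hg, hgv⟩ := ih fun s hs => h s (List.mem_cons_of_mem _ hs)
    obtain ⟨hr, hrS⟩ := h r List.mem_cons_self
    rw [← form10_toVec] at hr
    refine ⟨g * refl r.toVec hr, mul_mem hg (refl_mem_weyl hr hrS), fun v => ?_⟩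
    change g (refl r.toVec hr v.toVec) = (reflect w (addMul (dot r v) r v)).toVec
    rw [← hgv, toVec_addMul, refl_apply, form10_toVec]

end Coord

open Coord

/-! ### Subsets of the basis -/

/-- The set of indices given by the binary digits of `m`. -/
def nodes (m : ℕ) : Finset (Fin 10) := Finset.univ.filter fun i => m.testBit i

theorem mem_nodes {m : ℕ} {i : Fin 10} : i ∈ nodes m ↔ m.testBit i = true := by
  simp [nodes]

theorem exists_nodes_eq (I : Finset (Fin 10)) : ∃ m < 1024, nodes m = I := by
  have key : ∀ b0 b1 b2 b3 b4 b5 b6 b7 b8 b9 : Bool, ∃ m < 1024,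
      m = b0.toNat + 2 * b1.toNat + 4 * b2.toNat + 8 * b3.toNat + 16 * b4.toNat + 32 * b5.toNat +
        64 * b6.toNat + 128 * b7.toNat + 256 * b8.toNat + 512 * b9.toNat ∧
      ∀ i : Fin 10, m.testBit i = (![b0, b1, b2, b3, b4, b5, b6, b7, b8, b9] : Fin 10 → Bool) i := by
    intro b0 b1 b2 b3 b4 b5 b6 b7 b8 b9
    refine ⟨_, ?_, rfl, ?_⟩
    · have h := fun b : Bool => b.toNat_le
      have := h b0; have := h b1; have := h b2; have := h b3; have := h b4
      have := h b5; have := h b6; have := h b7; have := h b8; have := h b9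
      omega
    · revert b0 b1 b2 b3 b4 b5 b6 b7 b8 b9
      decide +kernel
  obtain ⟨m, hm, -, h⟩ := key (decide (0 ∈ I)) (decide (1 ∈ I)) (decide (2 ∈ I)) (decide (3 ∈ I))
    (decide (4 ∈ I)) (decide (5 ∈ I)) (decide (6 ∈ I)) (decide (7 ∈ I)) (decide (8 ∈ I))
    (decide (9 ∈ I))
  refine ⟨m, hm, ?_⟩
  ext i
  rw [mem_nodes, h i]
  fin_cases i <;> simp

/-- An element of the Weyl group carrying one subset of the basis to another: if the part in `scope`
of a subset is `source`, it may be replaced by `target`. Subsets are encoded by binary digits. -/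
structure Move where
  (scope source target : ℕ)
  /-- The roots of the successive reflections. -/
  word : List ℤ

namespace Move

/-- The correctness of a move: the reflections fix the basis vectors outside `scope` and carry
those of `source` to those of `target`. -/
def Valid (m : Move) : Prop :=
  (m.target &&& m.scope) = m.target ∧
  (∀ r ∈ m.word.map ofDigits, dot r r = -2 ∧
    ∀ i : Fin 10, m.scope.testBit i = false → dot r (unit i) = 0) ∧
  (∀ i : Fin 10, m.source.testBit i = true → ∃ j : Fin 10, m.target.testBit j = true ∧
    reflect (m.word.map ofDigits) (unit i) = unit j) ∧
  ∀ j : Fin 10, m.target.testBit j = true → ∃ i : Fin 10, m.source.testBit i = true ∧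
    reflect (m.word.map ofDigits) (unit i) = unit j

instance (m : Move) : Decidable m.Valid := by unfold Valid; infer_instance

theorem exists_image {m : Move} (hm : m.Valid) {I : ℕ} (hI : (I &&& m.scope) = m.source) :
    ∃ g ∈ OPlus, (basisSet (nodes I)).image g =
      basisSet (nodes ((I ^^^ m.source) ||| m.target)) := by
  obtain ⟨h1, h2, h3, h4⟩ := hm
  let S : Submodule ℤ L10 := Submodule.span ℤ {x | ∃ r ∈ m.word.map ofDigits, r.toVec = x}
  obtain ⟨g, hg, hgv⟩ := exists_weyl_reflect (S := S) (w := m.word.map ofDigits) fun r hr =>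
    ⟨(h2 r hr).1, Submodule.subset_span ⟨r, hr, rfl⟩⟩
  have hout : ∀ i : Fin 10, m.scope.testBit i = false → g (basisVec i) = basisVec i := by
    intro i hi
    refine weyl_apply_of_orthogonal hg fun s hs => ?_
    induction hs using Submodule.span_induction with
    | mem x h =>
      obtain ⟨r, hr, rfl⟩ := h
      rw [← toVec_unit, form10_toVec]
      exact (h2 r hr).2 i hi
    | zero => simp
    | add x y _ _ hx hy => rw [map_add, LinearMap.add_apply, hx, hy, add_zero]
    | smul c x _ hx => rw [map_smul, LinearMap.smul_apply, hx, smul_zero]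
  have hb1 : ∀ i : ℕ, m.target.testBit i = true → m.scope.testBit i = true := by
    intro i hi
    rw [← h1, Nat.testBit_and] at hi
    simp at hi
    exact hi.2
  have hb2 : ∀ i : ℕ, m.source.testBit i = (I.testBit i && m.scope.testBit i) := by
    intro i
    rw [← hI, Nat.testBit_and]
  have hb3 : ∀ i : ℕ, ((I ^^^ m.source) ||| m.target).testBit i =
      ((I.testBit i ^^ m.source.testBit i) || m.target.testBit i) := by
    intro i
    rw [Nat.testBit_or, Nat.testBit_xor]
  refine ⟨g, weyl_le_OPlus _ hg, ?_⟩
  ext x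
  simp only [basisSet, Finset.mem_image, mem_nodes, hb3]
  constructor
  · rintro ⟨_, ⟨i, hi, rfl⟩, rfl⟩
    cases hs : m.scope.testBit i with
    | false => exact ⟨i, by rw [hb2, hi, hs]; simp, (hout i hs).symm⟩
    | true =>
      obtain ⟨j, hj, hij⟩ := h3 i (by rw [hb2, hi, hs]; rfl)
      exact ⟨j, by simp [hj], by rw [← toVec_unit, ← toVec_unit, hgv, hij]⟩
  · rintro ⟨j, hj, rfl⟩
    cases ht : m.target.testBit j with
    | false =>
      have hs : m.scope.testBit j = false ∧ I.testBit j = true := by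
        rw [hb2, ht] at hj
        revert hj
        cases I.testBit j <;> cases m.scope.testBit j <;> simp
      exact ⟨_, ⟨j, hs.2, rfl⟩, hout j hs.1⟩
    | true =>
      obtain ⟨i, hi, hij⟩ := h4 j ht
      refine ⟨_, ⟨i, ?_, rfl⟩, by rw [← toVec_unit, ← toVec_unit, hgv, hij]⟩
      rw [hb2] at hi
      simp at hi
      exact hi.1

/-- Whether repeated application, at most `n` times, of the first applicable move of `l` leads from
`I` to one of the subsets in `l'`. -/
def reaches (l : List Move) (l' : List ℕ) : ℕ → ℕ → Bool
  | 0, I => l'.any (Nat.beq I)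
  | n + 1, I =>
    match l.find? fun m => Nat.beq (Nat.land I m.scope) m.source with
    | some m => reaches l l' n (Nat.lor (Nat.xor I m.source) m.target)
    | none => l'.any (Nat.beq I)

theorem exists_of_reaches {l : List Move} (hl : ∀ m ∈ l, m.Valid) {l' : List ℕ} (n I : ℕ)
    (h : reaches l l' n I = true) :
    ∃ I' ∈ l', ∃ g ∈ OPlus, (basisSet (nodes I)).image g = basisSet (nodes I') := by
  have done : ∀ I, l'.any (Nat.beq I) = true →
      ∃ I' ∈ l', ∃ g ∈ OPlus, (basisSet (nodes I)).image g = basisSet (nodes I') := by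
    intro I h
    obtain ⟨I', hI', he⟩ := List.any_eq_true.1 h
    obtain rfl := Nat.eq_of_beq_eq_true he
    exact ⟨I, hI', 1, one_mem _, Finset.image_id⟩
  induction n generalizing I with
  | zero => exact done I h
  | succ n ih =>
    rw [reaches] at h
    split at h
    · rename_i m hm
      obtain ⟨I', hI', g, hg, hgI⟩ := ih _ h
      have hmI : Nat.beq (Nat.land I m.scope) m.source = true :=
        List.find?_some (p := fun m : Move => Nat.beq (Nat.land I m.scope) m.source) hm
      obtain ⟨f, hf, hfI⟩ := exists_image (hl m (List.mem_of_find?_eq_some hm))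
        (Nat.eq_of_beq_eq_true hmI)
      refine ⟨I', hI', g * f, mul_mem hg hf, ?_⟩
      have hfI' : (basisSet (nodes I)).image f =
          basisSet (nodes (Nat.lor (Nat.xor I m.source) m.target)) := hfI
      rw [← hgI, ← hfI', Finset.image_image]
      rfl
    · exact done I h

end Move

/-! ### Simple systems given by coordinates -/

/-- An irreducible simple system: its type and its roots, in the standard order and encoded by
decimal digits. -/
structure Block where
  label : Label
  roots : List ℤ

namespace Block

/-- A block of type `A`. -/
def A (l : List ℤ) : Block := ⟨.A (l.length - 1 + 1) (Nat.le_add_left _ _), l⟩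

/-- A block of type `D`. -/
def D (l : List ℤ) : Block := ⟨.D (l.length - 4 + 4) (Nat.le_add_left _ _), l⟩

/-- A block of type `E`. -/
def E (l : List ℤ) : Block :=
  ⟨match l.length with
    | 6 => .E6
    | 7 => .E7
    | _ => .E8, l⟩

/-- The chain of basis vectors with the given indices. -/
def path (l : List ℕ) : Block := A (l.map fun i => ((10 ^ i : ℕ) : ℤ))

/-- The root at position `p`, and zero beyond the last one. -/
def root (b : Block) (p : ℕ) : Coord := ofDigits (b.roots.getD p 0)

/-- The roots of the block. -/
def coords (b : Block) : List Coord := b.roots.map ofDigits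

/-- The opposite of the highest root. -/
def lowestRoot (b : Block) : Coord :=
  (List.finRange b.label.rank).foldr (fun p => addMul (-b.label.mark p) (b.root p)) (ofDigits 0)

/-- The Gram matrix is the standard one, and `Label.mark` describes the highest root. -/
def IsStandard (b : Block) : Prop :=
  b.roots.length = b.label.rank ∧
    (∀ p q : Fin b.label.rank, dot (b.root p) (b.root q) = -b.label.cartan p q) ∧
    (∀ p, 0 < b.label.mark p) ∧
    (∀ q, 0 ≤ ∑ p, b.label.mark p * b.label.cartan p q) ∧
    ∑ q, b.label.mark q * ∑ p, b.label.mark p * b.label.cartan p q = 2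

instance (b : Block) : Decidable b.IsStandard := by unfold IsStandard; infer_instance

theorem mem_coords {b : Block} (hb : b.IsStandard) {v : Coord} :
    v ∈ b.coords ↔ ∃ p : Fin b.label.rank, b.root p = v := by
  simp only [coords, List.mem_map]
  constructor
  · rintro ⟨n, hn, rfl⟩
    obtain ⟨i, hi, rfl⟩ := List.mem_iff_getElem.1 hn
    refine ⟨⟨i, lt_of_lt_of_eq hi hb.1⟩, ?_⟩
    rw [root, List.getD_eq_getElem _ _ hi]
  · rintro ⟨p, rfl⟩
    have hp : p.val < b.roots.length := lt_of_lt_of_eq p.2 hb.1.symm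
    exact ⟨_, List.getElem_mem hp, by rw [root, List.getD_eq_getElem _ _ hp]⟩

theorem toVec_lowestRoot (b : Block) :
    b.lowestRoot.toVec = -∑ p, b.label.mark p • (b.root p).toVec := by
  rw [Fin.sum_univ_def, lowestRoot]
  induction List.finRange b.label.rank with
  | nil => simp [toVec_ofDigits_zero]
  | cons p l ih =>
    rw [List.foldr_cons, toVec_addMul, ih, List.map_cons, List.sum_cons, neg_smul]
    abel

end Block

/-- A simple system given as a list of irreducible ones. -/
abbrev System := List Block

namespace System

/-- The roots of the system. -/
def coords (s : System) : List Coord := s.flatMap Block.coords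

/-- The set of roots of the system. -/
def support (s : System) : Finset L10 := (s.coords.map toVec).toFinset

/-- The blocks are standard and mutually orthogonal. -/
def IsStandard (s : System) : Prop :=
  (∀ b ∈ s, b.IsStandard) ∧
    s.Pairwise fun b c => ∀ u ∈ b.coords, ∀ v ∈ c.coords, dot u v = 0

instance (s : System) : Decidable s.IsStandard := by unfold IsStandard; infer_instance

/-- The types of the blocks. -/
def labels (s : System) (i : Fin s.length) : Label := (s.get i).label

/-- The roots of the system, indexed by block and position. -/
def vec (s : System) (p : (i : Fin s.length) × Fin (s.labels i).rank) : L10 :=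
  ((s.get p.1).root p.2).toVec

theorem mem_support {s : System} {x : L10} : x ∈ s.support ↔ ∃ v ∈ s.coords, v.toVec = x := by
  simp [support]

theorem mem_coords {s : System} (hs : s.IsStandard) {v : Coord} :
    v ∈ s.coords ↔ ∃ (i : Fin s.length) (p : Fin (s.labels i).rank), (s.get i).root p = v := by
  simp only [coords, List.mem_flatMap]
  constructor
  · rintro ⟨b, hb, hv⟩
    obtain ⟨i, rfl⟩ := List.mem_iff_get.1 hb
    obtain ⟨p, hp⟩ := (Block.mem_coords (hs.1 _ hb)).1 hv
    exact ⟨i, p, hp⟩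
  · rintro ⟨i, p, rfl⟩
    exact ⟨_, List.get_mem s i, (Block.mem_coords (hs.1 _ (List.get_mem s i))).2 ⟨p, rfl⟩⟩

theorem image_vec {s : System} (hs : s.IsStandard) : Finset.univ.image s.vec = s.support := by
  ext x
  simp only [Finset.mem_image, Finset.mem_univ, true_and, mem_support]
  constructor
  · rintro ⟨⟨i, p⟩, rfl⟩
    exact ⟨_, (mem_coords hs).2 ⟨i, p, rfl⟩, rfl⟩
  · rintro ⟨v, hv, rfl⟩
    obtain ⟨i, p, rfl⟩ := (mem_coords hs).1 hv
    exact ⟨⟨i, p⟩, rfl⟩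

theorem gram_vec {s : System} (hs : s.IsStandard) (p q) :
    form10 (s.vec p) (s.vec q) = sigmaGram s.labels p q := by
  obtain ⟨i, p⟩ := p
  obtain ⟨j, q⟩ := q
  rw [vec, vec, form10_toVec]
  by_cases hij : i = j
  · subst hij
    rw [sigmaGram_same]
    exact (hs.1 _ (List.get_mem s i)).2.1 p q
  · rw [sigmaGram_ne _ hij]
    have hp := (Block.mem_coords (hs.1 _ (List.get_mem s i))).2 ⟨p, rfl⟩
    have hq := (Block.mem_coords (hs.1 _ (List.get_mem s j))).2 ⟨q, rfl⟩
    rcases lt_or_gt_of_ne hij with h | h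
    · exact List.pairwise_iff_get.1 hs.2 i j h _ hp _ hq
    · have := List.pairwise_iff_get.1 hs.2 j i h _ hq _ hp
      rw [← form10_toVec, form10_comm, form10_toVec]
      exact this

theorem isADEConfiguration {s : System} (hs : s.IsStandard) :
    IsADEConfiguration form10 s.support :=
  image_vec hs ▸ isADEConfiguration_of_gram (gram_vec hs)

theorem configType_support {s : System} (hs : s.IsStandard) :
    configType form10 s.support = ((s.map Block.label : List Label) : ADEType) := by
  rw [← image_vec hs, configType_of_gram (gram_vec hs)]
  change Multiset.map _ (Multiset.ofList (List.finRange s.length)) = _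
  rw [Multiset.map_coe]
  congr 1
  have h : s.map Block.label = ((List.finRange s.length).map s.get).map Block.label := by
    rw [List.map_get_finRange]
  rw [h, List.map_map]
  rfl

theorem isSimple {s : System} (hs : s.IsStandard) : IsSimple s.support :=
  (isADEConfiguration hs).isSimple

theorem highestRoots {s : System} (hs : s.IsStandard) :
    HighestRoots s.support (highestRoot s.vec) (highestCoeff s.vec) := by
  rw [← image_vec hs]
  refine highestRoots_of_gram (gram_vec hs) fun i => ?_
  obtain ⟨-, -, h1, h2, h3⟩ := hs.1 _ (List.get_mem s i)
  exact ⟨h1, h2, h3⟩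

/-- The system with the root `p` of the block `b` replaced by the lowest root of the block. -/
def replaced (s : System) (b : Block) (p : ℕ) : List Coord :=
  b.lowestRoot :: s.coords.filter fun v => v ≠ b.root p

/-- The number of roots. -/
def rank (s : System) : ℕ := (s.map fun b => b.label.rank).sum

theorem card_support {s : System} (hs : s.IsStandard) : s.support.card = s.rank := by
  rw [← image_vec hs, Finset.card_image_of_injective _ (injective_of_gram (gram_vec hs)),
    Finset.card_univ, Fintype.card_sigma]
  have h : s.map (fun b => b.label.rank) =
      ((List.finRange s.length).map s.get).map fun b => b.label.rank := by
    rw [List.map_get_finRange]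
  rw [rank, h, List.map_map, Fin.sum_univ_def]
  congr 1
  exact List.map_congr_left fun i _ => Fintype.card_fin _

end System

/-- The coordinates outside the subset encoded by `m` vanish. -/
def Coord.SupportedIn (m : ℕ) (v : Coord) : Prop :=
  ∀ i : Fin 10, m.testBit i = false → v.toVec i = 0

instance (m : ℕ) (v : Coord) : Decidable (v.SupportedIn m) := by
  unfold Coord.SupportedIn; infer_instance

theorem Coord.SupportedIn.mem {m : ℕ} {v : Coord} (h : v.SupportedIn m) :
    v.toVec ∈ lat (basisSet (nodes m)) := by
  refine mem_lat_basisSet.2 fun i hi => mem_nodes.2 ?_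
  by_contra hn
  exact hi (h i (by simpa using hn))

/-- The step of Borel and de Siebenthal at a root of a system: the node `node` of the block `block`
is replaced by the lowest root of the block, and reflections in the roots of `word` carry the result
to the system of index `target`. -/
structure Transition where
  (block node target : ℕ)
  word : List ℤ

/-- Reflections in the roots of `w`, which lie in the lattice of the subset encoded by `m`, carry
`s`, with the root `p` of the block `b` replaced by the lowest root, to `s'`. -/
def IsTransition (m : ℕ) (s s' : System) (b : Block) (p : ℕ) (w : List Coord) : Prop :=
  (∀ r ∈ w, dot r r = -2 ∧ r.SupportedIn m) ∧
    (∀ v ∈ s.replaced b p, reflect w v ∈ s'.coords) ∧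
    ∀ u ∈ s'.coords, ∃ v ∈ s.replaced b p, reflect w v = u

instance (m : ℕ) (s s' : System) (b : Block) (p : ℕ) (w : List Coord) :
    Decidable (IsTransition m s s' b p w) := by unfold IsTransition; infer_instance

/-- A simple system together with the steps of Borel and de Siebenthal starting at it. -/
structure State where
  blocks : System
  transitions : List Transition

/-- A family of simple systems. Each is the union of one of the systems in `states`, which span
sublattices of full rank in the lattice of the first one, with the chains of basis vectors in one of
the lists of `rests`. -/
structure Family where
  states : List State
  rests : List (List (List ℕ))

namespace Family

variable (F : Family) (ρ : List (List ℕ))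

/-- The state of index `k`, and the empty one beyond the last. -/
def state (k : ℕ) : State := F.states.getD k ⟨[], []⟩

/-- The system of index `k`, completed by the chains of `ρ`. -/
def system (k : ℕ) : System := (F.state k).blocks ++ ρ.map Block.path

/-- The binary encoding of the first system, a subset of the basis. -/
def mask : ℕ :=
  ((F.system ρ 0).coords.map fun v =>
    (v.a0 + 2 * v.a1 + 4 * v.a2 + 8 * v.a3 + 16 * v.a4 + 32 * v.a5 + 64 * v.a6 + 128 * v.a7 +
      256 * v.a8 + 512 * v.a9).natAbs).sum

/-- The first system is a subset of the basis. -/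
def IsParabolic : Prop :=
  (∀ i : Fin 10, (F.mask ρ).testBit i = true → unit i ∈ (F.system ρ 0).coords) ∧
    ∀ v ∈ (F.system ρ 0).coords, ∃ i : Fin 10, (F.mask ρ).testBit i = true ∧ v = unit i

/-- The system of index `k` is standard, of full rank in the lattice of the first one, and each step
of Borel and de Siebenthal leads to a system of larger index. -/
def IsComplete (k : ℕ) : Prop :=
  (F.system ρ k).IsStandard ∧ (F.system ρ k).rank = (F.system ρ 0).rank ∧
    (∀ v ∈ (F.system ρ k).coords, v.SupportedIn (F.mask ρ)) ∧
    ∀ (i : Fin (F.system ρ k).length) (p : Fin ((F.system ρ k).labels i).rank),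
      2 ≤ ((F.system ρ k).labels i).mark p →
        ∃ t ∈ (F.state k).transitions, (t.block = i ∧ t.node = p) ∧
          (k < t.target ∧ t.target < F.states.length) ∧
          IsTransition (F.mask ρ) (F.system ρ k) (F.system ρ t.target) ((F.system ρ k).get i) p
            (t.word.map ofDigits)

instance : Decidable (F.IsParabolic ρ) := by unfold IsParabolic; infer_instance

instance (k : ℕ) : Decidable (F.IsComplete ρ k) := by unfold IsComplete; infer_instance

end Family

/-! ### The classification data -/

/-- The subsets of the basis that represent the orbits of parabolic subsets. -/
def parabolicMasks : List ℕ := [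
  0, 512, 5, 768, 517, 832, 896, 645, 773, 928, 864, 960, 677, 837, 901, 872, 976, 944, 992, 853,
  933, 869, 965, 945, 876, 1000, 984, 952, 1008, 855, 981, 949, 997, 1009, 875, 985, 986, 954, 950,
  1004, 1016, 983, 951, 1013, 1003, 879, 987, 1018, 1014, 1006, 990, 1020, 1015, 1007, 1019, 1022,
  29, 541, 669, 797, 861, 925, 989, 31, 543, 671, 799, 863, 927, 991, 125, 637, 893, 253, 765, 509,
  1021, 63, 575, 703, 831, 959, 127, 639, 895, 255, 767]

/-- Moves by which every subset of the basis spanning a negative-definite lattice is carried to one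
of the representatives. -/
def moves : List Move := [
  ⟨14, 2, 4, [10, 110]⟩, ⟨896, 256, 512, [1000000000, 100000000]⟩, ⟨480, 64, 128, [10000000,
  1000000]⟩, ⟨120, 16, 32, [100000, 10000]⟩, ⟨240, 32, 64, [100000, 1100000]⟩, ⟨61, 8, 16, [10000,
  1000]⟩, ⟨992, 704, 832, [10000000, 100000000, 11000000, 1110000000]⟩, ⟨31, 4, 8, [100, 1100]⟩,
  ⟨125, 24, 48, [100000, 10000, 1000]⟩, ⟨960, 384, 768, [10000000, 1000000000, 110000000]⟩, ⟨960,
  128, 256, [10000000, 110000000]⟩, ⟨496, 96, 192, [100000, 10000000, 1100000]⟩, ⟨248, 48, 96,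
  [100000, 10000, 1110000]⟩, ⟨61, 9, 24, [1000, 1, 11001]⟩, ⟨1008, 736, 928, [1100000000, 110000000,
  1100000, 11000000]⟩, ⟨63, 12, 24, [100, 10000, 1100]⟩, ⟨992, 448, 896, [10000000, 1000000,
  1000000000, 111000000]⟩, ⟨992, 192, 384, [10000000, 1000000, 111000000]⟩, ⟨504, 176, 208,
  [10000000, 11000000, 110000, 1100000]⟩, ⟨504, 112, 224, [10000000, 100000, 10000, 1110000]⟩, ⟨29,
  1, 8, [1000, 1]⟩, ⟨31, 6, 12, [10, 1000, 110]⟩, ⟨31, 7, 11, [10, 100, 1110, 1101]⟩, ⟨253, 56, 112,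
  [100000, 10000, 1000, 1111000]⟩, ⟨63, 14, 28, [10, 10000, 1000, 110]⟩, ⟨127, 28, 56, [100000, 100,
  10000, 1100]⟩, ⟨1016, 880, 944, [1000000000, 10000000, 1100000000, 111000000, 1110000, 11100000]⟩,
  ⟨253, 88, 104, [100000, 1000000, 110000, 11000]⟩, ⟨1016, 752, 976, [1000000000, 1100000000,
  110000000, 1100000, 11000000, 110000]⟩, ⟨31, 13, 14, [10, 1000, 1, 1101]⟩, ⟨127, 30, 60, [100000,
  100, 10000, 10, 1110]⟩, ⟨1008, 224, 448, [100000, 100000000, 10000000, 1100000]⟩, ⟨1008, 480, 960,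
  [1000000000, 100000000, 1000000, 100000, 11100000]⟩, ⟨509, 120, 240, [1000000, 100000, 10000,
  1000, 11111000]⟩, ⟨63, 15, 30, [1001, 11000, 1111, 11101]⟩, ⟨125, 25, 56, [100000, 1000, 1,
  11001]⟩, ⟨509, 184, 232, [1100000, 11000000, 110000, 11000]⟩, ⟨255, 60, 120, [1000000, 100000,
  100, 10000, 1100]⟩, ⟨1021, 888, 984, [1000000000, 100000000, 1110000000, 111000000, 1110000,
  11100000, 111000]⟩, ⟨125, 41, 49, [100000, 110000, 1001, 11000]⟩, ⟨1016, 240, 480, [100000000,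
  1000000, 100000, 10000, 11110000]⟩, ⟨255, 92, 116, [1100000, 110000, 1100, 11000]⟩, ⟨1016, 496,
  992, [1000000000, 100000000, 1000000, 100000, 10000, 11110000]⟩, ⟨127, 44, 52, [100000, 110000,
  1100, 11000]⟩, ⟨253, 57, 120, [1000000, 1, 100000, 10000, 1001]⟩, ⟨1021, 760, 1000, [1100000000,
  110000000, 1100000, 11000000, 110000, 11000]⟩, ⟨511, 188, 244, [1000000, 10000000, 1100000,
  110000, 1100, 11000]⟩, ⟨127, 61, 31, [1111, 111001, 111100, 122111]⟩, ⟨255, 94, 122, [1000000,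
  1100000, 110000, 110, 1100, 11110]⟩, ⟨511, 124, 248, [1000000, 100000, 100, 10000, 1100,
  11111100]⟩, ⟨255, 62, 124, [1000000, 100000, 100, 10000, 10, 1110]⟩, ⟨127, 46, 58, [110000, 110,
  1100, 11110]⟩, ⟨509, 121, 248, [1000000, 1, 100000, 10000, 1001, 11111001]⟩, ⟨1021, 504, 1008,
  [1000000000, 100000000, 1000000, 100000, 10000, 1000, 11111000]⟩, ⟨1021, 248, 496, [100000000,
  1000000, 100000, 10000, 1000, 11111000]⟩, ⟨63, 22, 26, [10, 100, 1110, 11100]⟩, ⟨253, 89, 113,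
  [1100000, 1001, 11000, 111001]⟩, ⟨1021, 953, 985, [1000000000, 1000000, 10000000, 1100000000,
  111100000, 1111000, 11110000, 111001]⟩, ⟨31, 9, 12, [100, 1000, 1]⟩, ⟨127, 47, 59, [1101, 11001,
  1110, 112101, 122211]⟩, ⟨509, 185, 241, [1000000, 10000000, 1100000, 1001, 11000, 111001]⟩, ⟨511,
  126, 252, [1000000, 100000, 100, 10000, 10, 1110, 11111110]⟩, ⟨1021, 249, 504, [100000000,
  1000000, 1, 100000, 10000, 1001, 11111001]⟩, ⟨255, 110, 118, [1000000, 10000, 1100000, 111000,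
  1110, 11100]⟩, ⟨1021, 889, 1001, [1110000000, 111000000, 1110000, 11100000, 11001, 111000]⟩,
  ⟨1021, 761, 1009, [1000000000, 1100000000, 110000000, 1100000, 11000000, 1001, 11000, 111001]⟩,
  ⟨1021, 505, 1016, [1000000000, 100000000, 1000000, 1, 100000, 10000, 1001, 11111001]⟩, ⟨511, 190,
  250, [1100000, 11000000, 110000, 110, 1100, 11110]⟩, ⟨1023, 640, 5, [10000000, 11000000,
  1000000000, 1100000000, 100000, 1000000, 10000000, 100000000, 100000, 110000, 10000000, 11000000,
  10000, 11000, 100000, 1000000, 100, 1000, 100000, 110000, 10, 100, 10000, 11000, 1000, 1001, 10,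
  110]⟩, ⟨1023, 672, 517, [100000, 110000, 10000000, 11000000, 10000, 11000, 100000, 1000000, 100,
  1000, 100000, 110000, 10, 100, 10000, 11000, 1000, 1001, 10, 110]⟩, ⟨1023, 848, 773, [10000,
  11000, 100000, 1000000, 100, 1000, 100000, 110000, 10, 100, 10000, 11000, 1000, 1001, 10, 110]⟩,
  ⟨1023, 680, 645, [100, 1000, 100000, 110000, 10, 100, 10000, 11000, 1000, 1001, 10, 110]⟩, ⟨1023,
  849, 852, [10000000, 1000000, 110000000, 1100000000, 10000000, 1000000, 11100000, 1110000, 100000,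
  10000, 111000, 11001, 100, 1000, 1, 100000, 110000, 1100, 11000, 10000000, 11000000, 110000,
  1100000, 10000000, 100000000, 11000000, 1110000000]⟩, ⟨1023, 852, 837, [10, 100, 10000, 11000,
  1000, 1001, 10, 110]⟩, ⟨1023, 936, 901, [100, 1000, 100000, 110000, 10, 100, 10000, 11000, 1000,
  1001, 10, 110]⟩, ⟨1023, 948, 945, [100000, 10000, 111000, 11100, 100, 1, 1100, 100000, 110000,
  1001, 11000]⟩, ⟨1023, 977, 980, [1000000000, 100000000, 1100000, 110000, 1110000000, 111000000,
  1000000, 100000, 11000000, 1001, 1110000, 11111000, 1001, 1100, 11101, 111001, 1000000, 10000000,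
  1100000, 110000, 1100, 11000, 1000000000, 1100000000, 110000000, 1100000, 11000000, 110000]⟩,
  ⟨1023, 980, 965, [10, 100, 10000, 11000, 1000, 1001, 10, 110]⟩, ⟨1023, 874, 869, [1000, 1001, 10,
  110]⟩, ⟨1023, 988, 985, [1000000000, 100000000, 1000000, 11000000, 1111100000, 111110000, 1111100,
  11111000, 1001, 110000, 1100, 11101, 1000000000, 1000000, 10000000, 1100000000, 111100000,
  1111000, 11110000, 111001]⟩, ⟨1023, 1012, 1009, [1000000000, 100000000, 1100000, 110000,
  1110000000, 111000000, 1111111000, 111111100, 11100000, 11100, 1111101, 112101, 11122101,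
  1000000000, 1100000000, 110000000, 1100000, 11000000, 1001, 11000, 111001]⟩, ⟨1023, 682, 677,
  [1000, 1001, 10, 110]⟩, ⟨1023, 938, 933, [1000, 1001, 10, 110]⟩, ⟨1023, 1002, 997, [1000, 1001,
  10, 110]⟩, ⟨1023, 892, 1004, [1110000000, 111000000, 1110000, 11100000, 111000, 11100]⟩, ⟨1023,
  508, 1016, [1000000000, 100000000, 1000000, 100000, 100, 10000, 1100, 11111100]⟩, ⟨1023, 956, 988,
  [1000000000, 1000000, 10000000, 1100000000, 111100000, 1111000, 11110000, 111100]⟩, ⟨1023, 1017,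
  1020, [1111000000, 111001, 111111101, 1122101, 11112101, 1111222101]⟩, ⟨1023, 254, 508,
  [100000000, 1000000, 100000, 100, 10000, 10, 1110, 11111110]⟩, ⟨1023, 764, 1012, [1000000000,
  1100000000, 110000000, 1100000, 11000000, 110000, 1100, 11000]⟩, ⟨1023, 252, 504, [100000000,
  1000000, 100000, 100, 10000, 1100, 11111100]⟩, ⟨1023, 510, 1020, [1000000000, 100000000, 1000000,
  100000, 100, 10000, 10, 1110, 11111110]⟩, ⟨1023, 894, 1014, [1000000000, 10000000, 1100000000,
  111000000, 1110000, 11100000, 111000, 1110, 11100]⟩, ⟨1023, 958, 1006, [1100000000, 110000000,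
  1111000000, 111100000, 1111000, 11110000, 111100, 11110]⟩, ⟨1023, 766, 1018, [1100000000,
  110000000, 1100000, 11000000, 110000, 110, 1100, 11110]⟩]

/-- The representatives of the orbits of simple systems. The first family consists of the parabolic
subsets without components of type `D` or `E`; each of the others belongs to one such component. -/
def families : List Family := [
  ⟨[
    ⟨[], []⟩],
    [[], [[9]], [[0], [2]], [[8, 9]], [[0], [2], [9]], [[6], [8, 9]], [[7, 8, 9]], [[0], [2], [7],
      [9]], [[0], [2], [8, 9]], [[5], [7, 8, 9]], [[5, 6], [8, 9]], [[6, 7, 8, 9]], [[0], [2], [5],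
      [7], [9]], [[0], [2], [6], [8, 9]], [[0], [2], [7, 8, 9]], [[3], [5, 6], [8, 9]], [[4], [6, 7,
      8, 9]], [[4, 5], [7, 8, 9]], [[5, 6, 7, 8, 9]], [[0], [2], [4], [6], [8, 9]], [[0], [2], [5],
      [7, 8, 9]], [[0], [2], [5, 6], [8, 9]], [[0], [2], [6, 7, 8, 9]], [[0], [4, 5], [7, 8, 9]],
      [[2, 3], [5, 6], [8, 9]], [[3], [5, 6, 7, 8, 9]], [[3, 4], [6, 7, 8, 9]], [[3, 4, 5], [7, 8,
      9]], [[4, 5, 6, 7, 8, 9]], [[0], [1, 2], [4], [6], [8, 9]], [[0], [2], [4], [6, 7, 8, 9]],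
      [[0], [2], [4, 5], [7, 8, 9]], [[0], [2], [5, 6, 7, 8, 9]], [[0], [4, 5, 6, 7, 8, 9]], [[0,
      3], [1], [5, 6], [8, 9]], [[0, 3, 4], [6, 7, 8, 9]], [[1], [3, 4], [6, 7, 8, 9]], [[1], [3, 4,
      5], [7, 8, 9]], [[1, 2], [4, 5], [7, 8, 9]], [[2, 3], [5, 6, 7, 8, 9]], [[3, 4, 5, 6, 7, 8,
      9]], [[0], [1, 2], [4], [6, 7, 8, 9]], [[0], [1, 2], [4, 5], [7, 8, 9]], [[0], [2], [4, 5, 6,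
      7, 8, 9]], [[0, 3], [1], [5, 6, 7, 8, 9]], [[0, 3, 2, 1], [5, 6], [8, 9]], [[0, 3, 4], [1],
      [6, 7, 8, 9]], [[1], [3, 4, 5, 6, 7, 8, 9]], [[1, 2], [4, 5, 6, 7, 8, 9]], [[1, 2, 3], [5, 6,
      7, 8, 9]], [[1, 2, 3, 4], [6, 7, 8, 9]], [[2, 3, 4, 5, 6, 7, 8, 9]], [[0], [1, 2], [4, 5, 6,
      7, 8, 9]], [[0, 3, 2, 1], [5, 6, 7, 8, 9]], [[0, 3, 4, 5, 6, 7, 8, 9], [1]], [[1, 2, 3, 4, 5,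
      6, 7, 8, 9]]]⟩,
  ⟨[
    ⟨[.D [1, 1000, 100, 10000]], [⟨0, 1, 1, []⟩]⟩,
    ⟨[.A [-12101], .A [10000], .A [100], .A [1]], []⟩],
    [[], [[9]], [[7], [9]], [[8, 9]], [[6], [8, 9]], [[7, 8, 9]], [[6, 7, 8, 9]]]⟩,
  ⟨[
    ⟨[.D [10, 100, 1000, 1, 10000]], [⟨0, 1, 1, []⟩, ⟨0, 2, 1, [1001, 11000, 1111, 11101]⟩]⟩,
    ⟨[.A [1, 1000, 10000], .A [-12211], .A [10]], []⟩],
    [[], [[9]], [[7], [9]], [[8, 9]], [[6], [8, 9]], [[7, 8, 9]], [[6, 7, 8, 9]]]⟩,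
  ⟨[
    ⟨[.D [1000000, 100000, 10000, 1000, 1, 100]], [⟨0, 1, 1, []⟩, ⟨0, 2, 2, []⟩, ⟨0, 3, 1, [1111100,
      12101, 111101]⟩]⟩,
    ⟨[.D [1, 1000, 100, 10000], .A [-1222101], .A [1000000]], [⟨0, 1, 3, []⟩]⟩,
    ⟨[.A [1000000, 100000, -1222101], .A [1, 1000, 100]], []⟩,
    ⟨[.A [-1222101], .A [-12101], .A [1000000], .A [10000], .A [100], .A [1]], []⟩],
    [[], [[9]], [[8, 9]]]⟩,
  ⟨[
    ⟨[.D [10000000, 1000000, 100000, 10000, 1000, 1, 100]], [⟨0, 1, 1, []⟩, ⟨0, 2, 2, []⟩, ⟨0, 3, 2,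
      [11100000, 11100, 1111101, 112101, 11122101]⟩, ⟨0, 4, 1, [11100000, 11001, 1111101, 112101,
      11122101]⟩]⟩,
    ⟨[.D [100000, 10000, 1000, 1, 100], .A [-12222101], .A [10000000]], [⟨0, 1, 3, []⟩, ⟨0, 2, 3,
      [1001, 1100, 11101, 111001]⟩]⟩,
    ⟨[.D [1, 1000, 100, 10000], .A [10000000, 1000000, -12222101]], [⟨0, 1, 3, [10000, 1111101,
      11111100, 112101]⟩]⟩,
    ⟨[.A [1, 1000, 100], .A [-12222101], .A [-122101], .A [10000000], .A [100000]], []⟩],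
    [[], [[9]]]⟩,
  ⟨[
    ⟨[.D [100000000, 10000000, 1000000, 100000, 10000, 1000, 1, 100]], [⟨0, 1, 1, []⟩, ⟨0, 2, 2,
      []⟩, ⟨0, 3, 3, []⟩, ⟨0, 4, 2, [111111100, 1112101, 11111101, 122101]⟩, ⟨0, 5, 1, [111111100,
      1112101, 11111101, 122101]⟩]⟩,
    ⟨[.D [1000000, 100000, 10000, 1000, 1, 100], .A [-122222101], .A [100000000]], [⟨0, 1, 4, []⟩,
      ⟨0, 2, 5, []⟩, ⟨0, 3, 4, [1111100, 12101, 111101]⟩]⟩,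
    ⟨[.D [100000, 10000, 1000, 1, 100], .A [100000000, 10000000, -122222101]], [⟨0, 1, 5,
      [100000000, 10000000, 111000000, 11100000]⟩, ⟨0, 2, 5, [100000, 10000, 111111100, 1112101,
      11111101]⟩]⟩,
    ⟨[.D [1000000, 10000000, 100000000, -122222101], .D [1, 1000, 100, 10000]], [⟨0, 1, 4,
      [1222101]⟩, ⟨1, 1, 4, [1100000, 110000, 12101, 111111100, 11111101]⟩]⟩,
    ⟨[.D [1, 1000, 100, 10000], .A [-122222101], .A [-1222101], .A [100000000], .A [1000000]], [⟨0,
      1, 6, []⟩]⟩,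
    ⟨[.A [1000000, 100000, -1222101], .A [1, 1000, 100], .A [-122222101], .A [100000000]], []⟩,
    ⟨[.A [-122222101], .A [-1222101], .A [-12101], .A [100000000], .A [1000000], .A [10000], .A
      [100], .A [1]], []⟩],
    [[]]⟩,
  ⟨[
    ⟨[.D [1000000000, 100000000, 10000000, 1000000, 100000, 10000, 1000, 1, 100]], [⟨0, 1, 1, []⟩,
      ⟨0, 2, 2, []⟩, ⟨0, 3, 3, []⟩, ⟨0, 4, 3, [1111000000, 111100, 111111101, 1122101, 11112101,
      1111222101]⟩, ⟨0, 5, 2, [1111000000, 111100, 111111101, 1122101, 11112101, 1111222101]⟩, ⟨0,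
      6, 1, [1111000000, 111001, 111111101, 1122101, 11112101, 1111222101]⟩]⟩,
    ⟨[.D [10000000, 1000000, 100000, 10000, 1000, 1, 100], .A [-1222222101], .A [1000000000]], [⟨0,
      1, 4, []⟩, ⟨0, 2, 5, []⟩, ⟨0, 3, 5, [11100000, 11100, 1111101, 112101, 11122101]⟩, ⟨0, 4, 4,
      [11100000, 11001, 1111101, 112101, 11122101]⟩]⟩,
    ⟨[.D [1000000, 100000, 10000, 1000, 1, 100], .A [1000000000, 100000000, -1222222101]], [⟨0, 1,
      5, [1000000000, 100000000, 1110000000, 111000000]⟩, ⟨0, 2, 6, []⟩, ⟨0, 3, 5, [1000000000,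
      100000000, 1110000000, 111000000, 12101, 1111111100, 111111101]⟩]⟩,
    ⟨[.D [100000, 10000, 1000, 1, 100], .D [10000000, 100000000, 1000000000, -1222222101]], [⟨0, 1,
      5, [1000000000, 1000000, 10000, 1100, 1110000000, 1111101, 111111100, 122101, 11112101]⟩, ⟨0,
      2, 5, [1000000, 10000000, 1100000, 110000, 12101, 1111111100, 111111101]⟩, ⟨1, 1, 4,
      [12222101]⟩]⟩,
    ⟨[.D [100000, 10000, 1000, 1, 100], .A [-1222222101], .A [-12222101], .A [1000000000], .A
      [10000000]], [⟨0, 1, 7, []⟩, ⟨0, 2, 7, [1001, 1100, 11101, 111001]⟩]⟩,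
    ⟨[.D [1, 1000, 100, 10000], .A [10000000, 1000000, -12222101], .A [-1222222101], .A
      [1000000000]], [⟨0, 1, 7, [10000, 1111101, 11111100, 112101]⟩]⟩,
    ⟨[.A [1000000000, 100000000, -1222222101], .A [1000000, 100000, -1222101], .A [1, 1000, 100]],
      []⟩,
    ⟨[.A [1, 1000, 100], .A [-1222222101], .A [-12222101], .A [-122101], .A [1000000000], .A
      [10000000], .A [100000]], []⟩],
    [[]]⟩,
  ⟨[
    ⟨[.E [10, 1, 100, 1000, 10000, 100000]], [⟨0, 1, 1, []⟩, ⟨0, 2, 1, [1111, 111001, 111100,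
      122111]⟩, ⟨0, 3, 2, []⟩, ⟨0, 4, 1, [1111, 111001, 11110, 112211]⟩]⟩,
    ⟨[.A [10, 100, 1000, 10000, 100000], .A [-123212]], []⟩,
    ⟨[.A [10000, 100000], .A [10, 100], .A [1, -123212]], []⟩],
    [[], [[9]], [[7], [9]], [[8, 9]], [[7, 8, 9]]]⟩,
  ⟨[
    ⟨[.E [10, 1, 100, 1000, 10000, 100000, 1000000]], [⟨0, 0, 1, []⟩, ⟨0, 1, 2, []⟩, ⟨0, 2, 3, []⟩,
      ⟨0, 3, 4, []⟩, ⟨0, 4, 3, [1112211, 1122111, 1222101]⟩, ⟨0, 5, 1, [1112211, 1122111,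
      1222101]⟩]⟩,
    ⟨[.D [1000000, 100000, 10000, 1000, 1, 100], .A [-1234322]], [⟨0, 1, 5, []⟩, ⟨0, 2, 4, [1110000,
      1111, 1112101, 1233212]⟩, ⟨0, 3, 5, [1111100, 12101, 111101]⟩]⟩,
    ⟨[.A [1000000, 100000, 10000, 1000, 100, 10, -1234322]], []⟩,
    ⟨[.A [1, 1000, 10000, 100000, 1000000], .A [10, -1234322]], []⟩,
    ⟨[.A [10000, 100000, 1000000], .A [100, 10, -1234322], .A [1]], []⟩,
    ⟨[.D [1, 1000, 100, 10000], .A [-1234322], .A [-1222101], .A [1000000]], [⟨0, 1, 6, []⟩]⟩,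
    ⟨[.A [-1234322], .A [-1222101], .A [-12101], .A [1000000], .A [10000], .A [100], .A [1]], []⟩],
    [[], [[9]], [[8, 9]]]⟩,
  ⟨[
    ⟨[.E [10, 1, 100, 1000, 10000, 100000, 1000000, 10000000]], [⟨0, 0, 1, []⟩, ⟨0, 1, 3, []⟩, ⟨0,
      2, 5, []⟩, ⟨0, 3, 10, []⟩, ⟨0, 4, 9, []⟩, ⟨0, 5, 6, []⟩, ⟨0, 6, 4, []⟩, ⟨0, 7, 2, []⟩]⟩,
    ⟨[.D [-23456423, 10000000, 1000000, 100000, 10000, 1000, 1, 100]], [⟨0, 1, 7, []⟩, ⟨0, 2, 6,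
      [112211, 122111, 12222101, 12234322]⟩, ⟨0, 3, 8, []⟩, ⟨0, 4, 6, [1111000, 11110000, 111100,
      11110, 12333211, 12356423]⟩, ⟨0, 5, 7, [1112101, 11111101, 122101, 12345422]⟩]⟩,
    ⟨[.E [10, 1, 100, 1000, 10000, 100000, 1000000], .A [-23456423]], [⟨0, 0, 7, [1234322]⟩, ⟨0, 1,
      5, [11111001, 1111110, 11111100, 12111, 111111]⟩, ⟨0, 2, 10, [100, 10, 11233212, 12223212,
      1234322]⟩, ⟨0, 3, 11, [100, 11111000, 1111110, 12111, 111111, 12222101]⟩, ⟨0, 4, 10, [110000,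
      11111101, 112111, 1222101, 122211, 12233212]⟩, ⟨0, 5, 7, [1000000, 1112211, 1122111,
      1222101]⟩]⟩,
    ⟨[.A [10, 100, 1000, 10000, 100000, 1000000, 10000000, -23456423]], []⟩,
    ⟨[.E [10, 1, 100, 1000, 10000, 100000], .A [10000000, -23456423]], [⟨0, 1, 10, [1, 1122211,
      11122111, 123212, 12334322]⟩, ⟨0, 2, 10, [11101, 11110, 112211, 12222211, 1234322, 11234312]⟩,
      ⟨0, 3, 13, []⟩, ⟨0, 4, 10, [11110000, 11101, 111100, 1112211, 11234312, 12344322]⟩]⟩,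
    ⟨[.A [1, 1000, 10000, 100000, 1000000, 10000000, -23456423], .A [10]], []⟩,
    ⟨[.D [10, 100, 1000, 1, 10000], .A [1000000, 10000000, -23456423]], [⟨0, 1, 11, []⟩, ⟨0, 2, 11,
      [1001, 11000, 1111, 11101]⟩]⟩,
    ⟨[.D [1000000, 100000, 10000, 1000, 1, 100], .A [-23456423], .A [1234322]], [⟨0, 1, 12, []⟩, ⟨0,
      2, 11, [11100000, 11112211, 11122111, 1234322]⟩, ⟨0, 3, 12, [1111100, 12101, 111101]⟩]⟩,
    ⟨[.D [1, 1000, 100, 10000], .D [1234322, 10000000, 1000000, -23456423]], [⟨0, 1, 12, [10, 12111,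
      1234212, 11233212, 12233211]⟩, ⟨1, 1, 12, [1222101]⟩]⟩,
    ⟨[.A [100000, 1000000, 10000000, -23456423], .A [1, 1000, 100, 10]], []⟩,
    ⟨[.A [10000, 100000, 1000000, 10000000, -23456423], .A [10, 100], .A [1]], []⟩,
    ⟨[.A [1000000, 10000000, -23456423], .A [1, 1000, 10000], .A [-12211], .A [10]], []⟩,
    ⟨[.D [1, 1000, 100, 10000], .A [-23456423], .A [-1222101], .A [1000000], .A [1234322]], [⟨0, 1,
      14, []⟩]⟩,
    ⟨[.A [10000000, -23456423], .A [10000, 100000], .A [10, 100], .A [1, -123212]], []⟩,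
    ⟨[.A [-23456423], .A [-1222101], .A [-12101], .A [1000000], .A [10000], .A [100], .A [1], .A
      [1234322]], []⟩],
    [[], [[9]]]⟩]

/-- The representatives of the orbits of simple systems, each with the simple system of the
primitive closure of its lattice. -/
def representatives : List (System × System) :=
  families.flatMap fun F => F.rests.flatMap fun ρ =>
    (List.range F.states.length).map fun k => (F.system ρ k, F.system ρ 0)

/-- A numerical code for labels of rank at most `9`: distinct powers of `16`. -/
def Label.code : Label → ℕ
  | .A l _ => 16 ^ (l - 1)
  | .D m _ => 16 ^ (m + 5)
  | .E6 => 16 ^ 15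
  | .E7 => 16 ^ 16
  | .E8 => 16 ^ 17

/-- A numerical invariant of the type of a system. -/
def System.code (s : System) : ℕ := (s.map fun b => b.label.code).sum

theorem moves_valid : ∀ m ∈ moves, m.Valid := by decide +kernel

/-- Only the affine diagram of nine vertices and the full diagram are not of finite type. -/
theorem reaches_parabolicMasks : ((List.range 1024).all fun I =>
    Nat.beq I 511 || Nat.beq I 1023 || Move.reaches moves parabolicMasks 20 I) = true := by
  decide +kernel

theorem parabolicMasks_eq : parabolicMasks = families.flatMap fun F => F.rests.map F.mask := by
  decide +kernel

theorem families_isParabolic : ∀ F ∈ families, ∀ ρ ∈ F.rests, F.IsParabolic ρ := by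
  decide +kernel

/-- The families are closed under the steps of Borel and de Siebenthal. -/
theorem families_isComplete :
    ∀ F ∈ families, ∀ ρ ∈ F.rests, ∀ k < F.states.length, F.IsComplete ρ k := by
  decide +kernel

/-- The representatives differ in the type of the system or in that of its primitive closure. -/
theorem nodup_code :
    (representatives.map fun r => (r.1.code, r.2.code)).Nodup := by
  decide +kernel

theorem rank_representative_lt : ∀ r ∈ representatives, r.1.rank < 10 := by
  decide +kernel

theorem length_nonempty_representatives :
    (representatives.filter fun r => !r.1.isEmpty).length = 184 := by
  decide +kernel

/-! ### The classification of simple systems -/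

/-- A simple system inside the lattice of another one of the same cardinality is of full rank. -/
theorem IsSimple.full_of_card {J K : Finset L10} (hJ : IsSimple J) (hK : IsSimple K)
    (hsub : ∀ x ∈ J, x ∈ lat K) (hcard : J.card = K.card) {x : L10} (hx : x ∈ lat K) :
    ∃ k : ℤ, k ≠ 0 ∧ k • x ∈ lat J := by
  obtain ⟨d, hd, p, hp, hort⟩ := hJ.exists_projection x
  have hJK : lat J ≤ lat K := Submodule.span_le.2 hsub
  refine ⟨d, hd.ne', ?_⟩
  suffices h : d • x - p = 0 by rw [sub_eq_zero.1 h]; exact hp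
  -- otherwise `J` and this vector would be linearly independent in a lattice of smaller rank
  by_contra hz
  set z := d • x - p with hzdef
  have hzK : z ∈ lat K := sub_mem (Submodule.smul_mem _ _ hx) (hJK hp)
  clear_value z
  have hzz := hK.neg_of_mem hzK hz
  let u : Option J → lat K := fun o => o.elim ⟨z, hzK⟩ fun j => ⟨j, hsub j j.2⟩
  have hind : LinearIndependent ℤ u := by
    rw [Fintype.linearIndependent_iff]
    intro g hg
    have h1 : g none • z + ∑ j : J, g (some j) • (j : L10) = 0 := by
      have h2 := congrArg (Submodule.subtype _) hg
      rw [map_sum, Fintype.sum_option] at h2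
      simpa only [map_smul, map_zero, u, Option.elim, Submodule.subtype_apply] using h2
    have h3 : g none = 0 := by
      have h4 := congrArg (form10 z) h1
      rw [map_add, map_smul, map_sum, map_zero, Finset.sum_eq_zero fun j _ => by
        rw [map_smul, hort j j.2, smul_zero], add_zero, smul_eq_mul] at h4
      exact (mul_eq_zero.1 h4).resolve_right hzz.ne
    have h5 : ∀ j (hj : j ∈ J), g (some ⟨j, hj⟩) = 0 := by
      have h6 : comb J (fun j => if hj : j ∈ J then g (some ⟨j, hj⟩) else 0) = 0 := by
        rw [h3, zero_smul, zero_add] at h1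
        rw [comb, ← Finset.sum_coe_sort, ← h1]
        exact Finset.sum_congr rfl fun j _ => by rw [dif_pos j.2]
      intro j hj
      have := hJ.coeff_eq_zero h6 j hj
      rwa [dif_pos hj] at this
    intro o
    cases o with
    | none => exact h3
    | some j => exact h5 j j.2
  have h1 := hind.fintype_card_le_finrank
  have h2 := finrank_span_finset_le_card (R := ℤ) K
  rw [Fintype.card_option, Fintype.card_coe] at h1
  change Module.finrank ℤ (lat K) ≤ _ at h2
  omega

namespace System

theorem exists_replaced {s : System} {i : Fin s.length}
    {p : Fin (s.labels i).rank} {x : L10}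
    (hx : x ∈ insert (-highestRoot s.vec i) (s.support.erase (s.vec ⟨i, p⟩))) :
    ∃ v ∈ s.replaced (s.get i) p, v.toVec = x := by
  rcases Finset.mem_insert.1 hx with rfl | hx
  · exact ⟨_, List.mem_cons_self, Block.toVec_lowestRoot _⟩
  · obtain ⟨hne, hx⟩ := Finset.mem_erase.1 hx
    obtain ⟨v, hv, rfl⟩ := mem_support.1 hx
    refine ⟨v, List.mem_cons_of_mem _ (List.mem_filter.2 ⟨hv, ?_⟩), rfl⟩
    simpa using fun h : v = (s.get i).root p => hne (by rw [h]; rfl)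

theorem replaced_mem {s : System} (hs : s.IsStandard) {i : Fin s.length} {p : ℕ} {v : Coord}
    (hv : v ∈ s.replaced (s.get i) p) : v.toVec ∈ lat s.support := by
  rcases List.mem_cons.1 hv with rfl | hv
  · rw [Block.toVec_lowestRoot]
    refine neg_mem (Submodule.sum_mem _ fun q _ => Submodule.smul_mem _ _ (mem_lat ?_))
    exact mem_support.2 ⟨_, (mem_coords hs).2 ⟨i, q, rfl⟩, rfl⟩
  · exact mem_lat (mem_support.2 ⟨v, (List.mem_filter.1 hv).1, rfl⟩)

end System

namespace Family

variable {F : Family} {ρ : List (List ℕ)}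

theorem basisSet_mask (h : F.IsParabolic ρ) :
    basisSet (nodes (F.mask ρ)) = (F.system ρ 0).support := by
  ext x
  simp only [basisSet, Finset.mem_image, mem_nodes, System.mem_support]
  constructor
  · rintro ⟨i, hi, rfl⟩
    exact ⟨_, h.1 i hi, toVec_unit i⟩
  · rintro ⟨v, hv, rfl⟩
    obtain ⟨i, hi, rfl⟩ := h.2 v hv
    exact ⟨i, hi, (toVec_unit i).symm⟩

/-- A simple system of full rank in the lattice of a member of the family is conjugate to a member
of the family, by iteration of the step of Borel and de Siebenthal. -/
theorem exists_image_eq (hF : ∀ k < F.states.length, F.IsComplete ρ k) {k : ℕ}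
    (hk : k < F.states.length)
    {Φ : Finset L10} (hΦ : IsSimple Φ) (hsub : ∀ x ∈ Φ, x ∈ lat (F.system ρ k).support)
    (hfull : ∀ j ∈ (F.system ρ k).support, ∃ n : ℤ, n ≠ 0 ∧ n • j ∈ lat Φ) :
    ∃ g ∈ OPlus, ∃ l < F.states.length, Φ.image g = (F.system ρ l).support := by
  induction hn : F.states.length - k using Nat.strong_induction_on generalizing k Φ with
  | _ n ih =>
    subst hn
    obtain ⟨hs, -, hmask, hstep⟩ := hF k hk
    have hJ := System.isSimple hs
    by_cases hne : lat (F.system ρ k).support ≤ lat Φ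
    · obtain ⟨w, hw, hwΦ⟩ := exists_weyl_image_eq hJ hΦ (le_antisymm (Submodule.span_le.2 hsub) hne)
      exact ⟨w, weyl_le_OPlus _ hw, k, hk, hwΦ⟩
    · obtain ⟨w, hw, i, j, hj, hm, hmem⟩ :=
        exists_borel_de_siebenthal hJ hΦ hsub hfull hne (System.highestRoots hs)
      obtain ⟨⟨i', p⟩, -, rfl⟩ := Finset.mem_image.1 ((System.image_vec hs).symm ▸ hj)
      have hinj := injective_of_gram (System.gram_vec hs)
      obtain rfl : i = i' := by
        by_contra hii
        rw [highestCoeff_ne hinj hii] at hm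
        omega
      rw [highestCoeff_same hinj] at hm
      obtain ⟨t, -, -, ⟨hkt, ht⟩, hword, hinto, honto⟩ := hstep i p hm
      obtain ⟨g, hg, hgv⟩ := exists_weyl_reflect fun r hr =>
        ⟨(hword r hr).1, (hword r hr).2.mem⟩
      have hgw : g * w ∈ OPlus := mul_mem (weyl_le_OPlus _ hg) (weyl_le_OPlus _ hw)
      have hsub' : ∀ y ∈ Φ.image (g * w), y ∈ lat (F.system ρ t.target).support := by
        intro y hy
        obtain ⟨x, hx, rfl⟩ := Finset.mem_image.1 hy
        change g (w x) ∈ lat (F.system ρ t.target).support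
        have h1 : lat (insert (-highestRoot (F.system ρ k).vec i)
            ((F.system ρ k).support.erase ((F.system ρ k).vec ⟨i, p⟩))) ≤
              (lat (F.system ρ t.target).support).comap (g : L10 →ₗ[ℤ] L10) := by
          refine Submodule.span_le.2 fun z hz => ?_
          obtain ⟨v, hv, rfl⟩ := System.exists_replaced hz
          change g v.toVec ∈ lat (F.system ρ t.target).support
          rw [hgv]
          exact mem_lat (System.mem_support.2 ⟨_, hinto v hv, rfl⟩)
        exact h1 (hmem x hx)
      have hfull' : ∀ y ∈ (F.system ρ t.target).support,
          ∃ n : ℤ, n ≠ 0 ∧ n • y ∈ lat (Φ.image (g * w)) := by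
        intro y hy
        obtain ⟨u, hu, rfl⟩ := System.mem_support.1 hy
        obtain ⟨v, hv, rfl⟩ := honto u hu
        obtain ⟨n, hn, hnv⟩ := exists_smul_mem_of_full hfull
          (weyl_map_mem (inv_mem hw) (System.replaced_mem hs hv))
        refine ⟨n, hn, ?_⟩
        have h1 : lat Φ ≤ (lat (Φ.image (g * w))).comap ((g * w : L10 ≃ₗ[ℤ] L10) : L10 →ₗ[ℤ] L10) :=
          Submodule.span_le.2 fun z hz => mem_lat (Finset.mem_image_of_mem _ hz)
        have h2 := h1 hnv
        change g (w (n • w⁻¹ v.toVec)) ∈ lat (Φ.image (g * w)) at h2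
        rwa [map_smul, map_smul, show w (w⁻¹ v.toVec) = v.toVec from w.apply_symm_apply _, hgv] at h2
      obtain ⟨f, hf, l, hl, hfl⟩ := ih (F.states.length - t.target) (by omega) ht
        (hΦ.image (OPlus_form hgw)) hsub' hfull' rfl
      refine ⟨f * (g * w), mul_mem hf hgw, l, hl, ?_⟩
      rw [← hfl, Finset.image_image]
      rfl

end Family

/-- The affine diagram `E₉` is not of finite type. -/
theorem not_isSimple_of_subset {m : ℕ} (h : ∀ i : Fin 10, i ≠ 9 → m.testBit i = true) :
    ¬ IsSimple (basisSet (nodes m)) := by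
  intro hs
  -- the isotropic vector of the affine diagram on the first nine basis vectors
  let δ : L10 := ![3, 2, 4, 6, 5, 4, 3, 2, 1, 0]
  have h1 : δ ∈ lat (basisSet (nodes m)) := by
    refine mem_lat_basisSet.2 fun i hi => mem_nodes.2 (h i ?_)
    rintro rfl
    exact hi rfl
  have h2 := hs.neg_of_mem h1 fun h0 => absurd (congrFun h0 0) (by decide)
  have h3 : form10 δ δ = 0 := by rw [form10_expand]; decide
  omega

/-- Every simple system is conjugate to one of the representatives. -/
theorem exists_representative {Φ : Finset L10} (hΦ : IsSimple Φ) :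
    ∃ r ∈ representatives, ∃ g ∈ OPlus, Φ.image g = r.1.support := by
  obtain ⟨g, hg, I, hI, hsub, hfull⟩ := exists_parabolic hΦ
  obtain ⟨m, hm, rfl⟩ := exists_nodes_eq I
  have h1 := List.all_eq_true.1 reaches_parabolicMasks m (List.mem_range.2 hm)
  simp only [Bool.or_eq_true] at h1
  rcases h1 with (h1 | h1) | h1
  · obtain rfl := Nat.eq_of_beq_eq_true h1
    exact absurd hI (not_isSimple_of_subset (by decide))
  · obtain rfl := Nat.eq_of_beq_eq_true h1
    exact absurd hI (not_isSimple_of_subset (by decide))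
  · obtain ⟨m', hm', f, hf, hfm⟩ := Move.exists_of_reaches moves_valid _ _ h1
    rw [parabolicMasks_eq] at hm'
    obtain ⟨F, hF, hm'⟩ := List.mem_flatMap.1 hm'
    obtain ⟨ρ, hρ, rfl⟩ := List.mem_map.1 hm'
    have hP := families_isParabolic F hF ρ hρ
    have hC := families_isComplete F hF ρ hρ
    rw [Family.basisSet_mask hP] at hfm
    have hlen : 0 < F.states.length :=
      (by decide : ∀ F ∈ families, 0 < F.states.length) F hF
    have hfg : f * g ∈ OPlus := mul_mem hf hg
    obtain ⟨w, hw, l, hl, hwl⟩ := Family.exists_image_eq hC hlen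
      (hΦ.image (OPlus_form hfg)) (by
        intro y hy
        obtain ⟨x, hx, rfl⟩ := Finset.mem_image.1 hy
        have h2 : lat (basisSet (nodes m)) ≤ (lat (F.system ρ 0).support).comap
            (f : L10 →ₗ[ℤ] L10) := by
          rw [← hfm]
          exact Submodule.span_le.2 fun z hz => mem_lat (Finset.mem_image_of_mem _ hz)
        exact h2 (hsub x hx)) (by
        intro y hy
        rw [← hfm] at hy
        obtain ⟨x, hx, rfl⟩ := Finset.mem_image.1 hy
        obtain ⟨i, hi, rfl⟩ := Finset.mem_image.1 hx
        obtain ⟨n, hn, hni⟩ := hfull i hi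
        refine ⟨n, hn, ?_⟩
        have h2 : lat (Φ.image g) ≤ (lat (Φ.image (f * g))).comap (f : L10 →ₗ[ℤ] L10) := by
          refine Submodule.span_le.2 fun z hz => ?_
          obtain ⟨x, hx, rfl⟩ := Finset.mem_image.1 hz
          exact mem_lat (Finset.mem_image.2 ⟨x, hx, rfl⟩)
        have h3 := h2 hni
        change f (n • basisVec i) ∈ lat (Φ.image (f * g)) at h3
        rwa [map_smul] at h3)
    refine ⟨(F.system ρ l, F.system ρ 0), ?_, w * (f * g), mul_mem hw hfg, ?_⟩
    · exact List.mem_flatMap.2 ⟨F, hF, List.mem_flatMap.2 ⟨ρ, hρ,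
        List.mem_map.2 ⟨l, List.mem_range.2 hl, rfl⟩⟩⟩
    · rw [← hwl, Finset.image_image]
      rfl

/-- A representative is of full rank in a lattice spanned by a subset of the basis. -/
theorem representative_spec {r : System × System} (hr : r ∈ representatives) :
    r.1.IsStandard ∧ r.2.IsStandard ∧ (∃ I, r.2.support = basisSet I) ∧
      (∀ x ∈ r.1.support, x ∈ lat r.2.support) ∧
      ∀ x ∈ lat r.2.support, ∃ n : ℤ, n ≠ 0 ∧ n • x ∈ lat r.1.support := by
  obtain ⟨F, hF, hr⟩ := List.mem_flatMap.1 hr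
  obtain ⟨ρ, hρ, hr⟩ := List.mem_flatMap.1 hr
  obtain ⟨k, hk, rfl⟩ := List.mem_map.1 hr
  have hk := List.mem_range.1 hk
  have hP := families_isParabolic F hF ρ hρ
  obtain ⟨h1, h2, h3, -⟩ := families_isComplete F hF ρ hρ k hk
  have h4 := (families_isComplete F hF ρ hρ 0 (by omega)).1
  have hsub : ∀ x ∈ (F.system ρ k).support, x ∈ lat (F.system ρ 0).support := by
    intro x hx
    obtain ⟨v, hv, rfl⟩ := System.mem_support.1 hx
    rw [← Family.basisSet_mask hP]
    exact (h3 v hv).mem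
  refine ⟨h1, h4, ⟨_, (Family.basisSet_mask hP).symm⟩, hsub, fun x hx => ?_⟩
  exact (System.isSimple h1).full_of_card (System.isSimple h4) hsub
    (by rw [System.card_support h1, System.card_support h4, h2]) hx

/-! ### Primitive closures and overlattices -/

section Rational

variable {M : Type*} [AddCommGroup M] [Module ℤ M]

theorem tmul_one_injective [Module.Free ℤ M] :
    Function.Injective fun x : M => (1 : ℚ) ⊗ₜ[ℤ] x :=
  Module.Flat.tensorProduct_mk_injective ℤ M ℚ

theorem one_tmul_zsmul (k : ℤ) (x : M) :
    (1 : ℚ) ⊗ₜ[ℤ] (k • x) = (k : ℚ) • ((1 : ℚ) ⊗ₜ[ℤ] x) := by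
  rw [Int.cast_smul_eq_zsmul]
  exact map_zsmul (TensorProduct.mk ℤ ℚ M 1) k x

theorem exists_smul_eq_tmul (z : ℚ ⊗[ℤ] M) :
    ∃ k : ℤ, k ≠ 0 ∧ ∃ x : M, (k : ℚ) • z = (1 : ℚ) ⊗ₜ[ℤ] x := by
  induction z using TensorProduct.induction_on with
  | zero => exact ⟨1, one_ne_zero, 0, by simp⟩
  | tmul q m =>
    refine ⟨q.den, by exact_mod_cast q.den_ne_zero, q.num • m, ?_⟩
    rw [one_tmul_zsmul, TensorProduct.smul_tmul', TensorProduct.smul_tmul']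
    congr 1
    rw [smul_eq_mul, smul_eq_mul, mul_one]
    exact_mod_cast Rat.den_mul_eq_num q
  | add z w hz hw =>
    obtain ⟨k, hk, x, hx⟩ := hz
    obtain ⟨l, hl, y, hy⟩ := hw
    refine ⟨k * l, mul_ne_zero hk hl, l • x + k • y, ?_⟩
    rw [smul_add, TensorProduct.tmul_add, one_tmul_zsmul, one_tmul_zsmul, ← hx, ← hy, smul_smul,
      smul_smul, Int.cast_mul, mul_comm (l : ℚ)]

theorem mem_primitiveClosure [Module.Free ℤ M] {R : Submodule ℤ M} {x : M} :
    x ∈ primitiveClosure R ↔ ∃ k : ℤ, k ≠ 0 ∧ k • x ∈ R := by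
  change (1 : ℚ) ⊗ₜ[ℤ] x ∈ R.baseChange ℚ ↔ _
  rw [Submodule.baseChange_eq_span]
  constructor
  · intro h
    have key : ∀ z ∈ Submodule.span ℚ ((R.map (TensorProduct.mk ℤ ℚ M 1) :
        Submodule ℤ (ℚ ⊗[ℤ] M)) : Set (ℚ ⊗[ℤ] M)),
        ∃ k : ℤ, k ≠ 0 ∧ ∃ r ∈ R, (k : ℚ) • z = (1 : ℚ) ⊗ₜ[ℤ] r := by
      intro z hz
      induction hz using Submodule.span_induction with
      | mem z hz =>
        obtain ⟨r, hr, rfl⟩ := hz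
        exact ⟨1, one_ne_zero, r, hr, by rw [Int.cast_one, one_smul]; rfl⟩
      | zero => exact ⟨1, one_ne_zero, 0, zero_mem _, by simp⟩
      | add z w _ _ hz hw =>
        obtain ⟨k, hk, r, hr, hkr⟩ := hz
        obtain ⟨l, hl, s, hs, hls⟩ := hw
        refine ⟨k * l, mul_ne_zero hk hl, l • r + k • s,
          add_mem (zsmul_mem hr l) (zsmul_mem hs k), ?_⟩
        rw [smul_add, TensorProduct.tmul_add, one_tmul_zsmul, one_tmul_zsmul, ← hkr, ← hls,
          smul_smul, smul_smul, Int.cast_mul, mul_comm (l : ℚ)]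
      | smul q z _ hz =>
        obtain ⟨k, hk, r, hr, hkr⟩ := hz
        refine ⟨q.den * k, mul_ne_zero (by exact_mod_cast q.den_ne_zero) hk, q.num • r,
          zsmul_mem hr _, ?_⟩
        rw [one_tmul_zsmul, ← hkr, smul_smul, smul_smul, ← Rat.den_mul_eq_num q]
        push_cast
        congr 1
        ring
    obtain ⟨k, hk, r, hr, h⟩ := key _ h
    refine ⟨k, hk, ?_⟩
    rw [← one_tmul_zsmul] at h
    rwa [tmul_one_injective h]
  · rintro ⟨k, hk, hkx⟩
    have hk' : (k : ℚ) ≠ 0 := by exact_mod_cast hk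
    have h : (1 : ℚ) ⊗ₜ[ℤ] x = (k : ℚ)⁻¹ • ((1 : ℚ) ⊗ₜ[ℤ] (k • x)) := by
      rw [one_tmul_zsmul, smul_smul, inv_mul_cancel₀ hk', one_smul]
    rw [h]
    exact Submodule.smul_mem _ _ (Submodule.subset_span ⟨k • x, hkx, rfl⟩)

variable {M' : Type*} [AddCommGroup M'] [Module ℤ M'] {B : BilinForm ℤ M} {B' : BilinForm ℤ M'}

/-- An even lattice containing an isometric copy of `(M, B)` of finite index is an even overlattice
of it. -/
theorem hasEvenOverlattice_of_isometry [Module.Free ℤ M'] (i : M →ₗ[ℤ] M')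
    (hi : Function.Injective i) (hB : ∀ x y, B' (i x) (i y) = B x y)
    (hfull : ∀ y, ∃ k : ℤ, k ≠ 0 ∧ ∃ x, i x = k • y) (heven : ∀ y, Even (B' y y)) :
    HasEvenOverlattice B B' := by
  let iQ : ℚ ⊗[ℤ] M →ₗ[ℚ] ℚ ⊗[ℤ] M' := i.baseChange ℚ
  have hinj : Function.Injective iQ := by
    have h := Module.Flat.lTensor_preserves_injective_linearMap (M := ℚ) i hi
    rwa [← LinearMap.baseChange_eq_ltensor] at h
  have hsurj : ∀ y : M', ∃ z, iQ z = (1 : ℚ) ⊗ₜ[ℤ] y := by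
    intro y
    obtain ⟨k, hk, x, hx⟩ := hfull y
    have hk' : (k : ℚ) ≠ 0 := by exact_mod_cast hk
    refine ⟨(k : ℚ)⁻¹ • ((1 : ℚ) ⊗ₜ[ℤ] x), ?_⟩
    rw [map_smul, LinearMap.baseChange_tmul, hx, one_tmul_zsmul, smul_smul, inv_mul_cancel₀ hk',
      one_smul]
  have hform : ∀ z w, B'.baseChange ℚ (iQ z) (iQ w) = B.baseChange ℚ z w := by
    intro z w
    induction z using TensorProduct.induction_on with
    | zero => simp
    | add z z' hz hz' => simp only [map_add, LinearMap.add_apply, hz, hz']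
    | tmul q m =>
      induction w using TensorProduct.induction_on with
      | zero => simp
      | add w w' hw hw' => simp only [map_add, hw, hw']
      | tmul q' m' =>
        rw [LinearMap.baseChange_tmul, LinearMap.baseChange_tmul, BilinForm.baseChange_tmul,
          BilinForm.baseChange_tmul, hB]
  -- the overlattice is the preimage of `M'`
  let N : Submodule ℤ (ℚ ⊗[ℤ] M) := (rationalImage M').comap (iQ.restrictScalars ℤ)
  choose f hf using hsurj
  have hfN : ∀ y, f y ∈ N := fun y => ⟨y, (hf y).symm⟩
  have hint : ∀ z w y y', iQ z = (1 : ℚ) ⊗ₜ[ℤ] y → iQ w = (1 : ℚ) ⊗ₜ[ℤ] y' →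
      B.baseChange ℚ z w = B' y y' := by
    intro z w y y' h h'
    rw [← hform, h, h', BilinForm.baseChange_tmul]
    simp
  have hMN : rationalImage M ≤ N := by
    rintro _ ⟨x, rfl⟩
    exact ⟨i x, (LinearMap.baseChange_tmul (A := ℚ) i 1 x).symm⟩
  have hNint : ∀ x ∈ N, ∀ y ∈ N, ∃ k : ℤ, B.baseChange ℚ x y = k := by
    rintro x ⟨x', hx⟩ y ⟨y', hy⟩
    exact ⟨_, hint x y x' y' hx.symm hy.symm⟩
  have hadd : ∀ y y', f (y + y') = f y + f y' := fun y y' => hinj (by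
    rw [map_add, hf, hf, hf, TensorProduct.tmul_add])
  let φ₀ : M' →+ N :=
    AddMonoidHom.mk' (fun y => ⟨f y, hfN y⟩) fun y y' => Subtype.ext (hadd y y')
  let φ : M' →ₗ[ℤ] N :=
    { φ₀ with map_smul' := fun k y => by simpa using map_intCast_smul φ₀ ℤ ℤ k y }
  have hφ : Function.Bijective φ := by
    constructor
    · intro y y' h
      have h1 : f y = f y' := congrArg Subtype.val h
      have h2 := congrArg iQ h1
      rw [hf, hf] at h2
      exact tmul_one_injective h2
    · rintro ⟨z, y, hz⟩
      refine ⟨y, Subtype.ext (hinj ?_)⟩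
      change iQ (f y) = iQ z
      rw [hf]
      exact hz
  refine ⟨N, ⟨hMN, fun x hx => ?_, hNint, ?_⟩, LinearEquiv.ofBijective φ hφ, fun x y => ?_⟩
  · refine (BilinForm.mem_dualSubmodule _).2 fun y hy => ?_
    obtain ⟨k, hk⟩ := hNint x hx y (hMN hy)
    rw [hk]
    exact Submodule.mem_one.2 ⟨k, rfl⟩
  · rintro x ⟨x', hx⟩
    obtain ⟨k, hk⟩ := heven x'
    refine ⟨k, ?_⟩
    rw [hint x x x' x' hx.symm hx.symm, hk]
    push_cast
    ring
  · exact hint _ _ _ _ (hf x) (hf y)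

/-- An even overlattice contains the lattice isometrically and with finite index. -/
theorem HasEvenOverlattice.exists_isometry (h : HasEvenOverlattice B B') :
    ∃ i : M →ₗ[ℤ] M', (∀ x y, B' (i x) (i y) = B x y) ∧
      ∀ y, ∃ k : ℤ, k ≠ 0 ∧ ∃ x, i x = k • y := by
  obtain ⟨N, hN, φ, hφ⟩ := h
  let j : M →ₗ[ℤ] N := (TensorProduct.mk ℤ ℚ M 1).codRestrict N fun x => hN.le ⟨x, rfl⟩
  refine ⟨φ.symm.toLinearMap ∘ₗ j, fun x y => ?_, fun y => ?_⟩
  · have h1 := hφ (φ.symm (j x)) (φ.symm (j y))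
    rw [φ.apply_symm_apply, φ.apply_symm_apply] at h1
    have h2 : B.baseChange ℚ ((1 : ℚ) ⊗ₜ[ℤ] x) ((1 : ℚ) ⊗ₜ[ℤ] y) = (B x y : ℚ) := by
      rw [BilinForm.baseChange_tmul]
      simp
    have h3 : ((B' (φ.symm (j x)) (φ.symm (j y)) : ℤ) : ℚ) = (B x y : ℤ) := h1.symm.trans h2
    exact_mod_cast h3
  · obtain ⟨k, hk, x, hx⟩ := exists_smul_eq_tmul (φ y : ℚ ⊗[ℤ] M)
    refine ⟨k, hk, x, ?_⟩
    change φ.symm (j x) = _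
    rw [LinearEquiv.symm_apply_eq]
    refine Subtype.ext (hx.symm.trans ?_)
    rw [map_zsmul φ k y, Int.cast_smul_eq_zsmul]
    rfl

end Rational

/-! ### Types of sublattices of `L₁₀` -/

theorem IsADEConfiguration.image_of_isometry {M M' : Type*} [AddCommGroup M] [Module ℤ M]
    [AddCommGroup M'] [Module ℤ M'] [DecidableEq M] [DecidableEq M'] {B : BilinForm ℤ M}
    {B' : BilinForm ℤ M'} (hs : ∀ x y, B x y = B y x) {Φ : Finset M}
    (hΦ : IsADEConfiguration B Φ) (f : M → M')
    (hf : ∀ x ∈ Φ, ∀ y ∈ Φ, B' (f x) (f y) = B x y) :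
    IsADEConfiguration B' (Φ.image f) ∧ configType B' (Φ.image f) = configType B Φ := by
  obtain ⟨v, hvΦ, hv⟩ := hΦ.exists_gram hs
  have hmem : ∀ p, v p ∈ Φ := fun p => by
    have h := Finset.mem_image_of_mem v (Finset.mem_univ p)
    rwa [hvΦ] at h
  have h : ∀ p q, B' ((f ∘ v) p) ((f ∘ v) q) =
      sigmaGram (fun c : (configType B Φ).ToType => c.1) p q := fun p q =>
    (hf _ (hmem p) _ (hmem q)).trans (hv p q)
  have himage : Φ.image f = Finset.univ.image (f ∘ v) := by
    rw [← Finset.image_image, hvΦ]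
  rw [himage]
  exact ⟨isADEConfiguration_of_gram h, (configType_of_gram h).trans (Multiset.map_univ_coe _)⟩

theorem apply_mem_lat_image (g : L10 ≃ₗ[ℤ] L10) {J : Finset L10} {x : L10} :
    g x ∈ lat (J.image g) ↔ x ∈ lat J := by
  have h : lat (J.image g) = (lat J).map (g : L10 →ₗ[ℤ] L10) := by
    rw [Submodule.map_span, lat, Finset.coe_image]
    rfl
  rw [h, Submodule.mem_map_equiv, g.symm_apply_apply]

section Sublattice

variable {S : Submodule ℤ L10}

theorem restrict_apply (x y : S) : form10.restrict S x y = form10 x y := rfl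

theorem span_eq_top_iff {Ψ : Finset S} :
    Submodule.span ℤ (Ψ : Set S) = ⊤ ↔ lat (Ψ.image Subtype.val) = S := by
  have h : lat (Ψ.image Subtype.val) = (Submodule.span ℤ (Ψ : Set S)).map S.subtype := by
    rw [Submodule.map_span, lat, Finset.coe_image]
    rfl
  rw [h]
  constructor
  · intro h1
    rw [h1, Submodule.map_subtype_top]
  · intro h1
    refine Submodule.map_injective_of_injective S.subtype_injective ?_
    rw [h1, Submodule.map_subtype_top]

theorem linearIndependent_of_image {Ψ : Finset S} (hJ : IsSimple (Ψ.image Subtype.val)) :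
    LinearIndependent ℤ (fun x : Ψ => (x : S)) := by
  classical
  rw [Fintype.linearIndependent_iff]
  intro g hg
  have h1 : comb (Ψ.image Subtype.val) (fun y =>
      if h : ∃ hy : y ∈ S, (⟨y, hy⟩ : S) ∈ Ψ then g ⟨⟨y, h.1⟩, h.2⟩ else 0) = 0 := by
    have h2 := congrArg S.subtype hg
    rw [map_sum, map_zero] at h2
    rw [comb, Finset.sum_image fun x _ y _ h => Subtype.ext h, ← Finset.sum_coe_sort, ← h2]
    refine Finset.sum_congr rfl fun x _ => ?_
    rw [dif_pos (⟨x.1.2, x.2⟩ : ∃ hy : (x : L10) ∈ S, (⟨x, hy⟩ : S) ∈ Ψ), map_smul]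
    rfl
  intro x
  have h3 := hJ.coeff_eq_zero h1 x.1 (Finset.mem_image_of_mem _ x.2)
  rwa [dif_pos (⟨x.1.2, x.2⟩ : ∃ hy : (x : L10) ∈ S, (⟨x, hy⟩ : S) ∈ Ψ)] at h3

theorem exists_isADEBasis {J : Finset L10} (hJ : IsADEConfiguration form10 J) (h : lat J = S) :
    ∃ Ψ, IsADEBasis (form10.restrict S) Ψ := by
  classical
  let f : L10 → S := fun x => if hx : x ∈ S then ⟨x, hx⟩ else 0
  have hf : ∀ x ∈ J, (f x : L10) = x := fun x hx => by
    simp only [f]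
    rw [dif_pos (h ▸ mem_lat hx)]
  have himage : (J.image f).image Subtype.val = J := by
    rw [Finset.image_image]
    exact (Finset.image_congr hf).trans Finset.image_id
  refine ⟨J.image f, ?_, linearIndependent_of_image (himage.symm ▸ hJ.isSimple),
    span_eq_top_iff.2 (by rw [himage, h])⟩
  exact (hJ.image_of_isometry form10_comm f fun x hx y hy => by
    rw [restrict_apply, hf x hx, hf y hy]).1

/-- The type of a sublattice is that of any of its bases that are ADE-configurations, because two
such bases are conjugate under the Weyl group. -/
theorem latticeType_eq {J : Finset L10} (hJ : IsADEConfiguration form10 J) (h : lat J = S) :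
    latticeType (form10.restrict S) = configType form10 J := by
  have hex := exists_isADEBasis hJ h
  rw [latticeType, dif_pos hex]
  obtain ⟨hΨ, -, hspan⟩ := hex.choose_spec
  generalize hex.choose = Ψ at hΨ hspan
  obtain ⟨h1, h2⟩ := IsADEConfiguration.image_of_isometry (B := form10.restrict S) (B' := form10)
    (fun x y => form10_comm (x : L10) y) hΨ (fun x : S => (x : L10)) fun x _ y _ => rfl
  obtain ⟨w, hw, hwJ⟩ := exists_weyl_image_eq hJ.isSimple h1.isSimple
    ((span_eq_top_iff.1 hspan).trans h.symm)
  rw [← h2, ← hwJ]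
  exact ((h1.image_of_isometry form10_comm w fun x _ y _ => weyl_form hw x y).2).symm

theorem isRootLattice_restrict {J : Finset L10} (hJ : IsADEConfiguration form10 J)
    (h : lat J = S) : IsRootLattice (form10.restrict S) := by
  obtain ⟨Ψ, hΨ⟩ := exists_isADEBasis hJ h
  have hsep : ∀ x : S, form10 x x = 0 → x = 0 := by
    intro x hx
    by_contra h0
    have := hJ.isSimple.neg_of_mem (h.symm ▸ x.2) fun h1 => h0 (Subtype.ext h1)
    omega
  refine ⟨⟨inferInstance, inferInstance, ⟨fun x y => form10_comm x y⟩, ?_, ?_⟩, ?_⟩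
  · exact fun x hx => hsep x (hx x)
  · exact fun x hx => hsep x (hx x)
  · rw [eq_top_iff, ← hΨ.span_eq_top]
    exact Submodule.span_mono fun x hx => hΨ.isADEConfiguration.isRoot x hx

end Sublattice

theorem mem_closure_image (g : L10 ≃ₗ[ℤ] L10) {Φ : Finset L10} {x : L10} :
    g x ∈ primitiveClosure (generated (Φ.image g)) ↔ x ∈ primitiveClosure (generated Φ) := by
  rw [mem_primitiveClosure, mem_primitiveClosure]
  refine exists_congr fun k => and_congr_right fun _ => ?_
  rw [← map_zsmul g]
  exact apply_mem_lat_image g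

/-- The lattice of a subset of the basis is primitive, so that it is the primitive closure of any of
its sublattices of full rank. -/
theorem primitiveClosure_eq {Φ : Finset L10} {I : Finset (Fin 10)}
    (hsub : ∀ x ∈ Φ, x ∈ lat (basisSet I))
    (hfull : ∀ x ∈ lat (basisSet I), ∃ k : ℤ, k ≠ 0 ∧ k • x ∈ lat Φ) :
    primitiveClosure (generated Φ) = lat (basisSet I) := by
  ext x
  rw [mem_primitiveClosure]
  refine ⟨fun ⟨k, hk, hkx⟩ => ?_, hfull x⟩
  have h1 : lat Φ ≤ lat (basisSet I) := Submodule.span_le.2 hsub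
  have h2 := mem_lat_basisSet.1 (h1 hkx)
  exact mem_lat_basisSet.2 fun i hi => h2 i (by
    rw [Pi.smul_apply, smul_eq_mul]
    exact mul_ne_zero hk hi)

/-- The primitive closure of the lattice of a configuration, in terms of a representative. -/
theorem exists_closure_basis {Φ : Finset L10} {r : System × System} (hr : r ∈ representatives)
    {g : L10 ≃ₗ[ℤ] L10} (hg : g ∈ OPlus) (h : Φ.image g = r.1.support) :
    ∃ J, IsADEConfiguration form10 J ∧ lat J = primitiveClosure (generated Φ) ∧
      J.image g = r.2.support := by
  obtain ⟨-, h2, ⟨I, hI⟩, hsub, hfull⟩ := representative_spec hr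
  have hJ : (r.2.support.image g.symm).image g = r.2.support := by
    rw [Finset.image_image]
    exact (Finset.image_congr fun x _ => g.apply_symm_apply x).trans Finset.image_id
  have hiso : ∀ x y, form10 (g.symm x) (g.symm y) = form10 x y := fun x y => by
    rw [← OPlus_form hg, g.apply_symm_apply, g.apply_symm_apply]
  refine ⟨r.2.support.image g.symm, ((System.isADEConfiguration h2).image_of_isometry form10_comm
    g.symm fun x _ y _ => hiso x y).1, ?_, hJ⟩
  rw [hI] at hsub hfull hJ ⊢
  ext x
  rw [← mem_closure_image g, h, primitiveClosure_eq hsub hfull, ← apply_mem_lat_image g, hJ]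

/-- A configuration and its primitive closure have the types of any representative of its orbit. -/
theorem types_of_representative {Φ : Finset L10} (hΦ : IsADEConfiguration form10 Φ)
    {r : System × System} (hr : r ∈ representatives)
    {g : L10 ≃ₗ[ℤ] L10} (hg : g ∈ OPlus) (h : Φ.image g = r.1.support) :
    configType form10 Φ = ((r.1.map Block.label : List Label) : ADEType) ∧
      latticeType (closureForm Φ) = ((r.2.map Block.label : List Label) : ADEType) := by
  obtain ⟨h1, h2, -⟩ := representative_spec hr
  obtain ⟨J, hJ, hlat, hJr⟩ := exists_closure_basis hr hg h
  have hiso : ∀ {Φ}, IsADEConfiguration form10 Φ →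
      configType form10 (Φ.image g) = configType form10 Φ := fun hΦ =>
    (hΦ.image_of_isometry form10_comm g fun x _ y _ => OPlus_form hg x y).2
  constructor
  · rw [← hiso hΦ, h, System.configType_support h1]
  · rw [closureForm, latticeType_eq hJ hlat, ← hiso hJ, hJr, System.configType_support h2]

/-- A representative is determined by the types of its two systems. -/
theorem representative_eq {r r' : System × System} (hr : r ∈ representatives)
    (hr' : r' ∈ representatives)
    (h1 : ((r.1.map Block.label : List Label) : ADEType) = (r'.1.map Block.label : List Label))
    (h2 : ((r.2.map Block.label : List Label) : ADEType) = (r'.2.map Block.label : List Label)) :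
    r = r' := by
  have key : ∀ s s' : System,
      ((s.map Block.label : List Label) : ADEType) = (s'.map Block.label : List Label) →
        s.code = s'.code := by
    intro s s' h
    have h1 := congrArg (fun m : ADEType => (m.map Label.code).sum) h
    simp only [Multiset.map_coe, List.map_map, Multiset.sum_coe] at h1
    exact h1
  exact List.inj_on_of_nodup_map nodup_code hr hr' (Prod.ext (key _ _ h1) (key _ _ h2))

/-! ### Overlattices realised in `L₁₀` -/

section Realisation

theorem form10_linearCombination {ι : Type*} [Fintype ι] [DecidableEq ι] {v : ι → L10}
    {G : Matrix ι ι ℤ} (hv : ∀ p q, form10 (v p) (v q) = G p q) (x y : ι → ℤ) :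
    form10 (Fintype.linearCombination ℤ v x) (Fintype.linearCombination ℤ v y) =
      Matrix.toBilin' G x y := by
  refine Eq.trans ?_ (Matrix.toBilin'_apply G x y).symm
  simp only [Fintype.linearCombination_apply, map_sum, LinearMap.sum_apply, map_smul,
    LinearMap.smul_apply, smul_eq_mul, hv]
  simp only [Finset.mul_sum]
  rw [Finset.sum_comm]
  exact Finset.sum_congr rfl fun p _ => Finset.sum_congr rfl fun q _ => by ring

theorem range_linearCombination {ι : Type*} [Fintype ι] (v : ι → L10) :
    LinearMap.range (Fintype.linearCombination ℤ v) = lat (Finset.univ.image v) := by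
  rw [Fintype.range_linearCombination, lat, Finset.coe_image, Finset.coe_univ, Set.image_univ]

variable {t t' : ADEType}

theorem linearCombination_injective {v : Vertex t → L10}
    (hv : ∀ p q, form10 (v p) (v q) = gram t p q) :
    Function.Injective (Fintype.linearCombination ℤ v) := by
  rw [injective_iff_map_eq_zero]
  intro x hx
  by_contra h0
  have h1 := form10_linearCombination hv x x
  rw [hx, map_zero, Matrix.toBilin'_apply] at h1
  have h2 := negDef_sigmaGram (fun c : t.ToType => c.1) x h0
  exact absurd h1.symm h2.ne

/-- A sublattice of finite index of a lattice in `L₁₀` has it as an even overlattice. -/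
theorem hasEvenOverlattice_of_gram {v : Vertex t → L10} {u : Vertex t' → L10}
    (hv : ∀ p q, form10 (v p) (v q) = gram t p q)
    (hu : ∀ p q, form10 (u p) (u q) = gram t' p q)
    {Φ J : Finset L10} (hΦ : Finset.univ.image v = Φ) (hJ : Finset.univ.image u = J)
    (hsub : ∀ x ∈ Φ, x ∈ lat J) (hfull : ∀ x ∈ lat J, ∃ k : ℤ, k ≠ 0 ∧ k • x ∈ lat Φ) :
    HasEvenOverlattice (rootForm t) (rootForm t') := by
  subst hΦ hJ
  have hu' := linearCombination_injective hu
  let e := LinearEquiv.ofInjective (Fintype.linearCombination ℤ u) hu'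
  have hmem : ∀ x, Fintype.linearCombination ℤ v x ∈
      LinearMap.range (Fintype.linearCombination ℤ u) := by
    intro x
    rw [range_linearCombination, Fintype.linearCombination_apply]
    exact Submodule.sum_mem _ fun p _ => Submodule.smul_mem _ _
      (hsub _ (Finset.mem_image_of_mem v (Finset.mem_univ p)))
  let i : RootLattice t →ₗ[ℤ] RootLattice t' :=
    e.symm.toLinearMap ∘ₗ (Fintype.linearCombination ℤ v).codRestrict _ hmem
  have hi : ∀ x, Fintype.linearCombination ℤ u (i x) = Fintype.linearCombination ℤ v x := by
    intro x
    exact congrArg Subtype.val (e.apply_symm_apply ⟨Fintype.linearCombination ℤ v x, hmem x⟩)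
  refine hasEvenOverlattice_of_isometry i (fun x y h => linearCombination_injective hv ?_)
    (fun x y => ?_) (fun y => ?_) fun y => ?_
  · rw [← hi, ← hi, h]
  · rw [rootForm, rootForm, ← form10_linearCombination hu, ← form10_linearCombination hv, hi, hi]
  · obtain ⟨k, hk, hkx⟩ := hfull (Fintype.linearCombination ℤ u y)
      (range_linearCombination u ▸ LinearMap.mem_range_self _ y)
    rw [← range_linearCombination] at hkx
    obtain ⟨x, hx⟩ := hkx
    refine ⟨k, hk, x, hu' ?_⟩
    rw [hi, hx, map_smul]
  · rw [rootForm, ← form10_linearCombination hu]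
    exact even_form10 _

/-- An even overlattice of `R(t)` whose diagram is part of that of `E₁₀` is the primitive closure of
a configuration of type `t`. -/
theorem exists_configuration (h : HasEvenOverlattice (rootForm t) (rootForm t'))
    (emb : typeDiagram t' ↪g diagramE10) :
    ∃ Φ : Finset L10, IsADEConfiguration form10 Φ ∧ configType form10 Φ = t ∧
      latticeType (closureForm Φ) = t' := by
  obtain ⟨i, hi, hfull⟩ := h.exists_isometry
  let u : Vertex t' → L10 := fun p => basisVec (emb p)
  have hu : ∀ p q, form10 (u p) (u q) = gram t' p q := by
    intro p q
    rw [form10_basisVec]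
    by_cases hpq : p = q
    · subst hpq
      exact (gramE10_diag _).trans (sigmaGram_diag (fun c : t'.ToType => c.1) p).symm
    · have hne : emb p ≠ emb q := fun h => hpq (emb.injective h)
      have h1 : gramE10 (emb p) (emb q) = 1 ↔ gram t' p q = 1 := by
        refine Iff.trans ?_ ((emb.map_adj_iff (v := p) (w := q)).trans
          (sigmaDiagram_adj (fun c : t'.ToType => c.1) p q))
        refine Iff.trans ?_ (dynkinDiagram_adj _ _ _).symm
        rw [← form10_basisVec, ← form10_basisVec, form10_comm (basisVec (emb q)), or_self]
        exact ⟨fun h => ⟨hne, h⟩, fun h => h.2⟩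
      have h2 : gram t' p q = 0 ∨ gram t' p q = 1 :=
        sigmaGram_off_diag (fun c : t'.ToType => c.1) hpq
      rcases gramE10_off_diag _ _ hne with h | h <;> rcases h2 with h' | h' <;> omega
  let v : Vertex t → L10 := fun p => Fintype.linearCombination ℤ u (i (Pi.single p 1))
  have hv : ∀ p q, form10 (v p) (v q) = gram t p q := by
    intro p q
    rw [form10_linearCombination hu]
    refine (hi _ _).trans ?_
    rw [rootForm, Matrix.toBilin'_single]
  have hcomp : ∀ x, Fintype.linearCombination ℤ v x = Fintype.linearCombination ℤ u (i x) := by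
    intro x
    have h1 : x = ∑ p, x p • Pi.single p 1 := by
      ext q
      simp [Finset.sum_apply, Pi.single_apply]
    conv_rhs => rw [h1]
    rw [Fintype.linearCombination_apply, map_sum, map_sum]
    exact Finset.sum_congr rfl fun p _ => by rw [map_smul, map_smul]
  have hI : basisSet (Finset.univ.image emb) = Finset.univ.image u := Finset.image_image
  have hJ : IsADEConfiguration form10 (Finset.univ.image u) :=
    isADEConfiguration_of_gram (X := fun c : t'.ToType => c.1) hu
  have hclosure : primitiveClosure (generated (Finset.univ.image v)) =
      lat (basisSet (Finset.univ.image emb)) := by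
    refine primitiveClosure_eq (fun x hx => ?_) fun x hx => ?_
    · obtain ⟨p, -, rfl⟩ := Finset.mem_image.1 hx
      rw [hI, ← range_linearCombination]
      exact LinearMap.mem_range_self _ _
    · rw [hI, ← range_linearCombination] at hx
      obtain ⟨y, rfl⟩ := hx
      obtain ⟨k, hk, z, hz⟩ := hfull y
      refine ⟨k, hk, ?_⟩
      rw [← range_linearCombination]
      refine ⟨z, ?_⟩
      rw [hcomp, hz, map_smul]
  refine ⟨Finset.univ.image v, isADEConfiguration_of_gram (X := fun c : t.ToType => c.1) hv,
    (configType_of_gram (X := fun c : t.ToType => c.1) hv).trans (Multiset.map_univ_coe t), ?_⟩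
  exact (latticeType_eq hJ ((congrArg lat hI).symm.trans hclosure.symm)).trans <|
    (configType_of_gram (X := fun c : t'.ToType => c.1) hu).trans (Multiset.map_univ_coe t')

end Realisation

/-! ### Configurations and their types -/

/-- A configuration of type `t` whose primitive closure has type `t'` satisfies the conditions
characterising such pairs. -/
theorem conditions_of_configuration {Φ : Finset L10} (hΦ : IsADEConfiguration form10 Φ) :
    Module.finrank ℤ (RootLattice (configType form10 Φ)) < 10 ∧
      HasEvenOverlattice (rootForm (configType form10 Φ))
        (rootForm (latticeType (closureForm Φ))) ∧
      Nonempty (typeDiagram (latticeType (closureForm Φ)) ↪g diagramE10) := by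
  obtain ⟨r, hr, g, hg, hgΦ⟩ := exists_representative hΦ.isSimple
  obtain ⟨h1, h2, ⟨I, hI⟩, -⟩ := representative_spec hr
  obtain ⟨J, hJ, hlat, hJr⟩ := exists_closure_basis hr hg hgΦ
  obtain ⟨v, hvΦ, hv⟩ := hΦ.exists_gram form10_comm
  rw [closureForm, latticeType_eq hJ hlat]
  refine ⟨?_, ?_, ?_⟩
  · have hcard : Φ.card = r.1.rank := by
      rw [← System.card_support h1, ← hgΦ, Finset.card_image_of_injective _ g.injective]
    have hlt : r.1.rank < 10 := rank_representative_lt r hr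
    have hv' := Finset.card_image_of_injective Finset.univ (injective_of_gram hv)
    rw [hvΦ, hcard] at hv'
    rw [Module.finrank_fintype_fun_eq_card, ← Finset.card_univ]
    exact hv' ▸ hlt
  · obtain ⟨u, huJ, hu⟩ := hJ.exists_gram form10_comm
    refine hasEvenOverlattice_of_gram hv hu hvΦ huJ (fun x hx => ?_) fun x hx => ?_
    · rw [hlat, mem_primitiveClosure]
      exact ⟨1, one_ne_zero, (one_zsmul x).symm ▸ mem_lat hx⟩
    · rw [hlat, mem_primitiveClosure] at hx
      exact hx
  · have hKJ : configType form10 (J.image g) = configType form10 J :=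
      (hJ.image_of_isometry form10_comm g fun x _ y _ => OPlus_form hg x y).2
    have hK : IsADEConfiguration form10 (basisSet I) := by
      rw [← hI]; exact System.isADEConfiguration h2
    rw [← hKJ, hJr, hI]
    obtain ⟨u, huI, hu⟩ := hK.exists_gram form10_comm
    have hmem : ∀ p, ∃ i, basisVec i = u p := by
      intro p
      have h3 := Finset.mem_image_of_mem u (Finset.mem_univ p)
      rw [huI] at h3
      obtain ⟨i, -, hi⟩ := Finset.mem_image.1 h3
      exact ⟨i, hi⟩
    choose f hf using hmem
    have hfinj : Function.Injective f := fun p q h => injective_of_gram hu (by rw [← hf, ← hf, h])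
    have hgram : ∀ p q, gramE10 (f p) (f q) =
        sigmaGram (fun c : (configType form10 (basisSet I)).ToType => c.1) p q := by
      intro p q
      rw [← form10_basisVec, hf, hf, hu]
    have hne : ∀ p q, sigmaGram (fun c : (configType form10 (basisSet I)).ToType => c.1) p q = 1 →
        f p ≠ f q := by
      intro p q h hpq
      rw [hfinj hpq, sigmaGram_diag] at h
      omega
    have hiff : ∀ p q, (f p ≠ f q ∧ (gramE10 (f p) (f q) = 1 ∨ gramE10 (f q) (f p) = 1)) ↔
        sigmaGram (fun c : (configType form10 (basisSet I)).ToType => c.1) p q = 1 := by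
      intro p q
      rw [← form10_basisVec (f q), form10_comm (basisVec (f q)), form10_basisVec, or_self, hgram]
      exact ⟨fun h => h.2, fun h => ⟨hne p q h, h⟩⟩
    refine ⟨⟨⟨f, hfinj⟩, fun {p q} => ?_⟩⟩
    exact (dynkinDiagram_adj _ _ _).trans ((hiff p q).trans (sigmaDiagram_adj _ p q).symm)

theorem image_eq_iff {g : L10 ≃ₗ[ℤ] L10} {Φ Φ' : Finset L10} :
    g '' (Φ : Set L10) = (Φ' : Set L10) ↔ Φ.image g = Φ' := by
  rw [← Finset.coe_image, Finset.coe_inj]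

/-- Configurations are classified by their type and the type of the primitive closure. -/
theorem equivalent_iff {Φ Φ' : Finset L10} (hΦ : IsADEConfiguration form10 Φ)
    (hΦ' : IsADEConfiguration form10 Φ') :
    Equivalent Φ Φ' ↔ configType form10 Φ = configType form10 Φ' ∧
      latticeType (closureForm Φ) = latticeType (closureForm Φ') := by
  obtain ⟨r, hr, g, hg, hgΦ⟩ := exists_representative hΦ.isSimple
  obtain ⟨h1, h2⟩ := types_of_representative hΦ hr hg hgΦ
  constructor
  · rintro ⟨f, hf, h⟩
    rw [image_eq_iff] at h
    have h3 : Φ'.image (g * f⁻¹) = r.1.support := by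
      rw [← hgΦ, ← h, Finset.image_image]
      refine Finset.image_congr fun x _ => ?_
      change g (f.symm (f x)) = g x
      rw [f.symm_apply_apply]
    obtain ⟨h4, h5⟩ := types_of_representative hΦ' hr (mul_mem hg (inv_mem hf)) h3
    exact ⟨h1.trans h4.symm, h2.trans h5.symm⟩
  · rintro ⟨h3, h4⟩
    obtain ⟨r', hr', g', hg', hgΦ'⟩ := exists_representative hΦ'.isSimple
    obtain ⟨h5, h6⟩ := types_of_representative hΦ' hr' hg' hgΦ'
    obtain rfl := representative_eq hr hr' (h1.symm.trans (h3.trans h5))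
      (h2.symm.trans (h4.trans h6))
    exact equivalent_equivalence.trans ⟨g, hg, image_eq_iff.2 hgΦ⟩
      (equivalent_equivalence.symm ⟨g', hg', image_eq_iff.2 hgΦ'⟩)

theorem System.support_nonempty {s : System} (hs : s.IsStandard) (h : s ≠ []) :
    s.support.Nonempty := by
  obtain ⟨b, l, rfl⟩ := List.exists_cons_of_ne_nil h
  let i : Fin (b :: l : System).length := ⟨0, Nat.succ_pos _⟩
  refine ⟨_, System.mem_support.2 ⟨_, (System.mem_coords hs).2 ⟨i, ⟨0, Label.rank_pos _⟩, rfl⟩, rfl⟩⟩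

/-- The orbits of non-empty configurations correspond to the non-empty representatives. -/
theorem card_quotient : Nat.card (Quotient configurationSetoid) = 184 := by
  let R := representatives.filter fun r => !r.1.isEmpty
  have hR : ∀ i : Fin R.length, R.get i ∈ representatives ∧ (R.get i).1 ≠ [] := by
    intro i
    have h := List.mem_filter.1 (List.get_mem R i)
    refine ⟨h.1, fun h0 => ?_⟩
    have h1 := h.2
    rw [h0] at h1
    exact absurd h1 (by decide)
  have hs : ∀ i, (R.get i).1.IsStandard := fun i => (representative_spec (hR i).1).1
  let f : Fin R.length → Quotient configurationSetoid := fun i =>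
    Quotient.mk _ ⟨(R.get i).1.support, System.isADEConfiguration (hs i),
      System.support_nonempty (hs i) (hR i).2⟩
  have hnodup : R.Nodup := (nodup_code.of_map _).filter _
  have hf : Function.Bijective f := by
    constructor
    · intro i j hij
      have h1 : Equivalent (R.get i).1.support (R.get j).1.support := Quotient.exact hij
      obtain ⟨h2, h3⟩ := (equivalent_iff (System.isADEConfiguration (hs i))
        (System.isADEConfiguration (hs j))).1 h1
      have key : ∀ i, configType form10 (R.get i).1.support =
          (((R.get i).1.map Block.label : List Label) : ADEType) ∧
          latticeType (closureForm (R.get i).1.support) =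
            (((R.get i).2.map Block.label : List Label) : ADEType) := fun i =>
        types_of_representative (System.isADEConfiguration (hs i)) (hR i).1 OPlus.one_mem
          Finset.image_id
      have h4 := representative_eq (hR i).1 (hR j).1
        ((key i).1.symm.trans (h2.trans (key j).1)) ((key i).2.symm.trans (h3.trans (key j).2))
      exact hnodup.injective_get h4
    · intro c
      induction c using Quotient.inductionOn with
      | h Φ =>
        obtain ⟨Φ, hΦ, hne⟩ := Φ
        obtain ⟨r, hr, g, hg, hgΦ⟩ := exists_representative hΦ.isSimple
        have hr0 : r.1 ≠ [] := by
          intro h0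
          rw [h0] at hgΦ
          obtain ⟨x, hx⟩ := hne
          have h1 := Finset.mem_image_of_mem g hx
          rw [hgΦ] at h1
          obtain ⟨y, hy, -⟩ := System.mem_support.1 h1
          exact absurd hy (by simp [System.coords])
        have hrR : r ∈ R := List.mem_filter.2 ⟨hr, by simpa using hr0⟩
        obtain ⟨i, hi⟩ := List.mem_iff_get.1 hrR
        refine ⟨i, Quotient.sound ?_⟩
        change Equivalent (R.get i).1.support Φ
        rw [hi]
        exact equivalent_equivalence.symm ⟨g, hg, image_eq_iff.2 hgΦ⟩
  rw [← Nat.card_eq_of_bijective f hf, Nat.card_eq_fintype_card, Fintype.card_fin]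
  exact length_nonempty_representatives

end ADELattice

open ADELattice

theorem mainTheorem1 :
    (∀ Φ : Finset L10, IsADEConfiguration form10 Φ → IsRootLattice (closureForm Φ)) ∧
    (∀ Φ Φ' : Finset L10, IsADEConfiguration form10 Φ → IsADEConfiguration form10 Φ' →
      (Equivalent Φ Φ' ↔ configType form10 Φ = configType form10 Φ' ∧
        latticeType (closureForm Φ) = latticeType (closureForm Φ'))) ∧
    (∀ t t' : ADEType,
      (∃ Φ : Finset L10, IsADEConfiguration form10 Φ ∧
        configType form10 Φ = t ∧ latticeType (closureForm Φ) = t') ↔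
      (Module.finrank ℤ (RootLattice t) < 10 ∧
        HasEvenOverlattice (rootForm t) (rootForm t') ∧
        Nonempty (typeDiagram t' ↪g diagramE10))) ∧
    Nat.card (Quotient configurationSetoid) = 184 := by
  refine ⟨fun Φ hΦ => ?_, fun Φ Φ' hΦ hΦ' => equivalent_iff hΦ hΦ', fun t t' => ⟨?_, ?_⟩,
    card_quotient⟩
  · obtain ⟨r, hr, g, hg, hgΦ⟩ := exists_representative hΦ.isSimple
    obtain ⟨J, hJ, hlat, -⟩ := exists_closure_basis hr hg hgΦ
    exact isRootLattice_restrict hJ hlat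
  · rintro ⟨Φ, hΦ, rfl, rfl⟩
    exact conditions_of_configuration hΦ
  · rintro ⟨-, h, ⟨emb⟩⟩
    exact exists_configuration h emb
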